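/- Let $n\ge 1$ and $\ell\ge 1$ be integers. Let $V$ be a complex hermitian space (form $\langle\cdot,\cdot\rangle$ conjugate linear in the second variable) with a basis $u_1,u_2,v_1,\dots,v_n$ that is orthogonal with $\langle u_j,u_j\rangle=1$, $\langle v_k,v_k\rangle=-1$. Let $G=\mathrm U(V)=\mathrm U(2,n)$ act on $V$ from the right. Put $V_2^+=\mathrm{span}(u_1,u_2)$, $V_n^-=\mathrm{span}(v_1,\dots,v_n)$, $b_1=\frac1{\sqrt2}(u_1+v_n)$, $b_2=\frac1{\sqrt2}(u_1-v_n)$ and $V_0=\{b_1,b_2\}^\perp=\mathrm{span}(u_2,v_1,\dots,v_{n-1})$. For $x,y\in V$ let $x\otimes\overline y$ denote the endomorphism $v\mapsto\langle v,y\rangle x$; thus $\mathfrak g_0=\mathrm{Lie}(G)$ is spanned over $\mathbb R$ by the $x\otimes\overline y-y\otimes\overline x$. *Subgroups.* $K_\infty=\mathrm U(V_2^+)\times\mathrm U(V_n^-)$ is the stabilizer of $V=V_2^+\oplus V_n^-$. $N$ is the unipotent radical of the stabilizer of the line $\mathbb Cb_1$; it consists of the elements $\exp(w\otimes\overline b_1-b_1\otimes\overline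 w)\exp(t\,i\,b_1\otimes\overline b_1)$ with $w\in V_0$, $t\in\mathbb R$. $M=\mathrm U(V_0)\times\mathbb C^\times$ is the stabilizer of the two lines $\mathbb Cb_1$, $\mathbb Cb_2$, where $(h,z)$ acts by $b_1\mapsto z^{-1}b_1$, $x\mapsto x\cdot h$ $(x\in V_0)$, $b_2\mapsto\overline z b_2$. For $T\in V_0$ let $\chi_T$ be the character of $N$ given by $$\chi_T\big(\exp(w\otimes\overline b_1-b_1\otimes\overline w)\exp(t\,i\,b_1\otimes\overline b_1)\big)=e^{-2\pi i\,\mathrm{Im}\langle T,w\rangle}.$$ *Coefficients.* $\mathbb V_\ell=\mathrm{Sym}^{2\ell}V_2^+\otimes\det^{-\ell}$ is regarded as a (right) representation of $K_\infty$ on which $\mathrm U(V_n^-)$ acts trivially. Write $[u^a]=u^a/a!$ (and $[u^{-1}]=0$), so that the $[u_1^{\ell-v}][u_2^{\ell+v}]$, $-\ell\le v\le\ell$, form a basis of $\mathbb V_\ell$. *Schmid operators.* For $X\in\mathfrak g_0$ and smooth $\varphi:G\to\mathbb V_\ell$ put $X\varphi(g)=\frac{d}{dt}\varphi(g\exp(tX))|_{t=0}$,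 extended $\mathbb C$-linearly to $\mathfrak g=\mathfrak g_0\otimes_{\mathbb R}\mathbb C$; write $\sqrt{-1}$ for the imaginary unit of the second factor. Let $$[u_j\otimes\overline v_k]^\pm=(u_j\otimes\overline v_k-v_k\otimes\overline u_j)\otimes\tfrac12+i(u_j\otimes\overline v_k+v_k\otimes\overline u_j)\otimes\big(\tfrac{\mp\sqrt{-1}}2\big),$$ and let $\mathfrak p^\pm$ be their spans, identified with $V_2^+\otimes\overline{V_n^-}$ and $\overline{V_2^+}\otimes V_n^-$ through $[u_j\otimes\overline v_k]^+\mapsto u_j\otimes\overline v_k$ and $[u_j\otimes\overline v_k]^-\mapsto\overline u_j\otimes v_k$. With $\widetilde{\mathcal D}_\ell^\pm\varphi=\sum_\gamma X_\gamma^\pm\varphi\otimes X_\gamma^\mp$, where $\{X^+_\gamma\}$ is a basis of $\mathfrak p^+$ and $\{X_\gamma^-\}$ the basis of $\mathfrak p^-$ dual to it under the Killing form of $\mathfrak g$, put $\mathcal D_\ell^\pm=\pi^\pm\circ\widetilde{\mathcal D}_\ell^\pm$. Here $\pi^+$ and $\pi^-$ are induced by the contractions $$[u_1^a][u_2^b]\otimes\overline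 u_1\mapsto[u_1^{a-1}][u_2^b],\quad[u_1^a][u_2^b]\otimes\overline u_2\mapsto[u_1^a][u_2^{b-1}],$$ $$[u_1^a][u_2^b]\otimes u_1\mapsto-[u_1^a][u_2^{b-1}],\quad[u_1^a][u_2^b]\otimes u_2\mapsto[u_1^{a-1}][u_2^b].$$ *Theorem.* Let $T\in V_0$ be non-zero, and let $\mathcal C_T$ be the complex vector space of smooth functions $W:G\to\mathbb V_\ell$ of moderate growth (that is, bounded by a polynomial in the absolute values of the entries of $g$ and $g^{-1}$) such that (a) $W(gk)=W(g)\cdot k$ for all $k\in K_\infty$, $g\in G$; (b) $W(ng)=\chi_T(n)W(g)$ for all $n\in N$, $g\in G$; (c) $\mathcal D_\ell^+W$ and $\mathcal D_\ell^-W$ vanish identically on $G$. Then $\dim_{\mathbb C}\mathcal C_T=1$ if $\langle T,T\rangle\ge0$, and $\dim_{\mathbb C}\mathcal C_T=0$ if $\langle T,T\rangle<0$. If $\langle T,T\rangle\ge0$, there is a unique function $\mathcal W_T\in\mathcal C_T$ such that for all $(h,z)\in M$ $$\mathcal W_T(h,z)=\sum_{-\ell\le v\le\ell}|z|^{2\ell+2}\left(\frac{|\beta_T(h,z)|}{\beta_T(h,z)}\right)^{v}K_v\big(|\beta_T(h,z)|\big)\,[u_1^{\ell-v}][u_2^{\ell+v}],\qquad\beta_T(h,z)=\frac{4\pi}{\sqrt2}\langle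 u_2,zT\cdot h\rangle,$$ where $K_v(x)=\frac12\int_0^\infty t^{v-1}e^{-x(t+t^{-1})/2}\,dt$ is the $K$-Bessel function; and $\mathcal C_T=\mathbb C\,\mathcal W_T$. -/

import Mathlib

open scoped Matrix ContDiff ComplexConjugate Topology
open MeasureTheory

namespace QWhittaker

noncomputable section

/-! ### The hermitian space of signature `(2, n)` and its unitary group

`V` is the space of row vectors in a fixed orthogonal basis `u₁, u₂, v₁, …, vₙ` with
`⟨uᵢ, uᵢ⟩ = 1` and `⟨vₖ, vₖ⟩ = -1`; linear maps and group elements act on the right.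
`Sum.inl 0, Sum.inl 1` are the labels of `u₁, u₂`, and `Sum.inr 0, …, Sum.inr (n - 1)` those of
`v₁, …, vₙ`. -/

/-- Labels of the basis vectors. -/
abbrev Idx (n : ℕ) : Type := Fin 2 ⊕ Fin n

/-- The hermitian space `V`, in coordinates. -/
abbrev Vec (n : ℕ) : Type := Idx n → ℂ

/-- The hermitian form, conjugate linear in the second variable. -/
def herm {n : ℕ} (x y : Vec n) : ℂ :=
  (∑ i : Fin 2, x (Sum.inl i) * conj (y (Sum.inl i))) -
    ∑ k : Fin n, x (Sum.inr k) * conj (y (Sum.inr k))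

/-- The vectors `u₁, u₂`. -/
def uVec (n : ℕ) (j : Fin 2) : Vec n := Pi.single (Sum.inl j) 1

/-- The vectors `v₁, …, vₙ`. -/
def vVec (n : ℕ) (k : Fin n) : Vec n := Pi.single (Sum.inr k) 1

/-- The label of the last vector `vₙ`. -/
def lastIdx (n : ℕ) [NeZero n] : Fin n := ⟨n - 1, Nat.sub_lt (NeZero.pos n) one_pos⟩

/-- `b₁ = (u₁ + vₙ) / √2`, spanning the isotropic line `U`. -/
def b1 (n : ℕ) [NeZero n] : Vec n :=
  ((1 / Real.sqrt 2 : ℝ) : ℂ) • (uVec n 0 + vVec n (lastIdx n))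

/-- `b₂ = (u₁ - vₙ) / √2`, spanning the isotropic line `U^∨`; here `⟨b₁, b₂⟩ = 1`. -/
def b2 (n : ℕ) [NeZero n] : Vec n :=
  ((1 / Real.sqrt 2 : ℝ) : ℂ) • (uVec n 0 - vVec n (lastIdx n))

theorem herm_add_left {n : ℕ} (x x' y : Vec n) : herm (x + x') y = herm x y + herm x' y := by
  simp only [herm, Pi.add_apply, add_mul, Finset.sum_add_distrib]; ring

theorem herm_add_right {n : ℕ} (x y y' : Vec n) : herm x (y + y') = herm x y + herm x y' := by
  simp only [herm, Pi.add_apply, map_add, mul_add, Finset.sum_add_distrib]; ring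

theorem herm_smul_left {n : ℕ} (c : ℂ) (x y : Vec n) : herm (c • x) y = c * herm x y := by
  simp only [herm, Pi.smul_apply, smul_eq_mul, mul_sub, Finset.mul_sum, mul_assoc]

theorem herm_smul_right {n : ℕ} (c : ℂ) (x y : Vec n) :
    herm x (c • y) = conj c * herm x y := by
  simp only [herm, Pi.smul_apply, smul_eq_mul, mul_sub, Finset.mul_sum, map_mul, mul_left_comm]

theorem herm_conj {n : ℕ} (x y : Vec n) : conj (herm x y) = herm y x := by
  simp only [herm, map_sub, map_sum, map_mul, Complex.conj_conj]
  simp only [mul_comm]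

/-- `V₀ = (U ⊕ U^∨)^⊥`, a hermitian space of signature `(1, n - 1)`. -/
def V0 (n : ℕ) [NeZero n] : Submodule ℂ (Vec n) where
  carrier := {x | herm x (b1 n) = 0 ∧ herm x (b2 n) = 0}
  add_mem' := fun hx hy => by
    constructor
    · rw [herm_add_left, hx.1, hy.1, add_zero]
    · rw [herm_add_left, hx.2, hy.2, add_zero]
  zero_mem' := by constructor <;> simp [herm]
  smul_mem' := fun c x hx => by
    constructor
    · rw [herm_smul_left, hx.1, mul_zero]
    · rw [herm_smul_left, hx.2, mul_zero]

/-- The unitary group `U(2, n)` of `V`, acting on row vectors from the right. -/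
def U (n : ℕ) : Subgroup (GL (Idx n) ℂ) where
  carrier := {g | ∀ x y : Vec n,
    herm (x ᵥ* (g : Matrix (Idx n) (Idx n) ℂ)) (y ᵥ* (g : Matrix (Idx n) (Idx n) ℂ)) = herm x y}
  mul_mem' := fun {g h} hg hh x y => by
    rw [Units.val_mul, ← Matrix.vecMul_vecMul, ← Matrix.vecMul_vecMul, hh, hg]
  one_mem' := fun x y => by simp
  inv_mem' := fun {g} hg x y => by
    have h := hg (x ᵥ* ((g⁻¹ : GL (Idx n) ℂ) : Matrix (Idx n) (Idx n) ℂ))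
      (y ᵥ* ((g⁻¹ : GL (Idx n) ℂ) : Matrix (Idx n) (Idx n) ℂ))
    simp only [Matrix.vecMul_vecMul, ← Units.val_mul, inv_mul_cancel, Units.val_one,
      Matrix.vecMul_one] at h
    exact h.symm

/-- The matrix of a group element. -/
def toMat {n : ℕ} (g : U n) : Matrix (Idx n) (Idx n) ℂ := ((g : GL (Idx n) ℂ) : Matrix _ _ ℂ)

/-- The right action of `U(2, n)` on `V`. -/
def act {n : ℕ} (x : Vec n) (g : U n) : Vec n := x ᵥ* toMat g

/-! ### The Lie algebra and the exponential map -/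

/-- `𝔤₀ = Lie U(2, n)`: the skew-hermitian endomorphisms of `V`, acting from the right. -/
def lie (n : ℕ) : Submodule ℝ (Matrix (Idx n) (Idx n) ℂ) where
  carrier := {X | ∀ x y : Vec n, herm (x ᵥ* X) y + herm x (y ᵥ* X) = 0}
  add_mem' := fun {X Y} hX hY x y => by
    rw [Matrix.vecMul_add, Matrix.vecMul_add, herm_add_left, herm_add_right]
    linear_combination hX x y + hY x y
  zero_mem' := fun x y => by simp [herm]
  smul_mem' := fun c X hX x y => by
    have e : c • X = (c : ℂ) • X := by ext i j; simp
    rw [e, Matrix.vecMul_smul, Matrix.vecMul_smul, herm_smul_left, herm_smul_right,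
      Complex.conj_ofReal]
    linear_combination (c : ℂ) * hX x y

/-- `x ⊗ ȳ`, the endomorphism `v ↦ ⟨v, y⟩ x`, as a matrix acting on row vectors. -/
def tens {n : ℕ} (x y : Vec n) : Matrix (Idx n) (Idx n) ℂ :=
  Matrix.of fun i j => herm (Pi.single i 1) y * x j

theorem vecMul_tens {n : ℕ} (w x y : Vec n) : w ᵥ* tens x y = herm w y • x := by
  ext j
  simp only [Matrix.vecMul, dotProduct, tens, Matrix.of_apply, Pi.smul_apply, smul_eq_mul]
  rw [Fintype.sum_sum_type]
  simp only [herm, sub_mul, Finset.sum_mul]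
  simp [Pi.single_apply, sub_eq_add_neg, mul_assoc]

/-- `x ⊗ ȳ - y ⊗ x̄ ∈ 𝔤₀`. -/
def skewTens {n : ℕ} (x y : Vec n) : lie n :=
  ⟨tens x y - tens y x, fun v w => by
    simp only [sub_eq_add_neg, Matrix.vecMul_add, Matrix.vecMul_neg, vecMul_tens]
    rw [← neg_smul, ← neg_smul, herm_add_left, herm_add_right, herm_smul_left, herm_smul_left,
      herm_smul_right, herm_smul_right, map_neg, herm_conj, herm_conj]
    ring⟩

/-- `i (x ⊗ ȳ + y ⊗ x̄) ∈ 𝔤₀`. -/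
def symTens {n : ℕ} (x y : Vec n) : lie n :=
  ⟨Complex.I • (tens x y + tens y x), fun v w => by
    simp only [Matrix.vecMul_add, Matrix.vecMul_smul, vecMul_tens]
    rw [herm_smul_left, herm_smul_right, herm_add_left, herm_add_right, herm_smul_left,
      herm_smul_left, herm_smul_right, herm_smul_right, herm_conj, herm_conj, Complex.conj_I]
    ring⟩

/-- `i x ⊗ x̄ ∈ 𝔤₀`. -/
def diagTens {n : ℕ} (x : Vec n) : lie n :=
  ⟨Complex.I • tens x x, fun v w => by
    simp only [Matrix.vecMul_smul, vecMul_tens]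
    rw [herm_smul_left, herm_smul_right, herm_smul_left, herm_smul_right, herm_conj,
      Complex.conj_I]
    ring⟩

/-- The diagonal Gram matrix of the basis. -/
def gram (n : ℕ) : Matrix (Idx n) (Idx n) ℂ :=
  Matrix.diagonal (Sum.elim (fun _ => 1) (fun _ => -1))

theorem herm_eq_gram {n : ℕ} (x y : Vec n) : herm x y = x ⬝ᵥ (gram n *ᵥ star y) := by
  simp [herm, gram, dotProduct, Matrix.mulVec_diagonal, Fintype.sum_sum_type, sub_eq_add_neg]

theorem gram_mul_gram (n : ℕ) : gram n * gram n = 1 := by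
  rw [gram, Matrix.diagonal_mul_diagonal, ← Matrix.diagonal_one]
  congr 1
  ext i
  cases i <;> simp

theorem exp_mem {n : ℕ} (X : lie n) (x y : Vec n) :
    herm (x ᵥ* NormedSpace.exp (X : Matrix (Idx n) (Idx n) ℂ))
      (y ᵥ* NormedSpace.exp (X : Matrix (Idx n) (Idx n) ℂ)) = herm x y := by
  obtain ⟨X, hX⟩ := X
  have hJ := gram_mul_gram n
  have key : ∀ (A : Matrix (Idx n) (Idx n) ℂ) (x y : Vec n),
      herm x (y ᵥ* A) = x ⬝ᵥ ((gram n * Aᴴ) *ᵥ star y) := by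
    intro A x y
    rw [herm_eq_gram, Matrix.star_vecMul, Matrix.mulVec_mulVec]
  have key2 : ∀ (A : Matrix (Idx n) (Idx n) ℂ) (x y : Vec n),
      herm (x ᵥ* A) y = x ⬝ᵥ ((A * gram n) *ᵥ star y) := by
    intro A x y
    rw [herm_eq_gram, ← Matrix.dotProduct_mulVec, Matrix.mulVec_mulVec]
  have h1 : X * gram n + gram n * Xᴴ = 0 := by
    ext i j
    have h := hX (Pi.single i 1) (Pi.single j 1)
    rw [key, key2, ← dotProduct_add, ← Matrix.add_mulVec] at h
    have e : star (Pi.single j (1 : ℂ) : Vec n) = Pi.single j 1 := by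
      rw [← Pi.single_star, star_one]
    rw [e] at h
    simpa using h
  have hU : IsUnit (gram n) := IsUnit.of_mul_eq_one _ hJ
  have hinv : (gram n)⁻¹ = gram n := Matrix.inv_eq_right_inv hJ
  have h2 : X = gram n * (-Xᴴ) * (gram n)⁻¹ := by
    rw [hinv]
    have := congrArg (fun Z => Z * gram n) h1
    simp only [add_mul, zero_mul, mul_assoc, hJ, mul_one] at this
    rw [mul_neg, neg_mul, mul_assoc]
    exact eq_neg_of_add_eq_zero_left this
  have h3 : NormedSpace.exp X = gram n * NormedSpace.exp (-Xᴴ) * gram n := by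
    conv_lhs => rw [h2]
    rw [Matrix.exp_conj _ _ hU, hinv]
  have h4 : NormedSpace.exp X * gram n * (NormedSpace.exp X)ᴴ = gram n := by
    rw [← Matrix.exp_conjTranspose]
    conv_lhs => enter [1, 1]; rw [h3]
    have h5 : NormedSpace.exp (-Xᴴ) * NormedSpace.exp Xᴴ = 1 := by
      rw [Matrix.exp_neg]
      exact Matrix.nonsing_inv_mul _
        ((Matrix.isUnit_iff_isUnit_det _).1 (Matrix.isUnit_exp Xᴴ))
    rw [mul_assoc (gram n * _), hJ, mul_one, mul_assoc, h5, mul_one]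
  rw [key2, Matrix.star_vecMul, Matrix.mulVec_mulVec, h4, ← herm_eq_gram]

/-- The exponential map `𝔤₀ → U(2, n)`. -/
def expU {n : ℕ} (X : lie n) : U n :=
  ⟨(Matrix.isUnit_exp (X : Matrix (Idx n) (Idx n) ℂ)).unit, fun x y => exp_mem X x y⟩

/-! ### The subgroups `K_∞`, `N` and `M` -/

/-- The maximal compact subgroup `K_∞ = U(V₂⁺) × U(Vₙ⁻)`, the stabilizer of the decomposition
`V = V₂⁺ ⊕ Vₙ⁻` into the spans of the `uⱼ` and of the `vₖ`. -/
def KInf (n : ℕ) : Set (U n) :=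
  {k | (toMat k).toBlocks₁₂ = 0 ∧ (toMat k).toBlocks₂₁ = 0}

/-- The element `exp(w ⊗ b̄₁ - b₁ ⊗ w̄) · exp(t i b₁ ⊗ b̄₁)`; for `w ∈ V₀` and `t` real these
are exactly the elements of the unipotent radical `N` of the stabilizer of the line `ℂ b₁`, and the
second factors are the elements of its centre `Z`. -/
def heis {n : ℕ} [NeZero n] (w : Vec n) (t : ℝ) : U n :=
  expU (skewTens w (b1 n)) * expU (t • diagTens (b1 n))

/-- `m` is the element `(h, z)` of the Levi subgroup `M = U(V₀) × ℂ^×`, the stabilizer of the lines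
`ℂ b₁` and `ℂ b₂`: `(x, v, y) · (h, z) = (z⁻¹ x, v · h, z̄ y)` on `V = ℂ b₁ ⊕ V₀ ⊕ ℂ b₂`.
Here `h` is the restriction of `m` to `V₀`. -/
def IsLevi {n : ℕ} [NeZero n] (m : U n) (z : ℂˣ) : Prop :=
  act (b1 n) m = ((z : ℂ)⁻¹) • b1 n ∧ act (b2 n) m = (conj (z : ℂ)) • b2 n

/-! ### The representation `𝕍_ℓ = Sym^{2ℓ} V₂⁺ ⊗ det^{-ℓ}` of `K_∞` -/

/-- `𝕍_ℓ`, in coordinates with respect to the basis `[u₁^{ℓ-v}][u₂^{ℓ+v}]`, `-ℓ ≤ v ≤ ℓ`, where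
`[u^a] = u^a / a!`. The coordinate with label `a` belongs to `v = a - ℓ`. -/
abbrev VEll (ℓ : ℕ) : Type := Fin (2 * ℓ + 1) → ℂ

/-- The element `∑ c_a [u₁^{2ℓ-a}][u₂^a]` of `Sym^{2ℓ} V₂⁺`, the space of homogeneous polynomials
of degree `2ℓ` in `u₁ = X 0` and `u₂ = X 1`. -/
def toSym (ℓ : ℕ) : VEll ℓ →ₗ[ℂ] MvPolynomial (Fin 2) ℂ :=
  ∑ a : Fin (2 * ℓ + 1), (LinearMap.proj a : VEll ℓ →ₗ[ℂ] ℂ).smulRight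
    (((((2 * ℓ - (a : ℕ)).factorial * (a : ℕ).factorial : ℕ) : ℂ)⁻¹) •
      ((MvPolynomial.X 0) ^ (2 * ℓ - (a : ℕ)) * (MvPolynomial.X 1) ^ (a : ℕ)))

/-- The action of a `2 × 2` matrix `A` on `Sym V₂⁺`, induced by `uᵢ ↦ ∑ⱼ Aᵢⱼ uⱼ`. -/
def symSubst (A : Matrix (Fin 2) (Fin 2) ℂ) :
    MvPolynomial (Fin 2) ℂ →ₐ[ℂ] MvPolynomial (Fin 2) ℂ :=
  MvPolynomial.aeval fun i => ∑ j : Fin 2, A i j • MvPolynomial.X j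

/-- `y = x · k` in `𝕍_ℓ`, for `k ∈ K_∞`. -/
def IsActK {n ℓ : ℕ} (k : U n) (x y : VEll ℓ) : Prop :=
  toSym ℓ y = (((toMat k).toBlocks₁₁.det ^ ℓ)⁻¹) • symSubst (toMat k).toBlocks₁₁ (toSym ℓ x)

/-! ### Smooth functions, moderate growth, right regular action -/

/-- Matrix entries of a group element. -/
def entries {n : ℕ} (g : U n) : Idx n → Idx n → ℂ := fun i j => toMat g i j

/-- Smooth functions on `U(2, n)`, a closed submanifold of the space of matrices: those which are
locally the restriction of a smooth function of the matrix entries. -/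
def IsSmooth {n ℓ : ℕ} (φ : U n → VEll ℓ) : Prop :=
  ∀ g₀ : U n, ∃ (Ω : Set (Idx n → Idx n → ℂ)) (F : (Idx n → Idx n → ℂ) → VEll ℓ),
    IsOpen Ω ∧ entries g₀ ∈ Ω ∧ ContDiffOn ℝ ∞ F Ω ∧ ∀ g : U n, entries g ∈ Ω → φ g = F (entries g)

/-- The height of a group element: the sum of the absolute values of the entries of `g`
and `g⁻¹`. -/
def height {n : ℕ} (g : U n) : ℝ := ∑ i, ∑ j, (‖toMat g i j‖ + ‖toMat g⁻¹ i j‖)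

/-- Moderate growth: polynomially bounded in the height. -/
def IsModerate {n ℓ : ℕ} (φ : U n → VEll ℓ) : Prop :=
  ∃ (C : ℝ) (r : ℕ), ∀ g : U n, ‖φ g‖ ≤ C * height g ^ r

/-- The right regular action of `X ∈ 𝔤₀`: `(X φ)(g) = d/dt φ(g exp(tX))` at `t = 0`. -/
def lieDeriv {n ℓ : ℕ} (X : lie n) (φ : U n → VEll ℓ) (g : U n) : VEll ℓ :=
  deriv (fun t : ℝ => φ (g * expU (t • X))) 0

/-! ### The Schmid operators -/

/-- The action of `[uⱼ ⊗ v̄ₖ]⁺ = (uⱼ ⊗ v̄ₖ - vₖ ⊗ ūⱼ) ⊗ 1/2 + i (uⱼ ⊗ v̄ₖ + vₖ ⊗ ūⱼ) ⊗ (-√-1/2)`. -/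
def pPlus {n ℓ : ℕ} (j : Fin 2) (k : Fin n) (φ : U n → VEll ℓ) (g : U n) : VEll ℓ :=
  (1 / 2 : ℂ) • lieDeriv (skewTens (uVec n j) (vVec n k)) φ g +
    (-Complex.I / 2) • lieDeriv (symTens (uVec n j) (vVec n k)) φ g

/-- The action of `[uⱼ ⊗ v̄ₖ]⁻ = (uⱼ ⊗ v̄ₖ - vₖ ⊗ ūⱼ) ⊗ 1/2 + i (uⱼ ⊗ v̄ₖ + vₖ ⊗ ūⱼ) ⊗ (√-1/2)`. -/
def pMinus {n ℓ : ℕ} (j : Fin 2) (k : Fin n) (φ : U n → VEll ℓ) (g : U n) : VEll ℓ :=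
  (1 / 2 : ℂ) • lieDeriv (skewTens (uVec n j) (vVec n k)) φ g +
    (Complex.I / 2) • lieDeriv (symTens (uVec n j) (vVec n k)) φ g

/-- `D̃⁺ φ = ∑ X_γ⁺ φ ⊗ X_γ⁻ ∈ 𝕍_ℓ ⊗ 𝔭⁻`: the coefficient of `[uⱼ ⊗ v̄ₖ]⁻ = ūⱼ ⊗ vₖ`.
For the Killing form `B(X, Y) = 2 (n + 2) tr(XY) - 2 tr(X) tr(Y)` of `𝔤𝔩ₙ₊₂` the elements
`[uⱼ ⊗ v̄ₖ]⁺` and `[uⱼ ⊗ v̄ₖ]⁻` pair to `2 (n + 2)` and the other pairings vanish, so that the basis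
dual to the `[uⱼ ⊗ v̄ₖ]⁺` is that of the `[uⱼ ⊗ v̄ₖ]⁻ / (2 (n + 2))`. -/
def schmidTildePlus {n ℓ : ℕ} (φ : U n → VEll ℓ) (g : U n) : Fin 2 → Fin n → VEll ℓ :=
  fun j k => (1 / (2 * ((n : ℂ) + 2))) • pPlus j k φ g

/-- `D̃⁻ φ = ∑ X_γ⁻ φ ⊗ X_γ⁺ ∈ 𝕍_ℓ ⊗ 𝔭⁺`: the coefficient of `[uⱼ ⊗ v̄ₖ]⁺ = uⱼ ⊗ v̄ₖ`. -/
def schmidTildeMinus {n ℓ : ℕ} (φ : U n → VEll ℓ) (g : U n) : Fin 2 → Fin n → VEll ℓ :=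
  fun j k => (1 / (2 * ((n : ℂ) + 2))) • pMinus j k φ g

/-- The map `[u₁^a][u₂^b] ↦ [u₁^{a-1}][u₂^b]` from `Sym^{2ℓ}` to `Sym^{2ℓ-1}` (zero if `a = 0`);
coordinates on `Sym^{2ℓ-1}` are with respect to `[u₁^{2ℓ-1-a}][u₂^a]`, `0 ≤ a ≤ 2ℓ-1`. -/
def lower1 {ℓ : ℕ} (c : VEll ℓ) : Fin (2 * ℓ) → ℂ := fun a => c a.castSucc

/-- The map `[u₁^a][u₂^b] ↦ [u₁^a][u₂^{b-1}]` from `Sym^{2ℓ}` to `Sym^{2ℓ-1}` (zero if `b = 0`). -/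
def lower2 {ℓ : ℕ} (c : VEll ℓ) : Fin (2 * ℓ) → ℂ := fun a => c a.succ

/-- `π⁺`: contraction of `Sym^{2ℓ} V₂⁺` with `ū₁, ū₂`; the result is listed by the coefficients of
`v₁, …, vₙ`. -/
def projPlus {n ℓ : ℕ} (t : Fin 2 → Fin n → VEll ℓ) : Fin n → Fin (2 * ℓ) → ℂ :=
  fun k => lower1 (t 0 k) + lower2 (t 1 k)

/-- `π⁻`: contraction of `Sym^{2ℓ} V₂⁺` with `u₁, u₂`; the result is listed by the coefficients of
`v̄₁, …, v̄ₙ`. -/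
def projMinus {n ℓ : ℕ} (t : Fin 2 → Fin n → VEll ℓ) : Fin n → Fin (2 * ℓ) → ℂ :=
  fun k => -lower2 (t 0 k) + lower1 (t 1 k)

/-- The Schmid operator `D_ℓ⁺`. -/
def schmidPlus {n ℓ : ℕ} (φ : U n → VEll ℓ) (g : U n) : Fin n → Fin (2 * ℓ) → ℂ :=
  projPlus (schmidTildePlus φ g)

/-- The Schmid operator `D_ℓ⁻`. -/
def schmidMinus {n ℓ : ℕ} (φ : U n → VEll ℓ) (g : U n) : Fin n → Fin (2 * ℓ) → ℂ :=
  projMinus (schmidTildeMinus φ g)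

/-! ### The space of generalized Whittaker functions -/

/-- The conditions defining the space of generalized Whittaker functions with character `χ_T`. -/
structure IsWhittaker {n ℓ : ℕ} [NeZero n] (T : Vec n) (W : U n → VEll ℓ) : Prop where
  smooth : IsSmooth W
  moderate : IsModerate W
  equivariant : ∀ k ∈ KInf n, ∀ g : U n, IsActK k (W g) (W (g * k))
  character : ∀ w ∈ V0 n, ∀ (t : ℝ) (g : U n),
    W (heis w t * g) = Complex.exp (-2 * Real.pi * Complex.I * ((herm T w).im : ℂ)) • W g
  schmid_plus : ∀ g : U n, schmidPlus W g = 0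
  schmid_minus : ∀ g : U n, schmidMinus W g = 0

theorem differentiableAt_expU {n : ℕ} (g : U n) (X : lie n) :
    DifferentiableAt ℝ (fun t : ℝ => entries (g * expU (t • X))) 0 := by
  let _ : NormedRing (Matrix (Idx n) (Idx n) ℂ) := Matrix.linftyOpNormedRing
  let _ : NormedAlgebra ℝ (Matrix (Idx n) (Idx n) ℂ) := Matrix.linftyOpNormedAlgebra
  have h := (hasDerivAt_exp_smul_const (𝕂 := ℝ) (X : Matrix (Idx n) (Idx n) ℂ) 0).differentiableAt
  have h2 : ∀ i j, DifferentiableAt ℝ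
      (fun t : ℝ => NormedSpace.exp (t • (X : Matrix (Idx n) (Idx n) ℂ)) i j) 0 := fun i j =>
    ((LinearMap.toContinuousLinearMap (Matrix.entryLinearMap ℝ ℂ i j)).differentiableAt).comp
      (0 : ℝ) h
  rw [differentiableAt_pi]
  intro i
  rw [differentiableAt_pi]
  intro j
  have e : (fun t : ℝ => entries (g * expU (t • X)) i j) =
      fun t : ℝ => ∑ k, toMat g i k * NormedSpace.exp (t • (X : Matrix (Idx n) (Idx n) ℂ)) k j := by
    funext t
    exact Matrix.mul_apply
  rw [e]
  exact DifferentiableAt.fun_sum fun k _ => (h2 k j).const_mul _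

theorem IsSmooth.differentiableAt {n ℓ : ℕ} {φ : U n → VEll ℓ} (h : IsSmooth φ) (g : U n)
    (X : lie n) : DifferentiableAt ℝ (fun t : ℝ => φ (g * expU (t • X))) 0 := by
  have hc := differentiableAt_expU g X
  obtain ⟨Ω, F, hO, hg, hF, hφ⟩ := h (g * expU ((0 : ℝ) • X))
  have hd : DifferentiableAt ℝ F (entries (g * expU ((0 : ℝ) • X))) :=
    (hF.contDiffAt (hO.mem_nhds hg)).differentiableAt (by simp)
  have := hd.comp (0 : ℝ) hc
  refine this.congr_of_eventuallyEq ?_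
  filter_upwards [hc.continuousAt.preimage_mem_nhds (hO.mem_nhds hg)] with t ht
  exact hφ _ ht

theorem lieDeriv_add {n ℓ : ℕ} {φ ψ : U n → VEll ℓ} (h : IsSmooth φ) (h' : IsSmooth ψ)
    (X : lie n) (g : U n) : lieDeriv X (φ + ψ) g = lieDeriv X φ g + lieDeriv X ψ g :=
  deriv_add (h.differentiableAt g X) (h'.differentiableAt g X)

theorem lieDeriv_smul {n ℓ : ℕ} (c : ℂ) {φ : U n → VEll ℓ} (h : IsSmooth φ)
    (X : lie n) (g : U n) : lieDeriv X (c • φ) g = c • lieDeriv X φ g :=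
  deriv_const_smul c (h.differentiableAt g X)

theorem schmidPlus_add {n ℓ : ℕ} {φ ψ : U n → VEll ℓ} (h : IsSmooth φ) (h' : IsSmooth ψ)
    (g : U n) : schmidPlus (φ + ψ) g = schmidPlus φ g + schmidPlus ψ g := by
  ext k a
  simp only [schmidPlus, projPlus, schmidTildePlus, pPlus, lower1, lower2, lieDeriv_add h h',
    Pi.add_apply, Pi.smul_apply, smul_eq_mul]
  ring

theorem schmidMinus_add {n ℓ : ℕ} {φ ψ : U n → VEll ℓ} (h : IsSmooth φ) (h' : IsSmooth ψ)
    (g : U n) : schmidMinus (φ + ψ) g = schmidMinus φ g + schmidMinus ψ g := by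
  ext k a
  simp only [schmidMinus, projMinus, schmidTildeMinus, pMinus, lower1, lower2, lieDeriv_add h h',
    Pi.add_apply, Pi.neg_apply, Pi.smul_apply, smul_eq_mul]
  ring

theorem schmidPlus_smul {n ℓ : ℕ} (c : ℂ) {φ : U n → VEll ℓ} (h : IsSmooth φ)
    (g : U n) : schmidPlus (c • φ) g = c • schmidPlus φ g := by
  ext k a
  simp only [schmidPlus, projPlus, schmidTildePlus, pPlus, lower1, lower2, lieDeriv_smul c h,
    Pi.add_apply, Pi.smul_apply, smul_eq_mul]
  ring

theorem schmidMinus_smul {n ℓ : ℕ} (c : ℂ) {φ : U n → VEll ℓ} (h : IsSmooth φ)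
    (g : U n) : schmidMinus (c • φ) g = c • schmidMinus φ g := by
  ext k a
  simp only [schmidMinus, projMinus, schmidTildeMinus, pMinus, lower1, lower2, lieDeriv_smul c h,
    Pi.add_apply, Pi.neg_apply, Pi.smul_apply, smul_eq_mul]
  ring

theorem height_one_le {n : ℕ} (g : U n) : 1 ≤ height g := by
  have h : toMat g * toMat g⁻¹ = 1 := by
    have : (g : GL (Idx n) ℂ) * ((g⁻¹ : U n) : GL (Idx n) ℂ) = 1 := by simp
    exact (Units.val_mul _ _).symm.trans (congrArg Units.val this)
  have h0 := congrFun (congrFun h (Sum.inl 0)) (Sum.inl 0)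
  rw [Matrix.mul_apply, Matrix.one_apply_eq] at h0
  by_contra hlt
  rw [not_le] at hlt
  have hterm : ∀ i j, ‖toMat g i j‖ + ‖toMat g⁻¹ i j‖ < 1 := fun i j =>
    ((Finset.single_le_sum (f := fun j => ‖toMat g i j‖ + ‖toMat g⁻¹ i j‖)
      (fun j _ => by positivity) (Finset.mem_univ j)).trans
      (Finset.single_le_sum (f := fun i => ∑ j, (‖toMat g i j‖ + ‖toMat g⁻¹ i j‖))
      (fun i _ => by positivity) (Finset.mem_univ i))).trans_lt hlt
  have h1 : (1 : ℝ) ≤ ∑ j, ‖toMat g (Sum.inl 0) j‖ := by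
    have e := congrArg norm h0
    rw [norm_one] at e
    rw [← e]
    refine (norm_sum_le _ _).trans (Finset.sum_le_sum fun j _ => ?_)
    rw [norm_mul]
    have := hterm j (Sum.inl 0)
    have h3 := norm_nonneg (toMat g j (Sum.inl 0))
    exact mul_le_of_le_one_right (norm_nonneg _) (by linarith)
  have h2 : ∑ j, ‖toMat g (Sum.inl 0) j‖ ≤ height g :=
    (Finset.sum_le_sum fun j _ => le_add_of_nonneg_right (norm_nonneg _)).trans
      (Finset.single_le_sum (f := fun i => ∑ j, (‖toMat g i j‖ + ‖toMat g⁻¹ i j‖))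
        (fun i _ => by positivity) (Finset.mem_univ (Sum.inl 0)))
  linarith

theorem IsSmooth.add {n ℓ : ℕ} {φ ψ : U n → VEll ℓ} (h : IsSmooth φ) (h' : IsSmooth ψ) :
    IsSmooth (φ + ψ) := by
  intro g₀
  obtain ⟨Ω, F, hO, hg, hF, hφ⟩ := h g₀
  obtain ⟨Ω', F', hO', hg', hF', hψ⟩ := h' g₀
  exact ⟨Ω ∩ Ω', F + F', hO.inter hO', ⟨hg, hg'⟩,
    (hF.mono Set.inter_subset_left).add (hF'.mono Set.inter_subset_right),
    fun g hg => by simp [hφ g hg.1, hψ g hg.2]⟩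

theorem IsSmooth.smul {n ℓ : ℕ} (c : ℂ) {φ : U n → VEll ℓ} (h : IsSmooth φ) :
    IsSmooth (c • φ) := by
  intro g₀
  obtain ⟨Ω, F, hO, hg, hF, hφ⟩ := h g₀
  exact ⟨Ω, c • F, hO, hg, hF.const_smul c, fun g hg => by simp [hφ g hg]⟩

theorem IsModerate.add {n ℓ : ℕ} {φ ψ : U n → VEll ℓ} (h : IsModerate φ) (h' : IsModerate ψ) :
    IsModerate (φ + ψ) := by
  obtain ⟨C, r, hC⟩ := h
  obtain ⟨C', r', hC'⟩ := h'
  refine ⟨|C| + |C'|, r + r', fun g => ?_⟩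
  have h1 := height_one_le g
  have a1 : height g ^ r ≤ height g ^ (r + r') := pow_le_pow_right₀ h1 (Nat.le_add_right _ _)
  have a2 : height g ^ r' ≤ height g ^ (r + r') := pow_le_pow_right₀ h1 (Nat.le_add_left _ _)
  have p1 : 0 ≤ height g ^ r := by positivity
  have p2 : 0 ≤ height g ^ r' := by positivity
  calc ‖(φ + ψ) g‖ ≤ ‖φ g‖ + ‖ψ g‖ := norm_add_le _ _
    _ ≤ C * height g ^ r + C' * height g ^ r' := add_le_add (hC g) (hC' g)
    _ ≤ |C| * height g ^ (r + r') + |C'| * height g ^ (r + r') := by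
        gcongr <;> exact le_abs_self _
    _ = _ := by ring

theorem IsModerate.smul {n ℓ : ℕ} (c : ℂ) {φ : U n → VEll ℓ} (h : IsModerate φ) :
    IsModerate (c • φ) := by
  obtain ⟨C, r, hC⟩ := h
  refine ⟨‖c‖ * C, r, fun g => ?_⟩
  rw [Pi.smul_apply, norm_smul, mul_assoc]
  exact mul_le_mul_of_nonneg_left (hC g) (norm_nonneg _)

/-- The complex vector space of generalized Whittaker functions: smooth functions of moderate growth
`U(2, n) → 𝕍_ℓ` that are `K_∞`-equivariant, transform under `N` by `χ_T`, and are annihilated by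
`D_ℓ⁺` and `D_ℓ⁻`. -/
def whittakerSpace (n ℓ : ℕ) [NeZero n] (T : Vec n) : Submodule ℂ (U n → VEll ℓ) where
  carrier := {W | IsWhittaker T W}
  add_mem' := fun {W W'} h h' =>
    { smooth := h.smooth.add h'.smooth
      moderate := h.moderate.add h'.moderate
      equivariant := fun k hk g => by
        have a := h.equivariant k hk g
        have b := h'.equivariant k hk g
        simp only [IsActK, Pi.add_apply, map_add, smul_add] at a b ⊢
        rw [a, b]
      character := fun w hw t g => by
        simp only [Pi.add_apply, smul_add, h.character w hw t g, h'.character w hw t g]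
      schmid_plus := fun g => by
        rw [schmidPlus_add h.smooth h'.smooth, h.schmid_plus, h'.schmid_plus, add_zero]
      schmid_minus := fun g => by
        rw [schmidMinus_add h.smooth h'.smooth, h.schmid_minus, h'.schmid_minus, add_zero] }
  zero_mem' :=
    { smooth := fun _ => ⟨Set.univ, 0, isOpen_univ, trivial, contDiffOn_const, fun _ _ => rfl⟩
      moderate := ⟨0, 0, fun g => by simp⟩
      equivariant := fun k _ g => by simp [IsActK]
      character := fun w _ t g => by simp
      schmid_plus := fun g => by
        ext k a
        simp [schmidPlus, projPlus, schmidTildePlus, pPlus, lower1, lower2, lieDeriv]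
      schmid_minus := fun g => by
        ext k a
        simp [schmidMinus, projMinus, schmidTildeMinus, pMinus, lower1, lower2, lieDeriv] }
  smul_mem' := fun c W h =>
    { smooth := h.smooth.smul c
      moderate := h.moderate.smul c
      equivariant := fun k hk g => by
        have a := h.equivariant k hk g
        simp only [IsActK, Pi.smul_apply, map_smul] at a ⊢
        rw [a, smul_comm]
      character := fun w hw t g => by
        simp only [Pi.smul_apply, h.character w hw t g]
        rw [smul_comm]
      schmid_plus := fun g => by rw [schmidPlus_smul c h.smooth, h.schmid_plus, smul_zero]
      schmid_minus := fun g => by rw [schmidMinus_smul c h.smooth, h.schmid_minus, smul_zero] }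

/-! ### The explicit function on the Levi subgroup -/

/-- The `K`-Bessel function `K_v(x) = 1/2 ∫₀^∞ t^{v-1} exp(-x (t + t⁻¹) / 2) dt`, for `x > 0`. -/
def besselK (v : ℤ) (x : ℝ) : ℝ :=
  1 / 2 * ∫ t in Set.Ioi (0 : ℝ), t ^ (v - 1) * Real.exp (-x * (t + t⁻¹) / 2)

/-- `β_T(h, z) = (4π / √2) ⟨u₂, z T · h⟩` for the element `m = (h, z)` of `M`. -/
def beta {n : ℕ} (T : Vec n) (m : U n) (z : ℂˣ) : ℂ :=
  ((4 * Real.pi / Real.sqrt 2 : ℝ) : ℂ) * herm (uVec n 1) ((z : ℂ) • act T m)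

/-- `∑_v |z|^{2ℓ+2} (|β_T(h, z)| / β_T(h, z))^v K_v(|β_T(h, z)|) [u₁^{ℓ-v}][u₂^{ℓ+v}]`
for the element `m = (h, z)` of `M`. -/
def besselFormula {n : ℕ} (ℓ : ℕ) (T : Vec n) (m : U n) (z : ℂˣ) : VEll ℓ := fun a =>
  ((‖(z : ℂ)‖ ^ (2 * ℓ + 2) : ℝ) : ℂ) *
    (((‖beta T m z‖ : ℝ) : ℂ) / beta T m z) ^ ((a : ℤ) - (ℓ : ℤ)) *
    ((besselK ((a : ℤ) - (ℓ : ℤ)) ‖beta T m z‖ : ℝ) : ℂ)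

end

end QWhittaker

namespace QWhittaker

noncomputable section

/-! ### The `K`-Bessel function -/

/-- The integrand of the `K`-Bessel function. -/
def besselInt (v : ℤ) (x t : ℝ) : ℝ := t ^ (v - 1) * Real.exp (-x * (t + t⁻¹) / 2)

theorem besselInt_pos (v : ℤ) (x : ℝ) {t : ℝ} (ht : 0 < t) : 0 < besselInt v x t := by
  unfold besselInt; positivity

theorem besselInt_le {v : ℤ} {m N : ℕ} (h : v - 1 + m = N) {x t : ℝ} (hx : 0 < x) (ht : 0 < t) :
    besselInt v x t ≤ m.factorial * (2 / x) ^ m * (t ^ N * Real.exp (-(x / 2) * t)) := by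
  have h1 := Real.pow_div_factorial_le_exp (x / (2 * t)) (by positivity) m
  have h2 : Real.exp (-x * (t + t⁻¹) / 2) =
      Real.exp (-(x / 2) * t) * (Real.exp (x / (2 * t)))⁻¹ := by
    rw [← Real.exp_neg, ← Real.exp_add]; congr 1; field_simp; ring
  have h3 : (Real.exp (x / (2 * t)))⁻¹ ≤ m.factorial * (2 / x) ^ m * t ^ m := by
    rw [inv_le_comm₀ (Real.exp_pos _) (by positivity)]
    refine le_trans (le_of_eq ?_) h1
    rw [div_pow, div_pow, mul_pow]; field_simp
  have h4 : t ^ (v - 1) * t ^ m = t ^ N := by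
    rw [← zpow_natCast, ← zpow_add₀ ht.ne', h, zpow_natCast]
  unfold besselInt
  rw [h2]
  calc t ^ (v - 1) * (Real.exp (-(x / 2) * t) * (Real.exp (x / (2 * t)))⁻¹)
      ≤ t ^ (v - 1) * (Real.exp (-(x / 2) * t) * (m.factorial * (2 / x) ^ m * t ^ m)) := by
        gcongr
    _ = m.factorial * (2 / x) ^ m * ((t ^ (v - 1) * t ^ m) * Real.exp (-(x / 2) * t)) := by ring
    _ = _ := by rw [h4]

theorem integrableOn_pow_mul_exp {b : ℝ} (hb : 0 < b) (N : ℕ) :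
    IntegrableOn (fun t : ℝ => t ^ N * Real.exp (-b * t)) (Set.Ioi 0) := by
  have := integrableOn_rpow_mul_exp_neg_mul_rpow (p := 1) (s := N) (b := b)
    (by have : (0 : ℝ) ≤ N := by positivity
        linarith) one_pos hb
  simpa using this

theorem integral_pow_mul_exp {b : ℝ} (hb : 0 < b) (N : ℕ) :
    ∫ t in Set.Ioi (0 : ℝ), t ^ N * Real.exp (-b * t) = N.factorial * (1 / b) ^ (N + 1) := by
  have h := Real.integral_rpow_mul_exp_neg_mul_Ioi (a := N + 1) (r := b) (by positivity) hb
  rw [Real.Gamma_nat_eq_factorial] at h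
  have e : ((N : ℝ) + 1) = ((N + 1 : ℕ) : ℝ) := by push_cast; ring
  rw [add_sub_cancel_right, e, Real.rpow_natCast] at h
  rw [mul_comm, ← h]
  refine setIntegral_congr_fun measurableSet_Ioi fun t ht => ?_
  simp [neg_mul]

theorem continuousOn_besselInt (v : ℤ) (x : ℝ) : ContinuousOn (besselInt v x) (Set.Ioi 0) := by
  unfold besselInt
  refine ContinuousOn.mul (fun t ht => (continuousAt_zpow₀ t _
    (Or.inl (ne_of_gt ht))).continuousWithinAt) ?_
  refine Real.continuous_exp.comp_continuousOn ?_
  refine ContinuousOn.div_const (ContinuousOn.mul continuousOn_const ?_) _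
  exact continuousOn_id.add (continuousOn_id.inv₀ fun t ht => ne_of_gt ht)

theorem exists_shift (v : ℤ) (M : ℕ) : ∃ m N : ℕ, v - 1 + m = N ∧ M ≤ m + N + 1 :=
  ⟨M + (v - 1).natAbs, (v - 1 + (M + (v - 1).natAbs : ℕ)).toNat, by omega, by omega⟩

theorem integrableOn_besselInt (v : ℤ) {x : ℝ} (hx : 0 < x) :
    IntegrableOn (besselInt v x) (Set.Ioi 0) := by
  obtain ⟨m, N, h, -⟩ := exists_shift v 0
  refine Integrable.mono' ((integrableOn_pow_mul_exp (half_pos hx) N).const_mul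
    (m.factorial * (2 / x) ^ m)) ((continuousOn_besselInt v x).aestronglyMeasurable
      measurableSet_Ioi) ?_
  refine (ae_restrict_iff' measurableSet_Ioi).2 (Filter.Eventually.of_forall fun t ht => ?_)
  rw [Real.norm_of_nonneg (besselInt_pos v x ht).le]
  exact besselInt_le h hx ht

theorem besselK_eq (v : ℤ) (x : ℝ) : besselK v x = 1 / 2 * ∫ t in Set.Ioi 0, besselInt v x t := rfl

theorem besselK_pos (v : ℤ) {x : ℝ} (hx : 0 < x) : 0 < besselK v x := by
  rw [besselK_eq]
  refine mul_pos (by norm_num) ?_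
  rw [setIntegral_pos_iff_support_of_nonneg_ae _ (integrableOn_besselInt v hx)]
  · have : Function.support (besselInt v x) ∩ Set.Ioi 0 = Set.Ioi 0 := by
      rw [Set.inter_eq_right]
      exact fun t ht => (besselInt_pos v x ht).ne'
    rw [this]; simp
  · exact (ae_restrict_iff' measurableSet_Ioi).2
      (Filter.Eventually.of_forall fun t ht => (besselInt_pos v x ht).le)

/-- `K_v` is bounded by arbitrarily high powers of `1 / x`. -/
theorem besselK_le (v : ℤ) (M : ℕ) : ∃ (M' : ℕ) (C : ℝ), M ≤ M' ∧ 0 ≤ C ∧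
    ∀ x : ℝ, 0 < x → besselK v x ≤ C * (1 / x) ^ M' := by
  obtain ⟨m, N, h, hM⟩ := exists_shift v M
  refine ⟨m + N + 1, 1 / 2 * (m.factorial * 2 ^ m * (N.factorial * 2 ^ (N + 1))), hM,
    by positivity, fun x hx => ?_⟩
  have h1 : ∫ t in Set.Ioi 0, besselInt v x t ≤ ∫ t in Set.Ioi (0 : ℝ),
      m.factorial * (2 / x) ^ m * (t ^ N * Real.exp (-(x / 2) * t)) :=
    setIntegral_mono_on (integrableOn_besselInt v hx)
      ((integrableOn_pow_mul_exp (half_pos hx) N).const_mul _) measurableSet_Ioi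
      fun t ht => besselInt_le h hx ht
  rw [integral_const_mul, integral_pow_mul_exp (half_pos hx)] at h1
  rw [besselK_eq]
  refine (mul_le_mul_of_nonneg_left h1 (by norm_num)).trans (le_of_eq ?_)
  have : (1 / (x / 2)) = 2 * (1 / x) := by field_simp
  rw [this, show 2 / x = 2 * (1 / x) by ring, mul_pow, mul_pow]
  ring

theorem besselInt_sub (v : ℤ) (x : ℝ) {t : ℝ} (ht : 0 < t) :
    besselInt (v + 1) x t + besselInt (v - 1) x t = (t + t⁻¹) * besselInt v x t := by
  unfold besselInt
  rw [show v + 1 - 1 = v - 1 + 1 by ring, show v - 1 - 1 = v - 1 + (-1) by ring,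
    zpow_add₀ ht.ne', zpow_add₀ ht.ne', zpow_one, zpow_neg_one]
  ring

theorem hasDerivAt_besselK (v : ℤ) {x : ℝ} (hx : 0 < x) :
    HasDerivAt (besselK v) (-(1 / 2) * (besselK (v - 1) x + besselK (v + 1) x)) x := by
  have key := hasDerivAt_integral_of_dominated_loc_of_deriv_le (μ := volume.restrict (Set.Ioi 0))
    (F := fun x t => besselInt v x t) (x₀ := x) (s := Set.Ioi (x / 2))
    (F' := fun x t => -(1 / 2) * (besselInt (v + 1) x t + besselInt (v - 1) x t))
    (bound := fun t => (1 / 2) * (besselInt (v + 1) (x / 2) t + besselInt (v - 1) (x / 2) t))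
    (Ioi_mem_nhds (by linarith))
    (Filter.Eventually.of_forall fun y => (continuousOn_besselInt v y).aestronglyMeasurable
      measurableSet_Ioi)
    (integrableOn_besselInt v hx)
    ((((continuousOn_besselInt (v + 1) x).add
      (continuousOn_besselInt (v - 1) x)).const_smul (-(1 / 2 : ℝ))).aestronglyMeasurable
      measurableSet_Ioi)
    ?_ ?_ ?_
  · have h := key.2.const_mul (1 / 2 : ℝ)
    rw [integral_const_mul, integral_add (integrableOn_besselInt _ hx)
      (integrableOn_besselInt _ hx)] at h
    have e : (fun y => 1 / 2 * ∫ a in Set.Ioi 0, besselInt v y a) = besselK v := rfl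
    rw [e] at h
    refine h.congr_deriv ?_
    rw [besselK_eq, besselK_eq]; ring
  · refine (ae_restrict_iff' measurableSet_Ioi).2 (Filter.Eventually.of_forall fun t ht y hy => ?_)
    have hmono : ∀ w, besselInt w y t ≤ besselInt w (x / 2) t := fun w => by
      unfold besselInt
      have ht' : (0 : ℝ) < t := ht
      have h1 : x / 2 ≤ y := le_of_lt hy
      refine mul_le_mul_of_nonneg_left (Real.exp_le_exp.2 ?_) (by positivity)
      have : 0 < t + t⁻¹ := by positivity
      nlinarith
    rw [norm_mul, Real.norm_of_nonneg (add_pos (besselInt_pos _ _ ht) (besselInt_pos _ _ ht)).le]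
    have := hmono (v + 1)
    have := hmono (v - 1)
    rw [show ‖(-(1 / 2) : ℝ)‖ = 1 / 2 by norm_num]
    linarith
  · exact ((integrableOn_besselInt _ (half_pos hx)).add
      (integrableOn_besselInt _ (half_pos hx))).const_mul _
  · refine (ae_restrict_iff' measurableSet_Ioi).2 (Filter.Eventually.of_forall fun t ht y hy => ?_)
    rw [besselInt_sub v y ht]
    have h1 : HasDerivAt (fun y : ℝ => -y * (t + t⁻¹) / 2) (-1 * (t + t⁻¹) / 2) y :=
      (((hasDerivAt_id y).neg).mul_const _).div_const _
    have h2 := (h1.exp).const_mul (t ^ (v - 1))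
    refine h2.congr_deriv ?_
    unfold besselInt
    ring

theorem tendsto_besselInt_zero (v : ℤ) {x : ℝ} (hx : 0 < x) :
    Filter.Tendsto (besselInt v x) (𝓝[>] 0) (𝓝 0) := by
  obtain ⟨m, N, h, -⟩ := exists_shift (v - 1) 0
  have h' : v - 1 + m = (N + 1 : ℕ) := by push_cast; linarith
  have hlim : Filter.Tendsto (fun t : ℝ => m.factorial * (2 / x) ^ m *
      (t ^ (N + 1) * Real.exp (-(x / 2) * t))) (𝓝[>] 0) (𝓝 0) := by
    have hc : Continuous fun t : ℝ => m.factorial * (2 / x) ^ m *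
      (t ^ (N + 1) * Real.exp (-(x / 2) * t)) := by fun_prop
    have := (hc.tendsto 0).mono_left (nhdsWithin_le_nhds (s := Set.Ioi 0))
    simpa using this
  refine squeeze_zero' ?_ ?_ hlim
  · filter_upwards [self_mem_nhdsWithin] with t ht using (besselInt_pos v x ht).le
  · filter_upwards [self_mem_nhdsWithin] with t ht using besselInt_le h' hx ht

theorem tendsto_besselInt_atTop (v : ℤ) {x : ℝ} (hx : 0 < x) :
    Filter.Tendsto (besselInt v x) Filter.atTop (𝓝 0) := by
  obtain ⟨m, N, h, -⟩ := exists_shift v 0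
  have hlim : Filter.Tendsto (fun t : ℝ => m.factorial * (2 / x) ^ m *
      (t ^ N * Real.exp (-(x / 2) * t))) Filter.atTop (𝓝 0) := by
    have h1 := (Real.tendsto_pow_mul_exp_neg_atTop_nhds_zero N).comp
      (Filter.tendsto_id.const_mul_atTop (half_pos hx))
    have h2 := h1.const_mul (m.factorial * (2 / x) ^ m * (2 / x) ^ N)
    rw [mul_zero] at h2
    refine h2.congr fun t => ?_
    simp only [Function.comp, id]
    rw [mul_pow, neg_mul, div_pow x 2 N, div_pow 2 x N]
    field_simp
  refine squeeze_zero' ?_ ?_ hlim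
  · filter_upwards [Filter.eventually_gt_atTop 0] with t ht using (besselInt_pos v x ht).le
  · filter_upwards [Filter.eventually_gt_atTop 0] with t ht using besselInt_le h hx ht

theorem besselK_recurrence (v : ℤ) {x : ℝ} (hx : 0 < x) :
    x * (besselK (v + 1) x - besselK (v - 1) x) = 2 * v * besselK v x := by
  classical
  have hd : ∀ t ∈ Set.Ioi (0 : ℝ), HasDerivAt (Function.update (besselInt (v + 1) x) 0 0)
      (v * besselInt v x t - x / 2 * (besselInt (v + 1) x t - besselInt (v - 1) x t)) t := by
    intro t ht
    have ht' : (0 : ℝ) < t := ht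
    have h1 : HasDerivAt (fun t : ℝ => -x * (t + t⁻¹) / 2) (-x * (1 + -(t ^ 2)⁻¹) / 2) t :=
      (((hasDerivAt_id t).add (hasDerivAt_inv ht'.ne')).const_mul (-x)).div_const 2
    have h2 := (hasDerivAt_zpow (v + 1 - 1) t (Or.inl ht'.ne')).mul h1.exp
    have h3 : HasDerivAt (besselInt (v + 1) x)
        (v * besselInt v x t - x / 2 * (besselInt (v + 1) x t - besselInt (v - 1) x t)) t := by
      refine h2.congr_deriv ?_
      unfold besselInt
      rw [show v + 1 - 1 = v - 1 - 1 + 2 by ring, show v - 1 - 1 + 2 - 1 = v - 1 - 1 + 1 by ring,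
        zpow_add₀ ht'.ne', zpow_add₀ ht'.ne', show v - 1 = v - 1 - 1 + 1 by ring,
        zpow_add₀ ht'.ne', show v - 1 - 1 + 1 - 1 = v - 1 - 1 by ring]
      simp only [zpow_ofNat]
      push_cast
      field_simp
      ring
    refine h3.congr_of_eventuallyEq ?_
    filter_upwards [Ioi_mem_nhds ht'] with s hs
    rw [Function.update_of_ne (ne_of_gt hs)]
  have hc : ContinuousWithinAt (Function.update (besselInt (v + 1) x) 0 0) (Set.Ici 0) 0 := by
    rw [continuousWithinAt_update_same]
    rw [Set.Ici_sdiff_left]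
    exact tendsto_besselInt_zero (v + 1) hx
  have hi : IntegrableOn (fun t => v * besselInt v x t - x / 2 *
      (besselInt (v + 1) x t - besselInt (v - 1) x t)) (Set.Ioi 0) :=
    ((integrableOn_besselInt v hx).const_mul _).sub
      (((integrableOn_besselInt _ hx).sub (integrableOn_besselInt _ hx)).const_mul _)
  have hl : Filter.Tendsto (Function.update (besselInt (v + 1) x) 0 0) Filter.atTop (𝓝 0) := by
    refine (tendsto_besselInt_atTop (v + 1) hx).congr' ?_
    filter_upwards [Filter.eventually_gt_atTop 0] with s hs
    rw [Function.update_of_ne (ne_of_gt hs)]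
  have := integral_Ioi_of_hasDerivAt_of_tendsto hc hd hi hl
  have i1 : Integrable (fun t => v * besselInt v x t) (volume.restrict (Set.Ioi 0)) :=
    (integrableOn_besselInt v hx).const_mul _
  have i2 : Integrable (fun t => x / 2 * (besselInt (v + 1) x t - besselInt (v - 1) x t))
    (volume.restrict (Set.Ioi 0)) :=
    ((integrableOn_besselInt _ hx).sub (integrableOn_besselInt _ hx)).const_mul _
  rw [integral_sub i1 i2, integral_const_mul, integral_const_mul,
    integral_sub (integrableOn_besselInt _ hx) (integrableOn_besselInt _ hx)] at this
  simp only [Function.update_self, sub_zero] at this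
  rw [besselK_eq, besselK_eq, besselK_eq]
  linarith

theorem contDiffOn_besselK (v : ℤ) : ContDiffOn ℝ ∞ (besselK v) (Set.Ioi 0) := by
  rw [contDiffOn_infty]
  intro m
  induction m generalizing v with
  | zero =>
    exact contDiffOn_zero.2 fun x hx => (hasDerivAt_besselK v hx).continuousAt.continuousWithinAt
  | succ m ih =>
    have : ((m + 1 : ℕ) : WithTop ℕ∞) = (m : WithTop ℕ∞) + 1 := by simp
    rw [this, contDiffOn_succ_iff_deriv_of_isOpen isOpen_Ioi]
    refine ⟨fun x hx => (hasDerivAt_besselK v hx).differentiableAt.differentiableWithinAt,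
      by simp, ?_⟩
    refine ((ContDiffOn.add (ih (v - 1)) (ih (v + 1))).const_smul (-(1 / 2 : ℝ))).congr ?_
    intro x hx
    rw [(hasDerivAt_besselK v hx).deriv]
    simp

/-- `K_1` blows up at the origin. -/
theorem exp_div_le_besselK_one {x : ℝ} (hx : 0 < x) : Real.exp (-x) / x ≤ besselK 1 x := by
  have h1 : ∫ t in Set.Ioi (1 : ℝ), Real.exp (-(x / 2) * t) * Real.exp (-(x / 2)) ≤
      ∫ t in Set.Ioi 1, besselInt 1 x t := by
    refine setIntegral_mono_on ((exp_neg_integrableOn_Ioi 1 (half_pos hx)).mul_const _)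
      ((integrableOn_besselInt 1 hx).mono_set (Set.Ioi_subset_Ioi zero_le_one))
      measurableSet_Ioi fun t ht => ?_
    have ht' : (1 : ℝ) < t := ht
    unfold besselInt
    rw [sub_self, zpow_zero, one_mul, ← Real.exp_add]
    refine Real.exp_le_exp.2 ?_
    have : t⁻¹ ≤ 1 := inv_le_one_of_one_le₀ ht'.le
    nlinarith
  have h2 : ∫ t in Set.Ioi 1, besselInt 1 x t ≤ ∫ t in Set.Ioi 0, besselInt 1 x t :=
    setIntegral_mono_set (integrableOn_besselInt 1 hx)
      ((ae_restrict_iff' measurableSet_Ioi).2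
        (Filter.Eventually.of_forall fun t ht => (besselInt_pos 1 x ht).le))
      (LE.le.eventuallyLE (Set.Ioi_subset_Ioi zero_le_one))
  rw [integral_mul_const, integral_exp_mul_Ioi (by linarith)] at h1
  rw [besselK_eq]
  have h3 : Real.exp (-x) = Real.exp (-(x / 2) * 1) * Real.exp (-(x / 2)) := by
    rw [← Real.exp_add]; congr 1; ring
  have h4 : Real.exp (-x) / x = 1 / 2 * (-Real.exp (-(x / 2) * 1) / -(x / 2) *
    Real.exp (-(x / 2))) := by rw [h3]; field_simp
  rw [h4]
  linarith

/-! ### The coefficients of the Whittaker function -/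

/-- `(|β| / β)^v K_v(|β|)`. -/
def kap (v : ℤ) (b : ℂ) : ℂ := (((‖b‖ : ℝ) : ℂ) / b) ^ v * ((besselK v ‖b‖ : ℝ) : ℂ)

theorem kap_ne_zero (v : ℤ) {b : ℂ} (hb : b ≠ 0) : kap v b ≠ 0 := by
  refine mul_ne_zero (zpow_ne_zero _ (div_ne_zero ?_ hb)) ?_
  · simpa using hb
  · exact_mod_cast (besselK_pos v (norm_pos_iff.2 hb)).ne'

theorem norm_kap (v : ℤ) {b : ℂ} (hb : b ≠ 0) : ‖kap v b‖ = besselK v ‖b‖ := by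
  rw [kap, norm_mul, norm_zpow, norm_div, Complex.norm_real, Complex.norm_real, norm_norm,
    div_self (norm_ne_zero_iff.2 hb), one_zpow, one_mul,
    Real.norm_of_nonneg (besselK_pos v (norm_pos_iff.2 hb)).le]

theorem kap_recurrence (v : ℤ) {b : ℂ} (hb : b ≠ 0) :
    b * kap (v + 1) b - conj b * kap (v - 1) b = 2 * v * kap v b := by
  have hr := besselK_recurrence v (norm_pos_iff.2 hb)
  have hr' : ((‖b‖ : ℝ) : ℂ) * (((besselK (v + 1) ‖b‖ : ℝ) : ℂ) - ((besselK (v - 1) ‖b‖ : ℝ) : ℂ)) =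
    2 * v * ((besselK v ‖b‖ : ℝ) : ℂ) := by exact_mod_cast hr
  have hn : ((‖b‖ : ℝ) : ℂ) ≠ 0 := by simpa using hb
  have hq : ((‖b‖ : ℝ) : ℂ) / b ≠ 0 := div_ne_zero hn hb
  have hc : conj b = ((‖b‖ : ℝ) : ℂ) ^ 2 / b := by
    rw [← Complex.conj_mul', mul_div_cancel_right₀ _ hb]
  unfold kap
  rw [zpow_add_one₀ hq, zpow_sub_one₀ hq, hc]
  generalize ((‖b‖ : ℝ) : ℂ) = r at *
  have e : b * ((r / b) ^ v * (r / b) * ((besselK (v + 1) ‖b‖ : ℝ) : ℂ)) - r ^ 2 / b *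
      ((r / b) ^ v * (r / b)⁻¹ * ((besselK (v - 1) ‖b‖ : ℝ) : ℂ)) = (r / b) ^ v * (r *
      (((besselK (v + 1) ‖b‖ : ℝ) : ℂ) - ((besselK (v - 1) ‖b‖ : ℝ) : ℂ))) := by
    field_simp
  rw [e, hr']; ring

theorem hasDerivAt_norm_comp {b : ℝ → ℂ} {b' : ℂ} {t : ℝ} (h : HasDerivAt b b' t) (hb : b t ≠ 0) :
    HasDerivAt (fun s => ‖b s‖) ((conj (b t) * b').re / ‖b t‖) t := by
  have h1 := h.norm_sq
  have h2 := h1.sqrt (by simpa using hb)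
  have e : (fun s => √(‖b s‖ ^ 2)) = fun s => ‖b s‖ := by
    funext s; rw [Real.sqrt_sq (norm_nonneg _)]
  rw [e] at h2
  refine h2.congr_deriv ?_
  rw [Real.sqrt_sq (norm_nonneg _), Complex.inner]
  field_simp

theorem hasDerivAt_kap (v : ℤ) {b : ℝ → ℂ} {b' : ℂ} {t : ℝ} (h : HasDerivAt b b' t)
    (hb : b t ≠ 0) : HasDerivAt (fun s => kap v (b s))
      (-(1 / 2) * (b' * kap (v + 1) (b t) + conj b' * kap (v - 1) (b t))) t := by
  have hn := hasDerivAt_norm_comp h hb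
  have hnC := hn.ofReal_comp
  have hp := norm_pos_iff.2 hb
  have h0 : ((‖b t‖ : ℝ) : ℂ) ≠ 0 := by simpa using hb
  have hq : ((‖b t‖ : ℝ) : ℂ) / b t ≠ 0 := div_ne_zero h0 hb
  have h1 := (hasDerivAt_zpow v _ (Or.inl hq)).comp t (hnC.div h hb)
  have h2 := ((hasDerivAt_besselK v hp).comp t hn).ofReal_comp
  have h3 := h1.mul h2
  refine h3.congr_deriv ?_
  have hr := besselK_recurrence v hp
  have hr' : ((‖b t‖ : ℝ) : ℂ) * (((besselK (v + 1) ‖b t‖ : ℝ) : ℂ) -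
    ((besselK (v - 1) ‖b t‖ : ℝ) : ℂ)) = 2 * v * ((besselK v ‖b t‖ : ℝ) : ℂ) := by exact_mod_cast hr
  have hre : (((conj (b t) * b').re : ℝ) : ℂ) = (conj (b t) * b' + b t * conj b') / 2 := by
    rw [Complex.re_eq_add_conj]; simp
  have hc : conj (b t) = ((‖b t‖ : ℝ) : ℂ) ^ 2 / b t := by
    rw [← Complex.conj_mul', mul_div_cancel_right₀ _ hb]
  simp only [Function.comp, Pi.div_apply]
  unfold kap
  rw [zpow_add_one₀ hq, zpow_sub_one₀ hq]
  push_cast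
  rw [hre, hc]
  generalize hB : b t = B at *
  generalize ((‖B‖ : ℝ) : ℂ) = r at *
  generalize ((besselK v ‖B‖ : ℝ) : ℂ) = k at *
  generalize ((besselK (v + 1) ‖B‖ : ℝ) : ℂ) = k1 at *
  generalize ((besselK (v - 1) ‖B‖ : ℝ) : ℂ) = k2 at *
  generalize hQ : (r / B) ^ v = Q
  have hk : (v : ℂ) * k = r * (k1 - k2) / 2 := by rw [hr']; ring
  have e1 : (v : ℂ) * (Q * (r / B)⁻¹) *
    (((r ^ 2 / B * b' + B * conj b') / 2 / r * B - r * b') / B ^ 2) * k =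
    Q * (r / B)⁻¹ *
    (((r ^ 2 / B * b' + B * conj b') / 2 / r * B - r * b') / B ^ 2) * (v * k) := by ring
  rw [e1, hk]
  field_simp
  ring

end

end QWhittaker

namespace QWhittaker

noncomputable section

/-! ### Binary forms as polynomial functions -/

/-- The binary form `∑ c_a [u₀^{N-a}] [u₁^a]` of degree `N = M - 1`, as a function. -/
def formEval {M : ℕ} (c : Fin M → ℂ) (u : Fin 2 → ℂ) : ℂ :=
  ∑ a : Fin M, c a * ((((M - 1 - (a : ℕ)).factorial * (a : ℕ).factorial : ℕ) : ℂ)⁻¹ *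
    (u 0 ^ (M - 1 - (a : ℕ)) * u 1 ^ (a : ℕ)))

theorem formEval_add {M : ℕ} (c d : Fin M → ℂ) (u : Fin 2 → ℂ) :
    formEval (c + d) u = formEval c u + formEval d u := by
  simp [formEval, add_mul, Finset.sum_add_distrib]

theorem formEval_smul {M : ℕ} (r : ℂ) (c : Fin M → ℂ) (u : Fin 2 → ℂ) :
    formEval (r • c) u = r * formEval c u := by
  simp [formEval, Finset.mul_sum, mul_assoc]

theorem formEval_zero {M : ℕ} (u : Fin 2 → ℂ) : formEval (0 : Fin M → ℂ) u = 0 := by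
  simp [formEval]

/-- Evaluation of binary forms at a point, as a linear map. -/
def formEvalₗ {M : ℕ} (u : Fin 2 → ℂ) : (Fin M → ℂ) →ₗ[ℂ] ℂ where
  toFun c := formEval c u
  map_add' c d := formEval_add c d u
  map_smul' r c := formEval_smul r c u

theorem eq_zero_of_formEval_nat {M : ℕ} {c : Fin M → ℂ}
    (h : ∀ i : Fin M, formEval c ![1, ((i : ℕ) : ℂ)] = 0) : c = 0 := by
  have := Matrix.eq_zero_of_forall_index_sum_pow_mul_eq_zero (R := ℂ)
    (f := fun i : Fin M => ((i : ℕ) : ℂ))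
    (v := fun a : Fin M => c a * (((M - 1 - (a : ℕ)).factorial * (a : ℕ).factorial : ℕ) : ℂ)⁻¹)
    (fun i j hij => Fin.ext (Nat.cast_injective (R := ℂ) hij)) (fun i => by
      rw [← h i]
      refine Finset.sum_congr rfl fun a _ => ?_
      simp; ring)
  funext a
  have h1 := congrFun this a
  simp only [Pi.zero_apply, mul_eq_zero, inv_eq_zero, Nat.cast_eq_zero] at h1 ⊢
  rcases h1 with h1 | h1 | h1
  · exact h1
  · exact absurd h1 (Nat.factorial_ne_zero _)
  · exact absurd h1 (Nat.factorial_ne_zero _)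

theorem formEval_injective {M : ℕ} {c d : Fin M → ℂ} (h : ∀ u, formEval c u = formEval d u) :
    c = d := by
  have : c + (-1 : ℂ) • d = 0 := eq_zero_of_formEval_nat fun i => by
    rw [formEval_add, formEval_smul, h]; ring
  funext a
  have := congrFun this a
  simp at this
  linear_combination this

theorem eval_toSym (ℓ : ℕ) (c : VEll ℓ) (u : Fin 2 → ℂ) :
    MvPolynomial.eval u (toSym ℓ c) = formEval c u := by
  simp [toSym, formEval, LinearMap.sum_apply, map_sum, MvPolynomial.smul_eval]

theorem eval_symSubst (A : Matrix (Fin 2) (Fin 2) ℂ) (p : MvPolynomial (Fin 2) ℂ)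
    (u : Fin 2 → ℂ) :
    MvPolynomial.eval u (symSubst A p) = MvPolynomial.eval (A *ᵥ u) p := by
  have h : (MvPolynomial.aeval u).comp (symSubst A) =
      (MvPolynomial.aeval (A *ᵥ u) : MvPolynomial (Fin 2) ℂ →ₐ[ℂ] ℂ) := by
    refine MvPolynomial.algHom_ext fun i => ?_
    fin_cases i <;> simp [symSubst]
  exact DFunLike.congr_fun h p

theorem isActK_iff {n ℓ : ℕ} (k : U n) (x y : VEll ℓ) : IsActK k x y ↔
    ∀ u, formEval y u = (((toMat k).toBlocks₁₁.det ^ ℓ)⁻¹) *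
      formEval x ((toMat k).toBlocks₁₁ *ᵥ u) := by
  simp only [← eval_toSym, ← eval_symSubst]
  constructor
  · intro h u
    rw [h, MvPolynomial.smul_eval]
  · intro h
    refine MvPolynomial.funext fun u => ?_
    rw [h, MvPolynomial.smul_eval]

theorem hasDerivAt_formEval {M : ℕ} (c : Fin (M + 1) → ℂ) {u : ℝ → Fin 2 → ℂ} {u' : Fin 2 → ℂ}
    {t : ℝ} (h0 : HasDerivAt (fun s => u s 0) (u' 0) t)
    (h1 : HasDerivAt (fun s => u s 1) (u' 1) t) :
    HasDerivAt (fun s => formEval c (u s))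
      (u' 0 * formEval (fun a : Fin M => c a.castSucc) (u t) +
        u' 1 * formEval (fun a : Fin M => c a.succ) (u t)) t := by
  have h : HasDerivAt (fun s => formEval c (u s)) (∑ a : Fin (M + 1), c a *
      ((((M + 1 - 1 - (a : ℕ)).factorial * (a : ℕ).factorial : ℕ) : ℂ)⁻¹ *
        (((M + 1 - 1 - (a : ℕ) : ℕ) * u t 0 ^ (M + 1 - 1 - (a : ℕ) - 1) * u' 0) * u t 1 ^ (a : ℕ) +
          u t 0 ^ (M + 1 - 1 - (a : ℕ)) * ((a : ℕ) * u t 1 ^ ((a : ℕ) - 1) * u' 1)))) t :=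
    HasDerivAt.fun_sum fun a _ => (((h0.fun_pow _).mul (h1.fun_pow _)).const_mul _).const_mul _
  refine h.congr_deriv ?_
  simp only [mul_add, Finset.sum_add_distrib]
  congr 1
  · rw [Fin.sum_univ_castSucc]
    simp only [Fin.val_last, Fin.val_castSucc, Nat.add_sub_cancel, Nat.sub_self, Nat.cast_zero,
      zero_mul, mul_zero, add_zero]
    rw [formEval, Finset.mul_sum]
    refine Finset.sum_congr rfl fun a _ => ?_
    obtain ⟨b, hb⟩ : ∃ b, M - (a : ℕ) = b + 1 := ⟨M - a - 1, by omega⟩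
    rw [show M - 1 - (a : ℕ) = b by omega, hb, Nat.factorial_succ]
    have h1 : ((b + 1 : ℕ) : ℂ) ≠ 0 := Nat.cast_ne_zero.2 (Nat.succ_ne_zero _)
    push_cast at h1 ⊢
    field_simp
  · rw [Fin.sum_univ_succ]
    simp only [Fin.val_zero, Fin.val_succ, Nat.add_sub_cancel, Nat.cast_zero,
      zero_mul, mul_zero, zero_add]
    rw [formEval, Finset.mul_sum]
    refine Finset.sum_congr rfl fun a _ => ?_
    rw [show M - 1 - (a : ℕ) = M - ((a : ℕ) + 1) by omega, Nat.factorial_succ]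
    have h1 : (((a : ℕ) + 1 : ℕ) : ℂ) ≠ 0 := Nat.cast_ne_zero.2 (Nat.succ_ne_zero _)
    push_cast at h1 ⊢
    field_simp

/-- `u₁ ∂/∂u₀` on coordinates. -/
def raise {M : ℕ} (c : Fin (M + 1) → ℂ) : Fin (M + 1) → ℂ :=
  Fin.cons 0 fun a : Fin M => ((a : ℕ) + 1 : ℂ) * c a.castSucc

/-- `u₀ ∂/∂u₁` on coordinates. -/
def sink {M : ℕ} (c : Fin (M + 1) → ℂ) : Fin (M + 1) → ℂ :=
  Fin.snoc (fun a : Fin M => ((M : ℂ) - (a : ℕ)) * c a.succ) 0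

theorem raise_succ {M : ℕ} (c : Fin (M + 1) → ℂ) (a : Fin M) :
    raise c a.succ = ((a : ℕ) + 1 : ℂ) * c a.castSucc := by simp [raise]

theorem sink_castSucc {M : ℕ} (c : Fin (M + 1) → ℂ) (a : Fin M) :
    sink c a.castSucc = ((M : ℂ) - (a : ℕ)) * c a.succ := by simp [sink]

theorem u0_mul_lower1 {M : ℕ} (c : Fin (M + 1) → ℂ) (u : Fin 2 → ℂ) :
    u 0 * formEval (fun a : Fin M => c a.castSucc) u =
      formEval (fun a : Fin (M + 1) => ((M : ℂ) - (a : ℕ)) * c a) u := by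
  rw [formEval, formEval, Fin.sum_univ_castSucc, Finset.mul_sum]
  simp only [Fin.val_last, Fin.val_castSucc, Nat.add_sub_cancel, sub_self, zero_mul, add_zero]
  refine Finset.sum_congr rfl fun a _ => ?_
  obtain ⟨b, hb⟩ : ∃ b, M - (a : ℕ) = b + 1 := ⟨M - a - 1, by omega⟩
  have e : (M : ℂ) - (a : ℕ) = (b + 1 : ℕ) := by
    rw [← hb, Nat.cast_sub a.2.le]
  rw [e, show M - 1 - (a : ℕ) = b by omega, hb, Nat.factorial_succ]
  have h1 : ((b + 1 : ℕ) : ℂ) ≠ 0 := Nat.cast_ne_zero.2 (Nat.succ_ne_zero _)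
  push_cast at h1 ⊢
  field_simp
  ring

theorem u1_mul_lower2 {M : ℕ} (c : Fin (M + 1) → ℂ) (u : Fin 2 → ℂ) :
    u 1 * formEval (fun a : Fin M => c a.succ) u =
      formEval (fun a : Fin (M + 1) => ((a : ℕ) : ℂ) * c a) u := by
  rw [formEval, formEval, Fin.sum_univ_succ, Finset.mul_sum]
  simp only [Fin.val_zero, Fin.val_succ, Nat.add_sub_cancel, Nat.cast_zero, zero_mul, zero_add]
  refine Finset.sum_congr rfl fun a _ => ?_
  rw [show M - 1 - (a : ℕ) = M - ((a : ℕ) + 1) by omega, Nat.factorial_succ]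
  have h1 : (((a : ℕ) + 1 : ℕ) : ℂ) ≠ 0 := Nat.cast_ne_zero.2 (Nat.succ_ne_zero _)
  push_cast at h1 ⊢
  field_simp
  ring

theorem u1_mul_lower1 {M : ℕ} (c : Fin (M + 1) → ℂ) (u : Fin 2 → ℂ) :
    u 1 * formEval (fun a : Fin M => c a.castSucc) u = formEval (raise c) u := by
  rw [formEval, formEval, Fin.sum_univ_succ, Finset.mul_sum]
  simp only [raise, Fin.cons_zero, Fin.cons_succ, Fin.val_zero, Fin.val_succ, Nat.add_sub_cancel,
    zero_mul, zero_add]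
  refine Finset.sum_congr rfl fun a _ => ?_
  rw [show M - 1 - (a : ℕ) = M - ((a : ℕ) + 1) by omega, Nat.factorial_succ]
  have h1 : (((a : ℕ) + 1 : ℕ) : ℂ) ≠ 0 := Nat.cast_ne_zero.2 (Nat.succ_ne_zero _)
  push_cast at h1 ⊢
  field_simp
  ring

theorem u0_mul_lower2 {M : ℕ} (c : Fin (M + 1) → ℂ) (u : Fin 2 → ℂ) :
    u 0 * formEval (fun a : Fin M => c a.succ) u = formEval (sink c) u := by
  rw [formEval, formEval, Fin.sum_univ_castSucc, Finset.mul_sum]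
  simp only [sink, Fin.snoc_castSucc, Fin.snoc_last, Fin.val_castSucc, Nat.add_sub_cancel,
    zero_mul, add_zero]
  refine Finset.sum_congr rfl fun a _ => ?_
  obtain ⟨b, hb⟩ : ∃ b, M - (a : ℕ) = b + 1 := ⟨M - a - 1, by omega⟩
  have e : (M : ℂ) - (a : ℕ) = (b + 1 : ℕ) := by
    rw [← hb, Nat.cast_sub a.2.le]
  rw [e, show M - 1 - (a : ℕ) = b by omega, hb, Nat.factorial_succ]
  have h1 : ((b + 1 : ℕ) : ℂ) ≠ 0 := Nat.cast_ne_zero.2 (Nat.succ_ne_zero _)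
  push_cast at h1 ⊢
  field_simp
  ring

/-- The infinitesimal action of a `2 × 2` matrix on binary forms, in coordinates. -/
theorem eq_of_formEval_infinitesimal {M : ℕ} {c d : Fin (M + 1) → ℂ} (r y00 y01 y10 y11 : ℂ)
    (h : ∀ u : Fin 2 → ℂ, formEval d u = r * formEval c u +
      ((y00 * u 0 + y01 * u 1) * formEval (fun a : Fin M => c a.castSucc) u +
        (y10 * u 0 + y11 * u 1) * formEval (fun a : Fin M => c a.succ) u)) (a : Fin (M + 1)) :
    d a = (r + ((M : ℂ) - (a : ℕ)) * y00 + (a : ℕ) * y11) * c a + y01 * raise c a +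
      y10 * sink c a := by
  have : d = r • c + y00 • (fun a : Fin (M + 1) => ((M : ℂ) - (a : ℕ)) * c a) +
      y11 • (fun a : Fin (M + 1) => ((a : ℕ) : ℂ) * c a) + y01 • raise c + y10 • sink c := by
    refine formEval_injective fun u => ?_
    rw [h]
    simp only [formEval_add, formEval_smul, ← u0_mul_lower1, ← u1_mul_lower2, ← u1_mul_lower1,
      ← u0_mul_lower2]
    ring
  rw [this]
  simp only [Pi.add_apply, Pi.smul_apply, smul_eq_mul]
  ring

/-- Functions on the plane given by binary forms of degree `N`. -/
def formSpace (N : ℕ) : Submodule ℂ ((Fin 2 → ℂ) → ℂ) where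
  carrier := {f | ∃ c : Fin (N + 1) → ℂ, ∀ u, f u = formEval c u}
  add_mem' := by
    rintro f g ⟨c, hc⟩ ⟨d, hd⟩
    exact ⟨c + d, fun u => by rw [Pi.add_apply, hc, hd, formEval_add]⟩
  zero_mem' := ⟨0, fun u => by rw [formEval_zero]; rfl⟩
  smul_mem' := by
    rintro r f ⟨c, hc⟩
    exact ⟨r • c, fun u => by rw [Pi.smul_apply, hc, formEval_smul, smul_eq_mul]⟩

theorem linear_mul_mem_formSpace {N : ℕ} {f : (Fin 2 → ℂ) → ℂ} (hf : f ∈ formSpace N) (p q : ℂ) :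
    (fun u => (p * u 0 + q * u 1) * f u) ∈ formSpace (N + 1) := by
  obtain ⟨c, hc⟩ := hf
  refine ⟨Fin.snoc (fun a : Fin (N + 1) => p * ((N + 1 : ℂ) - (a : ℕ)) * c a) 0 +
    Fin.cons 0 (fun a : Fin (N + 1) => q * ((a : ℕ) + 1 : ℂ) * c a), fun u => ?_⟩
  simp only
  rw [formEval_add, hc, add_mul]
  congr 1
  · have := u0_mul_lower1 (M := N + 1) (Fin.snoc c 0) u
    simp only [Fin.snoc_castSucc] at this
    rw [mul_assoc, this, ← formEval_smul]
    congr 1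
    funext a
    refine Fin.lastCases ?_ (fun a => ?_) a
    · simp
    · simp [mul_assoc]
  · have := u1_mul_lower2 (M := N + 1) (Fin.cons 0 c) u
    simp only [Fin.cons_succ] at this
    rw [mul_assoc, this, ← formEval_smul]
    congr 1
    funext a
    refine Fin.cases ?_ (fun a => ?_) a
    · simp
    · simp [mul_assoc]

theorem linear_pow_mem_formSpace (p q p' q' : ℂ) (i j : ℕ) :
    (fun u : Fin 2 → ℂ => (p * u 0 + q * u 1) ^ i * (p' * u 0 + q' * u 1) ^ j) ∈
      formSpace (i + j) := by
  induction i with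
  | zero =>
    induction j with
    | zero => exact ⟨fun _ => 1, fun u => by simp [formEval]⟩
    | succ j ih =>
      have := linear_mul_mem_formSpace ih p' q'
      rw [← Nat.add_assoc]
      convert this using 2 with u
      ring
  | succ i ih =>
    have := linear_mul_mem_formSpace ih p q
    rw [show i + 1 + j = i + j + 1 by ring]
    convert this using 2 with u
    ring

/-- Linear substitutions preserve binary forms. -/
theorem exists_formEval_comp {N : ℕ} (c : Fin (N + 1) → ℂ) (p q p' q' : ℂ) :
    ∃ d : Fin (N + 1) → ℂ, ∀ u, formEval d u =
      formEval c ![p * u 0 + q * u 1, p' * u 0 + q' * u 1] := by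
  have : (fun u : Fin 2 → ℂ => formEval c ![p * u 0 + q * u 1, p' * u 0 + q' * u 1]) ∈
      formSpace N := by
    have e : (fun u : Fin 2 → ℂ => formEval c ![p * u 0 + q * u 1, p' * u 0 + q' * u 1]) =
        ∑ a : Fin (N + 1), (c a *
          (((N + 1 - 1 - (a : ℕ)).factorial * (a : ℕ).factorial : ℕ) : ℂ)⁻¹) •
          fun u : Fin 2 → ℂ => (p * u 0 + q * u 1) ^ (N - (a : ℕ)) *
            (p' * u 0 + q' * u 1) ^ (a : ℕ) := by
      funext u
      rw [Finset.sum_apply]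
      simp [formEval, mul_assoc]
    rw [e]
    refine Submodule.sum_mem _ fun a _ => Submodule.smul_mem _ _ ?_
    have := linear_pow_mem_formSpace p q p' q' (N - (a : ℕ)) a
    rwa [Nat.sub_add_cancel (Nat.lt_succ_iff.1 a.2)] at this
  obtain ⟨d, hd⟩ := this
  exact ⟨d, fun u => (hd u).symm⟩

/-- Values of a binary form at sufficiently many points. -/
def formValues (M : ℕ) : (Fin M → ℂ) →ₗ[ℂ] (Fin M → ℂ) :=
  LinearMap.pi fun i => formEvalₗ ![1, ((i : ℕ) : ℂ)]

theorem exists_interpolation (M : ℕ) :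
    ∃ Ψ : (Fin M → ℂ) →ₗ[ℂ] (Fin M → ℂ), ∀ c, Ψ (formValues M c) = c := by
  have hinj : LinearMap.ker (formValues M) = ⊥ := by
    refine LinearMap.ker_eq_bot'.2 fun c hc => eq_zero_of_formEval_nat fun i => congrFun hc i
  obtain ⟨Ψ, hΨ⟩ := LinearMap.exists_leftInverse_of_injective _ hinj
  exact ⟨Ψ, fun c => by rw [← LinearMap.comp_apply, hΨ]; rfl⟩

end

end QWhittaker

namespace QWhittaker

noncomputable section

/-! ### Group elements, exponentials and the right regular action -/

section Basics

variable {n : ℕ}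

theorem toMat_mul (g h : U n) : toMat (g * h) = toMat g * toMat h := rfl

theorem toMat_one : toMat (1 : U n) = 1 := rfl

theorem toMat_injective {g h : U n} (e : toMat g = toMat h) : g = h :=
  Subtype.ext (Units.ext e)

theorem toMat_mul_inv (g : U n) : toMat g * toMat g⁻¹ = 1 := by
  rw [← toMat_mul, mul_inv_cancel, toMat_one]

theorem toMat_inv_mul (g : U n) : toMat g⁻¹ * toMat g = 1 := by
  rw [← toMat_mul, inv_mul_cancel, toMat_one]

theorem toMat_expU (X : lie n) : toMat (expU X) = NormedSpace.exp (X : Matrix (Idx n) (Idx n) ℂ) :=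
  rfl

theorem act_mul (x : Vec n) (g h : U n) : act x (g * h) = act (act x g) h := by
  simp [act, toMat_mul, Matrix.vecMul_vecMul]

theorem act_one (x : Vec n) : act x 1 = x := by simp [act, toMat_one]

theorem act_inv_act (x : Vec n) (g : U n) : act (act x g⁻¹) g = x := by
  rw [← act_mul, inv_mul_cancel, act_one]

theorem act_act_inv (x : Vec n) (g : U n) : act (act x g) g⁻¹ = x := by
  rw [← act_mul, mul_inv_cancel, act_one]

theorem act_add (x y : Vec n) (g : U n) : act (x + y) g = act x g + act y g :=
  Matrix.add_vecMul _ _ _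

theorem act_sub (x y : Vec n) (g : U n) : act (x - y) g = act x g - act y g :=
  Matrix.sub_vecMul _ _ _

theorem act_smul (c : ℂ) (x : Vec n) (g : U n) : act (c • x) g = c • act x g :=
  Matrix.smul_vecMul _ _ _

theorem herm_act (x y : Vec n) (g : U n) : herm (act x g) (act y g) = herm x y := g.2 x y

theorem herm_act_left (x y : Vec n) (g : U n) : herm (act x g) y = herm x (act y g⁻¹) := by
  rw [← herm_act x (act y g⁻¹) g, act_inv_act]

theorem herm_act_right (x y : Vec n) (g : U n) : herm x (act y g) = herm (act x g⁻¹) y := by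
  rw [← herm_act (act x g⁻¹) y g, act_inv_act]

theorem herm_neg_left (x y : Vec n) : herm (-x) y = -herm x y := by
  rw [← neg_one_smul ℂ, herm_smul_left]; ring

theorem herm_neg_right (x y : Vec n) : herm x (-y) = -herm x y := by
  rw [← neg_one_smul ℂ, herm_smul_right]; simp

theorem herm_sub_left (x x' y : Vec n) : herm (x - x') y = herm x y - herm x' y := by
  rw [sub_eq_add_neg, herm_add_left, herm_neg_left]; ring

theorem herm_sub_right (x y y' : Vec n) : herm x (y - y') = herm x y - herm x y' := by
  rw [sub_eq_add_neg, herm_add_right, herm_neg_right]; ring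

theorem herm_zero_left (y : Vec n) : herm 0 y = 0 := by simp [herm]

theorem herm_zero_right (y : Vec n) : herm y 0 = 0 := by simp [herm]

theorem matrix_ext_vecMul {A B : Matrix (Idx n) (Idx n) ℂ} (h : ∀ v : Vec n, v ᵥ* A = v ᵥ* B) :
    A = B := by
  ext i j
  have := congrFun (h (Pi.single i 1)) j
  simpa using this

theorem tens_add_left (x x' y : Vec n) : tens (x + x') y = tens x y + tens x' y :=
  matrix_ext_vecMul fun v => by simp [Matrix.vecMul_add, vecMul_tens]

theorem tens_add_right (x y y' : Vec n) : tens x (y + y') = tens x y + tens x y' :=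
  matrix_ext_vecMul fun v => by simp [Matrix.vecMul_add, vecMul_tens, herm_add_right, add_smul]

theorem tens_smul_left (c : ℂ) (x y : Vec n) : tens (c • x) y = c • tens x y :=
  matrix_ext_vecMul fun v => by simp [Matrix.vecMul_smul, vecMul_tens, smul_smul, mul_comm]

theorem tens_smul_right (c : ℂ) (x y : Vec n) : tens x (c • y) = conj c • tens x y :=
  matrix_ext_vecMul fun v => by simp [Matrix.vecMul_smul, vecMul_tens, smul_smul, herm_smul_right]

theorem toMat_mul_tens (m : U n) (x y : Vec n) :
    toMat m * tens x y = tens (act x m⁻¹) (act y m⁻¹) * toMat m :=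
  matrix_ext_vecMul fun v => by
    rw [← Matrix.vecMul_vecMul, ← Matrix.vecMul_vecMul, vecMul_tens, vecMul_tens,
      Matrix.smul_vecMul]
    change herm (act v m) y • x = herm v (act y m⁻¹) • act (act x m⁻¹) m
    rw [act_inv_act, herm_act_left]

theorem skewTens_add_left (x x' y : Vec n) :
    skewTens (x + x') y = skewTens x y + skewTens x' y :=
  Subtype.ext (by simp only [skewTens, Submodule.coe_add, tens_add_left, tens_add_right]; abel)

theorem skewTens_add_right (x y y' : Vec n) :
    skewTens x (y + y') = skewTens x y + skewTens x y' :=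
  Subtype.ext (by simp only [skewTens, Submodule.coe_add, tens_add_left, tens_add_right]; abel)

theorem skewTens_real_smul_left (r : ℝ) (x y : Vec n) :
    skewTens ((r : ℂ) • x) y = r • skewTens x y :=
  Subtype.ext (by
    simp only [skewTens, Submodule.coe_smul, tens_smul_left, tens_smul_right, Complex.conj_ofReal,
      ← smul_sub]
    rfl)

theorem skewTens_real_smul_right (r : ℝ) (x y : Vec n) :
    skewTens x ((r : ℂ) • y) = r • skewTens x y :=
  Subtype.ext (by
    simp only [skewTens, Submodule.coe_smul, tens_smul_left, tens_smul_right, Complex.conj_ofReal,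
      ← smul_sub]
    rfl)

theorem skewTens_I_smul_left (x y : Vec n) : skewTens (Complex.I • x) y = symTens x y :=
  Subtype.ext (by
    simp only [skewTens, symTens, tens_smul_left, tens_smul_right, Complex.conj_I, smul_add]
    module)

theorem skewTens_I_smul_right (x y : Vec n) : skewTens x (Complex.I • y) = -symTens x y :=
  Subtype.ext (by
    simp only [skewTens, symTens, tens_smul_left, tens_smul_right, Complex.conj_I, smul_add,
      Submodule.coe_neg]
    module)

theorem skewTens_swap (x y : Vec n) : skewTens y x = -skewTens x y :=
  Subtype.ext (by simp [skewTens])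

theorem symTens_eq (x y : Vec n) : symTens x y = skewTens (Complex.I • x) y :=
  (skewTens_I_smul_left x y).symm

theorem vecMul_skewTens (v x y : Vec n) :
    v ᵥ* (skewTens x y : Matrix (Idx n) (Idx n) ℂ) = herm v y • x - herm v x • y := by
  simp [skewTens, Matrix.vecMul_sub, vecMul_tens]

theorem vecMul_diagTens (v x : Vec n) :
    v ᵥ* (diagTens x : Matrix (Idx n) (Idx n) ℂ) = (Complex.I * herm v x) • x := by
  simp [diagTens, Matrix.vecMul_smul, vecMul_tens, smul_smul]

theorem toMat_mul_skewTens (m : U n) (x y : Vec n) :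
    toMat m * (skewTens x y : Matrix (Idx n) (Idx n) ℂ) =
      (skewTens (act x m⁻¹) (act y m⁻¹) : Matrix (Idx n) (Idx n) ℂ) * toMat m := by
  simp only [skewTens, mul_sub, sub_mul, toMat_mul_tens]

theorem toMat_mul_diagTens (m : U n) (x : Vec n) :
    toMat m * (diagTens x : Matrix (Idx n) (Idx n) ℂ) =
      (diagTens (act x m⁻¹) : Matrix (Idx n) (Idx n) ℂ) * toMat m := by
  simp only [diagTens, Matrix.mul_smul, Matrix.smul_mul, toMat_mul_tens]

theorem mul_expU_eq {m : U n} {X Y : lie n}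
    (h : toMat m * (X : Matrix (Idx n) (Idx n) ℂ) = (Y : Matrix (Idx n) (Idx n) ℂ) * toMat m) :
    m * expU X = expU Y * m := by
  apply toMat_injective
  rw [toMat_mul, toMat_mul, toMat_expU, toMat_expU]
  have e : (X : Matrix (Idx n) (Idx n) ℂ) =
      toMat m⁻¹ * (Y : Matrix (Idx n) (Idx n) ℂ) * toMat m := by
    rw [mul_assoc, ← h, ← mul_assoc, toMat_inv_mul, one_mul]
  have e2 : NormedSpace.exp (toMat m⁻¹ * (Y : Matrix (Idx n) (Idx n) ℂ) * toMat m) =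
      toMat m⁻¹ * NormedSpace.exp (Y : Matrix (Idx n) (Idx n) ℂ) * toMat m :=
    Matrix.exp_units_conj' (m : GL (Idx n) ℂ) (Y : Matrix (Idx n) (Idx n) ℂ)
  rw [e, e2, ← mul_assoc, ← mul_assoc, toMat_mul_inv, one_mul]

theorem mul_expU_smul_eq {m : U n} {X Y : lie n}
    (h : toMat m * (X : Matrix (Idx n) (Idx n) ℂ) = (Y : Matrix (Idx n) (Idx n) ℂ) * toMat m)
    (t : ℝ) : m * expU (t • X) = expU (t • Y) * m :=
  mul_expU_eq (by simp [h])

theorem expU_zero : expU (0 : lie n) = 1 :=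
  toMat_injective (by rw [toMat_expU]; simp [toMat_one])

theorem expU_add_smul (s t : ℝ) (X : lie n) :
    expU ((s + t) • X) = expU (s • X) * expU (t • X) := by
  apply toMat_injective
  rw [toMat_mul, toMat_expU, toMat_expU, toMat_expU, ← Matrix.exp_add_of_commute]
  · simp [add_smul]
  · exact ((Commute.refl _).smul_left s).smul_right t

theorem expU_neg_smul (t : ℝ) (X : lie n) : expU ((-t) • X) = (expU (t • X))⁻¹ := by
  have h := expU_add_smul (-t) t X
  rw [neg_add_cancel, zero_smul, expU_zero] at h
  exact eq_inv_of_mul_eq_one_left h.symm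

open scoped Nat in
theorem hasSum_act_expU (x : Vec n) (X : lie n) :
    HasSum (fun k : ℕ => ((k ! : ℂ)⁻¹) • (x ᵥ* (X : Matrix (Idx n) (Idx n) ℂ) ^ k))
      (act x (expU X)) := by
  let _ : NormedRing (Matrix (Idx n) (Idx n) ℂ) := Matrix.linftyOpNormedRing
  let _ : NormedAlgebra ℂ (Matrix (Idx n) (Idx n) ℂ) := Matrix.linftyOpNormedAlgebra
  have h := NormedSpace.exp_series_hasSum_exp' (𝕂 := ℂ) (X : Matrix (Idx n) (Idx n) ℂ)
  have hc : Continuous fun A : Matrix (Idx n) (Idx n) ℂ => x ᵥ* A := by fun_prop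
  have h2 := h.map (⟨⟨fun A => x ᵥ* A, Matrix.vecMul_zero x⟩,
    fun A B => Matrix.vecMul_add A B x⟩ : Matrix (Idx n) (Idx n) ℂ →+ Vec n) hc
  refine (h2.congr_fun fun k => ?_)
  simp [Matrix.vecMul_smul]

open scoped Nat in
theorem act_expU_of_eigen {x : Vec n} {X : lie n} {c : ℂ}
    (h : x ᵥ* (X : Matrix (Idx n) (Idx n) ℂ) = c • x) :
    act x (expU X) = Complex.exp c • x := by
  have hk : ∀ k : ℕ, x ᵥ* (X : Matrix (Idx n) (Idx n) ℂ) ^ k = c ^ k • x := by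
    intro k
    induction k with
    | zero => simp
    | succ k ih => rw [pow_succ, ← Matrix.vecMul_vecMul, ih, Matrix.smul_vecMul, h, smul_smul,
        pow_succ]
  have h1 := hasSum_act_expU x X
  have h2 := (NormedSpace.exp_series_hasSum_exp' (𝕂 := ℂ) c).smul_const x
  rw [← Complex.exp_eq_exp_ℂ] at h2
  refine h1.unique (h2.congr_fun fun k => ?_)
  rw [hk, smul_smul, smul_eq_mul]

theorem act_expU_smul_of_eigen {x : Vec n} {X : lie n} {c : ℂ}
    (h : x ᵥ* (X : Matrix (Idx n) (Idx n) ℂ) = c • x) (t : ℝ) :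
    act x (expU (t • X)) = Complex.exp (t * c) • x := by
  refine act_expU_of_eigen ?_
  rw [Submodule.coe_smul, Matrix.vecMul_smul, h, ← Complex.coe_smul, smul_smul]

theorem act_expU_of_eq_zero {x : Vec n} {X : lie n}
    (h : x ᵥ* (X : Matrix (Idx n) (Idx n) ℂ) = 0) : act x (expU X) = x := by
  have := act_expU_of_eigen (c := 0) (by rw [h, zero_smul])
  rwa [Complex.exp_zero, one_smul] at this

theorem act_expU_of_cube {x y z : Vec n} {X : lie n}
    (h1 : x ᵥ* (X : Matrix (Idx n) (Idx n) ℂ) = y) (h2 : y ᵥ* (X : Matrix (Idx n) (Idx n) ℂ) = z)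
    (h3 : z ᵥ* (X : Matrix (Idx n) (Idx n) ℂ) = 0) :
    act x (expU X) = x + y + (1 / 2 : ℂ) • z := by
  have hk : ∀ k : ℕ, x ᵥ* (X : Matrix (Idx n) (Idx n) ℂ) ^ (k + 3) = 0 := by
    intro k
    rw [add_comm, pow_add, pow_succ, pow_two, ← Matrix.vecMul_vecMul, ← Matrix.vecMul_vecMul,
      ← Matrix.vecMul_vecMul, h1, h2, h3, Matrix.zero_vecMul]
  have hs := hasSum_sum_of_ne_finset_zero (L := SummationFilter.unconditional ℕ)
    (s := Finset.range 3)
    (f := fun k : ℕ => ((k.factorial : ℂ)⁻¹) • (x ᵥ* (X : Matrix (Idx n) (Idx n) ℂ) ^ k))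
    (by
      intro b hb
      obtain ⟨k, rfl⟩ : ∃ k, b = k + 3 := ⟨b - 3, by simp at hb; omega⟩
      rw [hk, smul_zero])
  rw [(hasSum_act_expU x X).unique hs]
  simp only [Finset.sum_range_succ, Finset.sum_range_zero, pow_zero, pow_one, pow_two,
    ← Matrix.vecMul_vecMul, h1, h2, Matrix.vecMul_one]
  simp

/-! Block diagonal elements. -/

theorem mem_KInf_iff (k : U n) : k ∈ KInf n ↔ Commute (toMat k) (gram n) := by
  have e1 : ∀ i j, (toMat k * gram n) i j = toMat k i j * Sum.elim (fun _ => 1) (fun _ => -1) j :=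
    fun i j => Matrix.mul_diagonal _ _ _ _
  have e2 : ∀ i j, (gram n * toMat k) i j = Sum.elim (fun _ => 1) (fun _ => -1) i * toMat k i j :=
    fun i j => Matrix.diagonal_mul _ _ _ _
  constructor
  · rintro ⟨h1, h2⟩
    refine Matrix.ext fun i j => ?_
    rw [e1, e2]
    have h1' : ∀ i j, toMat k (Sum.inl i) (Sum.inr j) = 0 := fun i j => congrFun (congrFun h1 i) j
    have h2' : ∀ i j, toMat k (Sum.inr i) (Sum.inl j) = 0 := fun i j => congrFun (congrFun h2 i) j
    rcases i with i | i <;> rcases j with j | j <;> simp [h1', h2']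
  · intro h
    have h' : ∀ i j, _ := fun i j => ((e1 i j).symm.trans (congrFun (congrFun h.eq i) j)).trans
      (e2 i j)
    constructor
    · ext i j
      have := h' (Sum.inl i) (Sum.inr j)
      simp only [Sum.elim_inl, Sum.elim_inr] at this
      change toMat k (Sum.inl i) (Sum.inr j) = 0
      linear_combination (-1 / 2) * this
    · ext i j
      have := h' (Sum.inr i) (Sum.inl j)
      simp only [Sum.elim_inl, Sum.elim_inr] at this
      change toMat k (Sum.inr i) (Sum.inl j) = 0
      linear_combination (1 / 2) * this

theorem expU_mem_KInf {X : lie n} (h : Commute (X : Matrix (Idx n) (Idx n) ℂ) (gram n)) (t : ℝ) :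
    expU (t • X) ∈ KInf n := by
  let _ : NormedRing (Matrix (Idx n) (Idx n) ℂ) := Matrix.linftyOpNormedRing
  let _ : NormedAlgebra ℂ (Matrix (Idx n) (Idx n) ℂ) := Matrix.linftyOpNormedAlgebra
  rw [mem_KInf_iff, toMat_expU]
  exact Commute.exp_left (h.smul_left t)

theorem commute_gram_of_blocks {X : Matrix (Idx n) (Idx n) ℂ}
    (h1 : ∀ i j, X (Sum.inl i) (Sum.inr j) = 0) (h2 : ∀ i j, X (Sum.inr i) (Sum.inl j) = 0) :
    Commute X (gram n) := by
  refine Matrix.ext fun i j => ?_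
  rw [gram, Matrix.mul_diagonal, Matrix.diagonal_mul]
  rcases i with i | i <;> rcases j with j | j <;> simp [h1, h2]

theorem KInf_mul_mem {k k' : U n} (h : k ∈ KInf n) (h' : k' ∈ KInf n) : k * k' ∈ KInf n := by
  rw [mem_KInf_iff] at *
  rw [toMat_mul]
  exact h.mul_left h'

theorem KInf_inv_mem {k : U n} (h : k ∈ KInf n) : k⁻¹ ∈ KInf n := by
  rw [mem_KInf_iff] at *
  have := congrArg (fun Z => toMat k⁻¹ * Z * toMat k⁻¹) h.eq
  simp only [mul_assoc, toMat_mul_inv, mul_one] at this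
  rw [← mul_assoc, toMat_inv_mul, one_mul] at this
  exact this.symm

/-! Differentiation along one-parameter subgroups. -/

theorem hasDerivAt_entries_expU (g : U n) (X : lie n) :
    HasDerivAt (fun t : ℝ => entries (g * expU (t • X)))
      (toMat g * (X : Matrix (Idx n) (Idx n) ℂ) : Idx n → Idx n → ℂ) 0 := by
  let _ : NormedRing (Matrix (Idx n) (Idx n) ℂ) := Matrix.linftyOpNormedRing
  let _ : NormedAlgebra ℝ (Matrix (Idx n) (Idx n) ℂ) := Matrix.linftyOpNormedAlgebra
  have h := hasDerivAt_exp_smul_const (𝕂 := ℝ) (X : Matrix (Idx n) (Idx n) ℂ) 0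
  rw [zero_smul, NormedSpace.exp_zero, one_mul] at h
  have h2 : ∀ i j, HasDerivAt
      (fun t : ℝ => NormedSpace.exp (t • (X : Matrix (Idx n) (Idx n) ℂ)) i j)
      ((X : Matrix (Idx n) (Idx n) ℂ) i j) 0 := fun i j =>
    ((LinearMap.toContinuousLinearMap
      (Matrix.entryLinearMap ℝ ℂ i j)).hasFDerivAt).comp_hasDerivAt (0 : ℝ) h
  refine hasDerivAt_pi.2 fun i => hasDerivAt_pi.2 fun j => ?_
  have h3 : HasDerivAt (fun t : ℝ => ∑ k, toMat g i k * toMat (expU (t • X)) k j)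
      (∑ k, toMat g i k * (X : Matrix (Idx n) (Idx n) ℂ) k j) 0 :=
    HasDerivAt.fun_sum fun k _ => (h2 k j).const_mul (toMat g i k)
  exact h3

theorem hasDerivAt_act_expU (x : Vec n) (X : lie n) (j : Idx n) :
    HasDerivAt (fun t : ℝ => act x (expU (t • X)) j) ((x ᵥ* (X : Matrix (Idx n) (Idx n) ℂ)) j) 0 := by
  have h := hasDerivAt_entries_expU (1 : U n) X
  simp only [one_mul, toMat_one] at h
  have h2 : ∀ i, HasDerivAt (fun t : ℝ => toMat (expU (t • X)) i j)
      ((X : Matrix (Idx n) (Idx n) ℂ) i j) 0 := fun i =>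
    hasDerivAt_pi.1 (hasDerivAt_pi.1 h i) j
  have h3 : HasDerivAt (fun t : ℝ => ∑ i, x i * toMat (expU (t • X)) i j)
      (∑ i, x i * (X : Matrix (Idx n) (Idx n) ℂ) i j) 0 :=
    HasDerivAt.fun_sum fun k _ => (h2 k).const_mul (x k)
  exact h3

variable {ℓ : ℕ}

theorem IsSmooth.exists_linear {φ : U n → VEll ℓ} (h : IsSmooth φ) (g : U n) :
    ∃ L : lie n →ₗ[ℝ] VEll ℓ, ∀ X, HasDerivAt (fun t : ℝ => φ (g * expU (t • X))) (L X) 0 := by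
  obtain ⟨Ω, F, hO, hg, hF, hφ⟩ := h g
  have hd : DifferentiableAt ℝ F (entries g) :=
    (hF.contDiffAt (hO.mem_nhds hg)).differentiableAt (by simp)
  refine ⟨{ toFun := fun X => fderiv ℝ F (entries g)
              (toMat g * (X : Matrix (Idx n) (Idx n) ℂ) : Matrix (Idx n) (Idx n) ℂ)
            map_add' := fun X Y => ?_
            map_smul' := fun r X => ?_ }, fun X => ?_⟩
  · rw [Submodule.coe_add, mul_add]
    exact map_add (fderiv ℝ F (entries g)) _ _
  · rw [Submodule.coe_smul, Matrix.mul_smul]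
    exact map_smul (fderiv ℝ F (entries g)) r _
  · have hc := hasDerivAt_entries_expU g X
    have h0 : entries (g * expU ((0 : ℝ) • X)) = entries g := by
      rw [zero_smul, expU_zero, mul_one]
    have hd' : HasFDerivAt F (fderiv ℝ F (entries g)) (entries (g * expU ((0 : ℝ) • X))) := by
      rw [h0]; exact hd.hasFDerivAt
    refine (hd'.comp_hasDerivAt (0 : ℝ) hc).congr_of_eventuallyEq ?_
    have hmem : Ω ∈ 𝓝 (entries (g * expU ((0 : ℝ) • X))) := by rw [h0]; exact hO.mem_nhds hg
    filter_upwards [hc.continuousAt.preimage_mem_nhds hmem] with t ht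
    exact hφ _ ht

theorem IsSmooth.hasDerivAt_zero {φ : U n → VEll ℓ} (h : IsSmooth φ) (g : U n) (X : lie n) :
    HasDerivAt (fun t : ℝ => φ (g * expU (t • X))) (lieDeriv X φ g) 0 := by
  obtain ⟨L, hL⟩ := h.exists_linear g
  exact (hL X).differentiableAt.hasDerivAt

theorem IsSmooth.hasDerivAt_path {φ : U n → VEll ℓ} (h : IsSmooth φ) (g : U n) (X : lie n)
    (t : ℝ) : HasDerivAt (fun s : ℝ => φ (g * expU (s • X)))
      (lieDeriv X φ (g * expU (t • X))) t := by
  have h1 := h.hasDerivAt_zero (g * expU (t • X)) X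
  have h2 : HasDerivAt (fun s : ℝ => s - t) 1 t := (hasDerivAt_id t).sub_const t
  have h3 := HasDerivAt.scomp (h := fun s : ℝ => s - t) t (by rw [sub_self]; exact h1) h2
  rw [one_smul] at h3
  refine h3.congr_of_eventuallyEq (Filter.Eventually.of_forall fun s => ?_)
  simp only [Function.comp]
  rw [mul_assoc, ← expU_add_smul, add_sub_cancel]

/-- `X ↦ X φ(g)` as a real linear map. -/
def IsSmooth.lieDerivₗ {φ : U n → VEll ℓ} (h : IsSmooth φ) (g : U n) : lie n →ₗ[ℝ] VEll ℓ :=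
  (h.exists_linear g).choose

theorem IsSmooth.lieDerivₗ_apply {φ : U n → VEll ℓ} (h : IsSmooth φ) (g : U n) (X : lie n) :
    h.lieDerivₗ g X = lieDeriv X φ g :=
  ((h.exists_linear g).choose_spec X).unique (h.hasDerivAt_zero g X)

theorem lieDeriv_add_lie {φ : U n → VEll ℓ} (h : IsSmooth φ) (g : U n) (X Y : lie n) :
    lieDeriv (X + Y) φ g = lieDeriv X φ g + lieDeriv Y φ g := by
  simp only [← h.lieDerivₗ_apply, map_add]

theorem lieDeriv_smul_lie {φ : U n → VEll ℓ} (h : IsSmooth φ) (g : U n) (r : ℝ) (X : lie n) :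
    lieDeriv (r • X) φ g = r • lieDeriv X φ g := by
  simp only [← h.lieDerivₗ_apply, map_smul]

theorem lieDeriv_sub_lie {φ : U n → VEll ℓ} (h : IsSmooth φ) (g : U n) (X Y : lie n) :
    lieDeriv (X - Y) φ g = lieDeriv X φ g - lieDeriv Y φ g := by
  simp only [← h.lieDerivₗ_apply, map_sub]

theorem lieDeriv_neg_lie {φ : U n → VEll ℓ} (h : IsSmooth φ) (g : U n) (X : lie n) :
    lieDeriv (-X) φ g = -lieDeriv X φ g := by
  simp only [← h.lieDerivₗ_apply, map_neg]

end Basics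

end

end QWhittaker

namespace QWhittaker

noncomputable section

/-! ### Derivatives at points of the Levi subgroup -/

set_option linter.unusedSectionVars false

section Levi

variable {n ℓ : ℕ}

theorem hasDerivAt_toMat_expU (X : lie n) (i j : Idx n) :
    HasDerivAt (fun t : ℝ => toMat (expU (t • X)) i j) ((X : Matrix (Idx n) (Idx n) ℂ) i j) 0 := by
  have h := hasDerivAt_entries_expU (1 : U n) X
  simp only [one_mul, toMat_one] at h
  exact hasDerivAt_pi.1 (hasDerivAt_pi.1 h i) j

theorem toMat_expU_zero_smul (X : lie n) : toMat (expU ((0 : ℝ) • X)) = 1 := by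
  rw [zero_smul, expU_zero, toMat_one]

theorem lieDeriv_of_commute {W : U n → VEll ℓ} (hs : IsSmooth W)
    (hK : ∀ k ∈ KInf n, ∀ g : U n, IsActK k (W g) (W (g * k))) {X : lie n}
    (hX : Commute (X : Matrix (Idx n) (Idx n) ℂ) (gram n)) (g : U n) (a : Fin (2 * ℓ + 1))
    {y00 y01 y10 y11 : ℂ}
    (h00 : (X : Matrix (Idx n) (Idx n) ℂ) (Sum.inl 0) (Sum.inl 0) = y00)
    (h01 : (X : Matrix (Idx n) (Idx n) ℂ) (Sum.inl 0) (Sum.inl 1) = y01)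
    (h10 : (X : Matrix (Idx n) (Idx n) ℂ) (Sum.inl 1) (Sum.inl 0) = y10)
    (h11 : (X : Matrix (Idx n) (Idx n) ℂ) (Sum.inl 1) (Sum.inl 1) = y11) :
    lieDeriv X W g a = ((ℓ : ℂ) - (a : ℕ)) * (y00 - y11) * W g a + y01 * raise (W g) a +
      y10 * sink (W g) a := by
  have key := eq_of_formEval_infinitesimal (c := W g) (d := lieDeriv X W g)
    (-(ℓ * (y00 + y11))) y00 y01 y10 y11 (fun u => ?_) a
  · rw [key]; push_cast; ring
  have hd := (LinearMap.toContinuousLinearMap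
    ((formEvalₗ u).restrictScalars ℝ)).hasFDerivAt.comp_hasDerivAt (0 : ℝ) (hs.hasDerivAt_zero g X)
  have d : ∀ i j : Fin 2, HasDerivAt (fun t : ℝ => (toMat (expU (t • X))).toBlocks₁₁ i j)
      ((X : Matrix (Idx n) (Idx n) ℂ) (Sum.inl i) (Sum.inl j)) 0 := fun i j =>
    hasDerivAt_toMat_expU X _ _
  have z : (toMat (expU ((0 : ℝ) • X))).toBlocks₁₁ = 1 := by
    rw [toMat_expU_zero_smul]
    ext i j
    simp [Matrix.toBlocks₁₁, Matrix.one_apply]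
  have hdet : HasDerivAt (fun t : ℝ => (toMat (expU (t • X))).toBlocks₁₁.det) (y00 + y11) 0 := by
    simp only [Matrix.det_fin_two]
    refine (((d 0 0).mul (d 1 1)).sub ((d 0 1).mul (d 1 0))).congr_deriv ?_
    rw [z, h00, h11]
    simp
  have hdet2 : HasDerivAt (fun t : ℝ => ((toMat (expU (t • X))).toBlocks₁₁.det ^ ℓ)⁻¹)
      (-(ℓ * (y00 + y11))) 0 := by
    refine ((hdet.fun_pow ℓ).fun_inv ?_).congr_deriv ?_
    · rw [z]; simp
    · rw [z]; simp
  have hlin : ∀ i : Fin 2, HasDerivAt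
      (fun t : ℝ => ((toMat (expU (t • X))).toBlocks₁₁ *ᵥ u) i)
      ((X : Matrix (Idx n) (Idx n) ℂ) (Sum.inl i) (Sum.inl 0) * u 0 +
        (X : Matrix (Idx n) (Idx n) ℂ) (Sum.inl i) (Sum.inl 1) * u 1) 0 := fun i => by
    have e : (fun t : ℝ => ((toMat (expU (t • X))).toBlocks₁₁ *ᵥ u) i) = fun t : ℝ =>
        (toMat (expU (t • X))).toBlocks₁₁ i 0 * u 0 +
          (toMat (expU (t • X))).toBlocks₁₁ i 1 * u 1 := by
      funext t; simp [Matrix.mulVec, dotProduct, Fin.sum_univ_two]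
    rw [e]
    exact ((d i 0).mul_const _).add ((d i 1).mul_const _)
  have hform := hasDerivAt_formEval (W g)
    (u := fun t : ℝ => (toMat (expU (t • X))).toBlocks₁₁ *ᵥ u)
    (u' := ![y00 * u 0 + y01 * u 1, y10 * u 0 + y11 * u 1]) (t := 0)
    ((hlin 0).congr_deriv (by simp [h00, h01])) ((hlin 1).congr_deriv (by simp [h10, h11]))
  have hd2 := hdet2.mul hform
  have e : (fun t : ℝ => formEval (W (g * expU (t • X))) u) = fun t : ℝ =>
      ((toMat (expU (t • X))).toBlocks₁₁.det ^ ℓ)⁻¹ *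
        formEval (W g) ((toMat (expU (t • X))).toBlocks₁₁ *ᵥ u) := by
    funext t
    exact (isActK_iff _ _ _).1 (hK _ (expU_mem_KInf hX t) g) u
  have hd3 : HasDerivAt (fun t : ℝ => formEval (W (g * expU (t • X))) u)
    (formEval (lieDeriv X W g) u) 0 := hd
  rw [e] at hd3
  rw [hd3.unique hd2, z]
  simp

variable [NeZero n]

theorem sqrt_two_smul_b1 : ((Real.sqrt 2 : ℝ) : ℂ) • b1 n = uVec n 0 + vVec n (lastIdx n) := by
  have : (Real.sqrt 2) ≠ 0 := by positivity
  rw [b1, smul_smul, ← Complex.ofReal_mul, mul_one_div_cancel this, Complex.ofReal_one, one_smul]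

theorem herm_uVec (x : Vec n) (j : Fin 2) : herm x (uVec n j) = x (Sum.inl j) := by
  simp [herm, uVec, Pi.single_apply]

theorem herm_vVec (x : Vec n) (k : Fin n) : herm x (vVec n k) = -x (Sum.inr k) := by
  simp [herm, vVec, Pi.single_apply]

theorem herm_b1 (x : Vec n) :
    herm x (b1 n) = ((1 / Real.sqrt 2 : ℝ) : ℂ) * (x (Sum.inl 0) - x (Sum.inr (lastIdx n))) := by
  rw [b1, herm_smul_right, herm_add_right, herm_uVec, herm_vVec, Complex.conj_ofReal, sub_eq_add_neg]

theorem herm_b2 (x : Vec n) :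
    herm x (b2 n) = ((1 / Real.sqrt 2 : ℝ) : ℂ) * (x (Sum.inl 0) + x (Sum.inr (lastIdx n))) := by
  rw [b2, herm_smul_right, herm_sub_right, herm_uVec, herm_vVec, Complex.conj_ofReal, sub_neg_eq_add]

theorem inv_sqrt_two_ne_zero : ((1 / Real.sqrt 2 : ℝ) : ℂ) ≠ 0 := by
  have : (Real.sqrt 2) ≠ 0 := by positivity
  exact_mod_cast one_div_ne_zero this

theorem mem_V0_iff (x : Vec n) :
    x ∈ V0 n ↔ x (Sum.inl 0) = 0 ∧ x (Sum.inr (lastIdx n)) = 0 := by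
  change herm x (b1 n) = 0 ∧ herm x (b2 n) = 0 ↔ _
  rw [herm_b1, herm_b2]
  simp only [mul_eq_zero, inv_sqrt_two_ne_zero, false_or]
  constructor
  · rintro ⟨h1, h2⟩
    exact ⟨by linear_combination (h1 + h2) / 2, by linear_combination (h2 - h1) / 2⟩
  · rintro ⟨h1, h2⟩
    rw [h1, h2]; simp

theorem uVec_one_mem_V0 : uVec n 1 ∈ V0 n := by
  rw [mem_V0_iff]; simp [uVec]

theorem vVec_mem_V0 {k : Fin n} (hk : k ≠ lastIdx n) : vVec n k ∈ V0 n := by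
  rw [mem_V0_iff]; simp [vVec, hk]

theorem IsLevi.act_b1_inv {m : U n} {z : ℂˣ} (h : IsLevi m z) : act (b1 n) m⁻¹ = (z : ℂ) • b1 n := by
  have := congrArg (fun x => act x m⁻¹) h.1
  simp only [act_act_inv, act_smul] at this
  conv_rhs => rw [this]
  rw [smul_smul, mul_inv_cancel₀ z.ne_zero, one_smul]

theorem IsLevi.act_b2_inv {m : U n} {z : ℂˣ} (h : IsLevi m z) :
    act (b2 n) m⁻¹ = (conj (z : ℂ))⁻¹ • b2 n := by
  have hz : conj (z : ℂ) ≠ 0 := by simp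
  have := congrArg (fun x => act x m⁻¹) h.2
  simp only [act_act_inv, act_smul] at this
  conv_rhs => rw [this]
  rw [smul_smul, inv_mul_cancel₀ hz, one_smul]

theorem IsLevi.act_mem_V0 {m : U n} {z : ℂˣ} (h : IsLevi m z) {x : Vec n} (hx : x ∈ V0 n) :
    act x m ∈ V0 n := by
  constructor
  · rw [herm_act_left, h.act_b1_inv, herm_smul_right, hx.1, mul_zero]
  · rw [herm_act_left, h.act_b2_inv, herm_smul_right, hx.2, mul_zero]

theorem IsLevi.act_inv_mem_V0 {m : U n} {z : ℂˣ} (h : IsLevi m z) {x : Vec n} (hx : x ∈ V0 n) :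
    act x m⁻¹ ∈ V0 n := by
  constructor
  · rw [← herm_act_right, h.1, herm_smul_right, hx.1, mul_zero]
  · rw [← herm_act_right, h.2, herm_smul_right, hx.2, mul_zero]

theorem skewTens_zero_left (y : Vec n) : skewTens 0 y = 0 := by
  have := skewTens_real_smul_left 0 (0 : Vec n) y
  simpa using this

theorem heis_eq_left (w : Vec n) : heis w 0 = expU (skewTens w (b1 n)) := by
  rw [heis, zero_smul, expU_zero, mul_one]

theorem heis_eq_right (t : ℝ) : heis (0 : Vec n) t = expU (t • diagTens (b1 n)) := by
  rw [heis, skewTens_zero_left, expU_zero, one_mul]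

theorem skewTens_smul_swap (c : ℂ) (x y : Vec n) : skewTens x (c • y) = skewTens (conj c • x) y :=
  Subtype.ext (by
    simp only [skewTens, tens_smul_left, tens_smul_right, Complex.conj_conj])

theorem diagTens_smul (c : ℂ) (x : Vec n) : diagTens (c • x) = (‖c‖ ^ 2 : ℝ) • diagTens x :=
  Subtype.ext (by
    simp only [diagTens, tens_smul_left, tens_smul_right, Submodule.coe_smul, smul_smul]
    rw [← Complex.coe_smul, smul_smul, Complex.ofReal_pow, ← Complex.mul_conj']
    congr 1; ring)

theorem diagTens_add (x y : Vec n) :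
    diagTens (x + y) = diagTens x + diagTens y + symTens x y :=
  Subtype.ext (by
    simp only [diagTens, symTens, tens_add_left, tens_add_right, Submodule.coe_add]
    module)

/-- `(4π / √2) ⟨y, z T · h⟩`, so that `β_T` is the value at `y = u₂`. -/
def pairing (T : Vec n) (m : U n) (z : ℂˣ) (y : Vec n) : ℂ :=
  ((4 * Real.pi / Real.sqrt 2 : ℝ) : ℂ) * herm y ((z : ℂ) • act T m)

omit [NeZero n] in
theorem beta_eq_pairing (T : Vec n) (m : U n) (z : ℂˣ) : beta T m z = pairing T m z (uVec n 1) := rfl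

variable {T : Vec n} {W : U n → VEll ℓ} (hs : IsSmooth W)
  (hN : ∀ w ∈ V0 n, ∀ (t : ℝ) (g : U n),
    W (heis w t * g) = Complex.exp (-2 * Real.pi * Complex.I * ((herm T w).im : ℂ)) • W g)
  (hK : ∀ k ∈ KInf n, ∀ g : U n, IsActK k (W g) (W (g * k)))

include hs hN

theorem lieDeriv_diagTens_b1 {m : U n} {z : ℂˣ} (hm : IsLevi m z) :
    lieDeriv (diagTens (b1 n)) W m = 0 := by
  have h := toMat_mul_diagTens m (b1 n)
  rw [hm.act_b1_inv, diagTens_smul] at h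
  have e : (fun t : ℝ => W (m * expU (t • diagTens (b1 n)))) = fun _ => W m := by
    funext t
    rw [mul_expU_smul_eq h t, smul_smul, ← heis_eq_right, hN 0 (Submodule.zero_mem _),
      herm_zero_right]
    simp
  rw [lieDeriv, e, deriv_const]

theorem lieDeriv_skewTens_b1 {m : U n} {z : ℂˣ} (hm : IsLevi m z) {w : Vec n} (hw : w ∈ V0 n) :
    ((Real.sqrt 2 : ℝ) : ℂ) • lieDeriv (skewTens w (b1 n)) W m =
      (Complex.I * ((pairing T m z w).im : ℂ)) • W m := by
  have h := toMat_mul_skewTens m w (b1 n)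
  rw [hm.act_b1_inv, skewTens_smul_swap] at h
  have hw' : conj (z : ℂ) • act w m⁻¹ ∈ V0 n := Submodule.smul_mem _ _ (hm.act_inv_mem_V0 hw)
  set w' := conj (z : ℂ) • act w m⁻¹ with hw'_def
  have hT : herm T w' = conj (herm w ((z : ℂ) • act T m)) := by
    rw [hw'_def, herm_smul_right, Complex.conj_conj, herm_conj, herm_smul_left, herm_act_left]
  have e : (fun t : ℝ => W (m * expU (t • skewTens w (b1 n)))) = fun t : ℝ =>
      Complex.exp (t * (-2 * Real.pi * Complex.I * ((herm T w').im : ℂ))) • W m := by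
    funext t
    rw [mul_expU_smul_eq h t, ← skewTens_real_smul_left, ← heis_eq_left,
      hN _ (Submodule.smul_mem _ _ hw'), herm_smul_right]
    congr 2
    simp
    ring
  have hd : HasDerivAt (fun t : ℝ =>
      Complex.exp (t * (-2 * Real.pi * Complex.I * ((herm T w').im : ℂ))) • W m)
      ((-2 * Real.pi * Complex.I * ((herm T w').im : ℂ)) • W m) 0 := by
    have h1 : HasDerivAt (fun t : ℝ => (t : ℂ) * (-2 * Real.pi * Complex.I * ((herm T w').im : ℂ)))
        (-2 * Real.pi * Complex.I * ((herm T w').im : ℂ)) 0 := by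
      simpa using (Complex.ofRealCLM.hasDerivAt (x := (0 : ℝ))).mul_const
        (-2 * Real.pi * Complex.I * ((herm T w').im : ℂ))
    have h2 := h1.cexp.smul_const (W m)
    simpa using h2
  have h2 : ((Real.sqrt 2 : ℝ) : ℂ) ^ 2 = 2 := by
    rw [← Complex.ofReal_pow, Real.sq_sqrt (by norm_num)]; simp
  have h3 : ((Real.sqrt 2 : ℝ) : ℂ) ≠ 0 := by
    intro h0; rw [h0] at h2; norm_num at h2
  rw [lieDeriv, e, hd.deriv, smul_smul, hT, pairing]
  congr 1
  rw [Complex.im_ofReal_mul, Complex.conj_im]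
  push_cast
  field_simp
  rw [h2]
  ring

include hK

theorem lieDeriv_symTens_u0_last {m : U n} {z : ℂˣ} (hm : IsLevi m z) (a : Fin (2 * ℓ + 1)) :
    lieDeriv (symTens (uVec n 0) (vVec n (lastIdx n))) W m a =
      Complex.I * ((a : ℕ) - (ℓ : ℂ)) * W m a := by
  have h1 : symTens (uVec n 0) (vVec n (lastIdx n)) = (2 : ℝ) • diagTens (b1 n) -
      (diagTens (uVec n 0) + diagTens (vVec n (lastIdx n))) := by
    have h2 := diagTens_smul ((Real.sqrt 2 : ℝ) : ℂ) (b1 n)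
    rw [sqrt_two_smul_b1, diagTens_add, Complex.norm_real, Real.norm_of_nonneg (Real.sqrt_nonneg _),
      Real.sq_sqrt (by norm_num)] at h2
    rw [← h2]; abel
  have hc : ∀ i j : Idx n, ((diagTens (uVec n 0) + diagTens (vVec n (lastIdx n)) : lie n) :
      Matrix (Idx n) (Idx n) ℂ) i j = Complex.I * (herm (Pi.single i 1) (uVec n 0) * uVec n 0 j) +
      Complex.I * (herm (Pi.single i 1) (vVec n (lastIdx n)) * vVec n (lastIdx n) j) :=
    fun i j => rfl
  rw [h1, lieDeriv_sub_lie hs, lieDeriv_smul_lie hs, lieDeriv_diagTens_b1 hs hN hm, Pi.sub_apply,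
    lieDeriv_of_commute hs hK (X := diagTens (uVec n 0) + diagTens (vVec n (lastIdx n)))
      (commute_gram_of_blocks ?_ ?_) m a (y00 := Complex.I) (y01 := 0) (y10 := 0) (y11 := 0)]
  · simp; ring
  · rw [hc, herm_uVec, herm_vVec]; simp [uVec, vVec]
  · rw [hc, herm_uVec, herm_vVec]; simp [uVec, vVec]
  · rw [hc, herm_uVec, herm_vVec]; simp [uVec, vVec]
  · rw [hc, herm_uVec, herm_vVec]; simp [uVec, vVec]
  · intro i j; rw [hc, herm_uVec, herm_vVec]; simp [uVec, vVec]
  · intro i j; rw [hc, herm_uVec, herm_vVec]; simp [uVec, vVec]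

theorem lieDeriv_skewTens_u1_last {m : U n} {z : ℂˣ} (hm : IsLevi m z) (c : ℂ)
    (a : Fin (2 * ℓ + 1)) :
    lieDeriv (skewTens (c • uVec n 1) (vVec n (lastIdx n))) W m a =
      Complex.I * ((c * beta T m z).im : ℂ) * W m a - c * raise (W m) a +
        conj c * sink (W m) a := by
  have h1 : skewTens (c • uVec n 1) (vVec n (lastIdx n)) =
      Real.sqrt 2 • skewTens (c • uVec n 1) (b1 n) - skewTens (c • uVec n 1) (uVec n 0) := by
    rw [← skewTens_real_smul_right, sqrt_two_smul_b1, skewTens_add_right]; abel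
  have hc : ∀ i j : Idx n, ((skewTens (c • uVec n 1) (uVec n 0) : lie n) :
      Matrix (Idx n) (Idx n) ℂ) i j = herm (Pi.single i 1) (uVec n 0) * (c * uVec n 1 j) -
      herm (Pi.single i 1) (c • uVec n 1) * uVec n 0 j :=
    fun i j => rfl
  have h2 := lieDeriv_skewTens_b1 hs hN hm
    (Submodule.smul_mem (V0 n) c (uVec_one_mem_V0 (n := n)))
  have hp : pairing T m z (c • uVec n 1) = c * beta T m z := by
    rw [beta_eq_pairing, pairing, pairing, herm_smul_left]; ring
  rw [h1, lieDeriv_sub_lie hs, lieDeriv_smul_lie hs, ← Complex.coe_smul, h2, Pi.sub_apply,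
    lieDeriv_of_commute hs hK (X := skewTens (c • uVec n 1) (uVec n 0))
      (commute_gram_of_blocks ?_ ?_) m a (y00 := 0) (y01 := c) (y10 := -conj c) (y11 := 0), hp]
  · simp; ring
  · rw [hc, herm_smul_right, herm_uVec, herm_uVec]; simp [uVec]
  · rw [hc, herm_smul_right, herm_uVec, herm_uVec]; simp [uVec]
  · rw [hc, herm_smul_right, herm_uVec, herm_uVec]; simp [uVec]
  · rw [hc, herm_smul_right, herm_uVec, herm_uVec]; simp [uVec]
  · intro i j; rw [hc, herm_smul_right, herm_uVec, herm_uVec]; simp [uVec]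
  · intro i j; rw [hc, herm_smul_right, herm_uVec, herm_uVec]; simp [uVec]

theorem lieDeriv_skewTens_u0_vVec {m : U n} {z : ℂˣ} (hm : IsLevi m z) {k : Fin n}
    (hk : k ≠ lastIdx n) (c : ℂ) :
    lieDeriv (skewTens (uVec n 0) (c • vVec n k)) W m =
      (-(Complex.I * ((c * pairing T m z (vVec n k)).im : ℂ))) • W m := by
  have h1 : skewTens (uVec n 0) (c • vVec n k) =
      -(Real.sqrt 2 • skewTens (c • vVec n k) (b1 n)) -
        skewTens (vVec n (lastIdx n)) (c • vVec n k) := by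
    rw [skewTens_swap (b1 n), smul_neg, neg_neg, ← skewTens_real_smul_left, sqrt_two_smul_b1,
      skewTens_add_left]; abel
  have hc : ∀ i j : Idx n, ((skewTens (vVec n (lastIdx n)) (c • vVec n k) : lie n) :
      Matrix (Idx n) (Idx n) ℂ) i j =
      herm (Pi.single i 1) (c • vVec n k) * vVec n (lastIdx n) j -
      herm (Pi.single i 1) (vVec n (lastIdx n)) * (c * vVec n k j) :=
    fun i j => rfl
  have h2 := lieDeriv_skewTens_b1 hs hN hm
    (Submodule.smul_mem (V0 n) c (vVec_mem_V0 hk))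
  have hp : pairing T m z (c • vVec n k) = c * pairing T m z (vVec n k) := by
    rw [pairing, pairing, herm_smul_left]; ring
  have h3 : lieDeriv (skewTens (vVec n (lastIdx n)) (c • vVec n k)) W m = 0 := by
    funext a
    rw [lieDeriv_of_commute hs hK (commute_gram_of_blocks ?_ ?_) m a (y00 := 0) (y01 := 0)
      (y10 := 0) (y11 := 0)]
    · simp
    · rw [hc, herm_smul_right, herm_vVec, herm_vVec]; simp [vVec]
    · rw [hc, herm_smul_right, herm_vVec, herm_vVec]; simp [vVec]
    · rw [hc, herm_smul_right, herm_vVec, herm_vVec]; simp [vVec]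
    · rw [hc, herm_smul_right, herm_vVec, herm_vVec]; simp [vVec]
    · intro i j; rw [hc, herm_smul_right, herm_vVec, herm_vVec]; simp [vVec]
    · intro i j; rw [hc, herm_smul_right, herm_vVec, herm_vVec]; simp [vVec]
  rw [h1, lieDeriv_sub_lie hs, lieDeriv_neg_lie hs, lieDeriv_smul_lie hs, ← Complex.coe_smul, h2,
    h3, hp, sub_zero, neg_smul]

/-- The element of `𝔤₀` generating the dilations of the Levi subgroup. -/
def dilation (n : ℕ) [NeZero n] : lie n := skewTens (uVec n 0) (vVec n (lastIdx n))

theorem pPlus_zero_last {m : U n} {z : ℂˣ} (hm : IsLevi m z) (a : Fin (2 * ℓ + 1)) :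
    pPlus 0 (lastIdx n) W m a =
      1 / 2 * (lieDeriv (dilation n) W m a + ((a : ℕ) - (ℓ : ℂ)) * W m a) := by
  simp only [pPlus, Pi.add_apply, Pi.smul_apply, smul_eq_mul,
    lieDeriv_symTens_u0_last hs hN hK hm, dilation]
  linear_combination (-1 / 2 * ((a : ℕ) - (ℓ : ℂ)) * W m a) * Complex.I_sq

theorem pMinus_zero_last {m : U n} {z : ℂˣ} (hm : IsLevi m z) (a : Fin (2 * ℓ + 1)) :
    pMinus 0 (lastIdx n) W m a =
      1 / 2 * (lieDeriv (dilation n) W m a - ((a : ℕ) - (ℓ : ℂ)) * W m a) := by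
  simp only [pMinus, Pi.add_apply, Pi.smul_apply, smul_eq_mul,
    lieDeriv_symTens_u0_last hs hN hK hm, dilation]
  linear_combination (1 / 2 * ((a : ℕ) - (ℓ : ℂ)) * W m a) * Complex.I_sq

theorem pPlus_one_last {m : U n} {z : ℂˣ} (hm : IsLevi m z) (a : Fin (2 * ℓ + 1)) :
    pPlus 1 (lastIdx n) W m a = beta T m z / 2 * W m a - raise (W m) a := by
  have h1 := lieDeriv_skewTens_u1_last hs hN hK hm 1 a
  have h2 := lieDeriv_skewTens_u1_last hs hN hK hm Complex.I a
  rw [one_smul, one_mul, one_mul, map_one, one_mul] at h1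
  rw [skewTens_I_smul_left, Complex.I_mul_im, Complex.conj_I] at h2
  simp only [pPlus, Pi.add_apply, Pi.smul_apply, smul_eq_mul, h1, h2]
  conv_rhs => rw [← Complex.re_add_im (beta T m z)]
  linear_combination (-1 / 2 * ((beta T m z).re * W m a - raise (W m) a - sink (W m) a)) *
    Complex.I_sq

theorem pMinus_one_last {m : U n} {z : ℂˣ} (hm : IsLevi m z) (a : Fin (2 * ℓ + 1)) :
    pMinus 1 (lastIdx n) W m a = -conj (beta T m z) / 2 * W m a + sink (W m) a := by
  have h1 := lieDeriv_skewTens_u1_last hs hN hK hm 1 a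
  have h2 := lieDeriv_skewTens_u1_last hs hN hK hm Complex.I a
  rw [one_smul, one_mul, one_mul, map_one, one_mul] at h1
  rw [skewTens_I_smul_left, Complex.I_mul_im, Complex.conj_I] at h2
  simp only [pMinus, Pi.add_apply, Pi.smul_apply, smul_eq_mul, h1, h2]
  have hb : conj (beta T m z) = (beta T m z).re - (beta T m z).im * Complex.I := by
    rw [Complex.ext_iff]; simp
  rw [hb]
  linear_combination (1 / 2 * ((beta T m z).re * W m a - raise (W m) a - sink (W m) a)) *
    Complex.I_sq

theorem pPlus_zero_of_ne {m : U n} {z : ℂˣ} (hm : IsLevi m z) {k : Fin n} (hk : k ≠ lastIdx n) :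
    pPlus 0 k W m = (conj (pairing T m z (vVec n k)) / 2) • W m := by
  have h1 := lieDeriv_skewTens_u0_vVec hs hN hK hm hk 1
  have h2 := lieDeriv_skewTens_u0_vVec hs hN hK hm hk Complex.I
  rw [one_smul, one_mul] at h1
  rw [skewTens_I_smul_right, lieDeriv_neg_lie hs, Complex.I_mul_im, neg_smul, neg_inj] at h2
  rw [pPlus, h1, h2, smul_smul, smul_smul, ← add_smul]
  congr 1
  have hb : conj (pairing T m z (vVec n k)) = (pairing T m z (vVec n k)).re -
      (pairing T m z (vVec n k)).im * Complex.I := by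
    rw [Complex.ext_iff]; simp
  rw [hb]
  linear_combination (-1 / 2 * ((pairing T m z (vVec n k)).re : ℂ)) * Complex.I_sq

theorem pMinus_zero_of_ne {m : U n} {z : ℂˣ} (hm : IsLevi m z) {k : Fin n} (hk : k ≠ lastIdx n) :
    pMinus 0 k W m = (-pairing T m z (vVec n k) / 2) • W m := by
  have h1 := lieDeriv_skewTens_u0_vVec hs hN hK hm hk 1
  have h2 := lieDeriv_skewTens_u0_vVec hs hN hK hm hk Complex.I
  rw [one_smul, one_mul] at h1
  rw [skewTens_I_smul_right, lieDeriv_neg_lie hs, Complex.I_mul_im, neg_smul, neg_inj] at h2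
  rw [pMinus, h1, h2, smul_smul, smul_smul, ← add_smul]
  congr 1
  conv_rhs => rw [← Complex.re_add_im (pairing T m z (vVec n k))]
  linear_combination (1 / 2 * ((pairing T m z (vVec n k)).re : ℂ)) * Complex.I_sq

/-- The equation `D_ℓ⁺ W = 0` at a point of the Levi subgroup. -/
theorem schmidPlus_eq_zero_iff {m : U n} {z : ℂˣ} (hm : IsLevi m z) :
    schmidPlus W m = 0 ↔
      (∀ a : Fin (2 * ℓ), lieDeriv (dilation n) W m a.castSucc =
        ((a : ℕ) + ℓ + 2) * W m a.castSucc - beta T m z * W m a.succ) ∧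
      (∀ k ≠ lastIdx n, ∀ a : Fin (2 * ℓ), pPlus 1 k W m a.succ =
        -(1 / 2) * conj (pairing T m z (vVec n k)) * W m a.castSucc) := by
  have hn : (1 / (2 * ((n : ℂ) + 2))) ≠ 0 := by
    refine one_div_ne_zero (mul_ne_zero two_ne_zero ?_)
    exact_mod_cast (by omega : n + 2 ≠ 0)
  have e : ∀ k a, schmidPlus W m k a = (1 / (2 * ((n : ℂ) + 2))) *
      (pPlus 0 k W m a.castSucc + pPlus 1 k W m a.succ) := fun k a => by
    simp [schmidPlus, projPlus, schmidTildePlus, lower1, lower2, mul_add]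
  have h0 : schmidPlus W m = 0 ↔
      ∀ (k : Fin n) (a : Fin (2 * ℓ)), pPlus 0 k W m a.castSucc + pPlus 1 k W m a.succ = 0 := by
    constructor
    · intro h k a
      have := congrFun (congrFun h k) a
      rw [e] at this
      exact (mul_eq_zero.1 this).resolve_left hn
    · intro h
      funext k a
      rw [e, h, mul_zero]; rfl
  rw [h0]
  constructor
  · intro h
    refine ⟨fun a => ?_, fun k hk a => ?_⟩
    · have := h (lastIdx n) a
      rw [pPlus_zero_last hs hN hK hm, pPlus_one_last hs hN hK hm, raise_succ] at this
      simp only [Fin.val_castSucc] at this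
      linear_combination 2 * this
    · have := h k a
      rw [pPlus_zero_of_ne hs hN hK hm hk] at this
      simp only [Pi.smul_apply, smul_eq_mul] at this
      linear_combination this
  · rintro ⟨h1, h2⟩ k a
    by_cases hk : k = lastIdx n
    · rw [hk, pPlus_zero_last hs hN hK hm, pPlus_one_last hs hN hK hm, raise_succ]
      simp only [Fin.val_castSucc]
      linear_combination 1 / 2 * h1 a
    · rw [pPlus_zero_of_ne hs hN hK hm hk]
      simp only [Pi.smul_apply, smul_eq_mul]
      linear_combination h2 k hk a

/-- The equation `D_ℓ⁻ W = 0` at a point of the Levi subgroup. -/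
theorem schmidMinus_eq_zero_iff {m : U n} {z : ℂˣ} (hm : IsLevi m z) :
    schmidMinus W m = 0 ↔
      (∀ a : Fin (2 * ℓ), lieDeriv (dilation n) W m a.succ =
        (3 * ℓ + 1 - (a : ℕ)) * W m a.succ - conj (beta T m z) * W m a.castSucc) ∧
      (∀ k ≠ lastIdx n, ∀ a : Fin (2 * ℓ), pMinus 1 k W m a.castSucc =
        -(1 / 2) * pairing T m z (vVec n k) * W m a.succ) := by
  have hn : (1 / (2 * ((n : ℂ) + 2))) ≠ 0 := by
    refine one_div_ne_zero (mul_ne_zero two_ne_zero ?_)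
    exact_mod_cast (by omega : n + 2 ≠ 0)
  have e : ∀ k a, schmidMinus W m k a = (1 / (2 * ((n : ℂ) + 2))) *
      (-pMinus 0 k W m a.succ + pMinus 1 k W m a.castSucc) := fun k a => by
    simp [schmidMinus, projMinus, schmidTildeMinus, lower1, lower2, mul_add]
  have h0 : schmidMinus W m = 0 ↔
      ∀ (k : Fin n) (a : Fin (2 * ℓ)), -pMinus 0 k W m a.succ + pMinus 1 k W m a.castSucc = 0 := by
    constructor
    · intro h k a
      have := congrFun (congrFun h k) a
      rw [e] at this
      exact (mul_eq_zero.1 this).resolve_left hn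
    · intro h
      funext k a
      rw [e, h, mul_zero]; rfl
  rw [h0]
  constructor
  · intro h
    refine ⟨fun a => ?_, fun k hk a => ?_⟩
    · have := h (lastIdx n) a
      rw [pMinus_zero_last hs hN hK hm, pMinus_one_last hs hN hK hm, sink_castSucc] at this
      simp only [Fin.val_succ] at this
      push_cast at this
      linear_combination -2 * this
    · have := h k a
      rw [pMinus_zero_of_ne hs hN hK hm hk] at this
      simp only [Pi.smul_apply, smul_eq_mul] at this
      linear_combination this
  · rintro ⟨h1, h2⟩ k a
    by_cases hk : k = lastIdx n
    · rw [hk, pMinus_zero_last hs hN hK hm, pMinus_one_last hs hN hK hm, sink_castSucc]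
      simp only [Fin.val_succ]
      push_cast
      linear_combination -1 / 2 * h1 a
    · rw [pMinus_zero_of_ne hs hN hK hm hk]
      simp only [Pi.smul_apply, smul_eq_mul]
      linear_combination h2 k hk a

end Levi

end

end QWhittaker

namespace QWhittaker

noncomputable section

/-! ### Dilations, boosts and the decomposition of the group -/

set_option linter.unusedSectionVars false

section Geometry

variable {n : ℕ}

theorem herm_self_eq (x : Vec n) : herm x x =
    (((∑ i : Fin 2, ‖x (Sum.inl i)‖ ^ 2) - ∑ k : Fin n, ‖x (Sum.inr k)‖ ^ 2 : ℝ) : ℂ) := by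
  simp [herm, Complex.mul_conj']

theorem herm_self_im (x : Vec n) : (herm x x).im = 0 := by
  rw [herm_self_eq, Complex.ofReal_im]

theorem herm_self_re (x : Vec n) : (herm x x).re =
    (∑ i : Fin 2, ‖x (Sum.inl i)‖ ^ 2) - ∑ k : Fin n, ‖x (Sum.inr k)‖ ^ 2 := by
  rw [herm_self_eq, Complex.ofReal_re]

theorem herm_swap_eq_zero {x y : Vec n} (h : herm x y = 0) : herm y x = 0 := by
  rw [← herm_conj, h, map_zero]

theorem vec_eq_zero_of_herm {x : Vec n} (h0 : x (Sum.inl 0) = 0) (h1 : x (Sum.inl 1) = 0)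
    (h : 0 ≤ (herm x x).re) : x = 0 := by
  rw [herm_self_re, Fin.sum_univ_two, h0, h1] at h
  have hs : ∑ k : Fin n, ‖x (Sum.inr k)‖ ^ 2 = 0 :=
    le_antisymm (by simpa using h) (Finset.sum_nonneg fun _ _ => by positivity)
  have := (Finset.sum_eq_zero_iff_of_nonneg fun _ _ => by positivity).1 hs
  funext i
  rcases i with i | i
  · fin_cases i
    · exact h0
    · exact h1
  · simpa using this i (Finset.mem_univ i)

variable [NeZero n]

theorem herm_b1_b1 : herm (b1 n) (b1 n) = 0 := by
  rw [herm_b1]; simp [b1, uVec, vVec]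

theorem herm_b2_b2 : herm (b2 n) (b2 n) = 0 := by
  rw [herm_b2]; simp [b2, uVec, vVec]

theorem inv_sqrt_two_sq : ((1 / Real.sqrt 2 : ℝ) : ℂ) ^ 2 = 1 / 2 := by
  rw [← Complex.ofReal_pow, div_pow, Real.sq_sqrt (by norm_num)]; simp

theorem herm_b2_b1 : herm (b2 n) (b1 n) = 1 := by
  have := inv_sqrt_two_sq
  rw [herm_b1]
  simp only [b2, uVec, vVec, Pi.smul_apply, Pi.sub_apply, smul_eq_mul]
  simp only [ne_eq, reduceCtorEq, not_false_eq_true, Pi.single_eq_same, Pi.single_eq_of_ne]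
  linear_combination 2 * this

theorem herm_b1_b2 : herm (b1 n) (b2 n) = 1 := by
  rw [← herm_conj, herm_b2_b1, map_one]

theorem uVec_zero_eq : uVec n 0 = ((1 / Real.sqrt 2 : ℝ) : ℂ) • (b1 n + b2 n) := by
  have h : b1 n + b2 n = (((1 / Real.sqrt 2 : ℝ) : ℂ) * 2) • uVec n 0 := by
    rw [b1, b2]; module
  have := inv_sqrt_two_sq
  rw [h, smul_smul, show ((1 / Real.sqrt 2 : ℝ) : ℂ) * (((1 / Real.sqrt 2 : ℝ) : ℂ) * 2) = 1 by
    linear_combination 2 * this, one_smul]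

theorem herm_uVec_self (j : Fin 2) : herm (uVec n j) (uVec n j) = 1 := by
  rw [herm_uVec]; simp [uVec]

theorem b1_dilation : b1 n ᵥ* (dilation n : Matrix (Idx n) (Idx n) ℂ) = (-1 : ℂ) • b1 n := by
  rw [dilation, vecMul_skewTens, herm_uVec, herm_vVec]
  simp only [b1, uVec, vVec, Pi.smul_apply, Pi.add_apply, smul_eq_mul]
  simp only [ne_eq, reduceCtorEq, not_false_eq_true, Pi.single_eq_same, Pi.single_eq_of_ne]
  module

theorem b2_dilation : b2 n ᵥ* (dilation n : Matrix (Idx n) (Idx n) ℂ) = (1 : ℂ) • b2 n := by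
  rw [dilation, vecMul_skewTens, herm_uVec, herm_vVec]
  simp only [b2, uVec, vVec, Pi.smul_apply, Pi.sub_apply, smul_eq_mul]
  simp only [ne_eq, reduceCtorEq, not_false_eq_true, Pi.single_eq_same, Pi.single_eq_of_ne]
  module

theorem V0_dilation {x : Vec n} (hx : x ∈ V0 n) :
    x ᵥ* (dilation n : Matrix (Idx n) (Idx n) ℂ) = 0 := by
  rw [mem_V0_iff] at hx
  rw [dilation, vecMul_skewTens, herm_uVec, herm_vVec, hx.1, hx.2]
  simp

theorem act_V0_dilation {x : Vec n} (hx : x ∈ V0 n) (t : ℝ) : act x (expU (t • dilation n)) = x :=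
  act_expU_of_eq_zero (by rw [Submodule.coe_smul, Matrix.vecMul_smul, V0_dilation hx, smul_zero])

theorem act_b1_dilation (t : ℝ) :
    act (b1 n) (expU (t • dilation n)) = ((Real.exp (-t) : ℝ) : ℂ) • b1 n := by
  rw [act_expU_smul_of_eigen b1_dilation]; simp

theorem act_b2_dilation (t : ℝ) :
    act (b2 n) (expU (t • dilation n)) = ((Real.exp t : ℝ) : ℂ) • b2 n := by
  rw [act_expU_smul_of_eigen b2_dilation]; simp

/-- `e^t` as a unit. -/
def expUnit (t : ℝ) : ℂˣ := Units.mk0 ((Real.exp t : ℝ) : ℂ) (by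
  exact_mod_cast (Real.exp_pos t).ne')

theorem coe_expUnit (t : ℝ) : (expUnit t : ℂ) = ((Real.exp t : ℝ) : ℂ) := rfl

theorem IsLevi.mul_dilation {m : U n} {z : ℂˣ} (h : IsLevi m z) (t : ℝ) :
    IsLevi (m * expU (t • dilation n)) (z * expUnit t) := by
  constructor
  · rw [act_mul, h.1, act_smul, act_b1_dilation, smul_smul, Units.val_mul, mul_inv, coe_expUnit,
      Real.exp_neg, Complex.ofReal_inv]
  · rw [act_mul, h.2, act_smul, act_b2_dilation, smul_smul, Units.val_mul, map_mul, coe_expUnit,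
      Complex.conj_ofReal]

theorem pairing_dilation {T : Vec n} (hT : T ∈ V0 n) {m : U n} {z : ℂˣ} (h : IsLevi m z)
    (t : ℝ) (y : Vec n) : pairing T (m * expU (t • dilation n)) (z * expUnit t) y =
      ((Real.exp t : ℝ) : ℂ) * pairing T m z y := by
  rw [pairing, pairing, act_mul, act_V0_dilation (h.act_mem_V0 hT), Units.val_mul, coe_expUnit,
    herm_smul_right, herm_smul_right, map_mul, Complex.conj_ofReal]
  ring

theorem beta_dilation {T : Vec n} (hT : T ∈ V0 n) {m : U n} {z : ℂˣ} (h : IsLevi m z)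
    (t : ℝ) : beta T (m * expU (t • dilation n)) (z * expUnit t) =
      ((Real.exp t : ℝ) : ℂ) * beta T m z :=
  pairing_dilation hT h t _

theorem isLevi_one : IsLevi (1 : U n) 1 := by
  constructor <;> simp [act_one]

theorem IsLevi.mul_skewTens {m : U n} {z : ℂˣ} (h : IsLevi m z) {x y : Vec n} (hx : x ∈ V0 n)
    (hy : y ∈ V0 n) : IsLevi (m * expU (skewTens x y)) z := by
  constructor
  · rw [act_mul, h.1, act_smul, act_expU_of_eq_zero]
    rw [vecMul_skewTens, herm_swap_eq_zero hx.1, herm_swap_eq_zero hy.1]; simp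
  · rw [act_mul, h.2, act_smul, act_expU_of_eq_zero]
    rw [vecMul_skewTens, herm_swap_eq_zero hx.2, herm_swap_eq_zero hy.2]; simp

theorem IsLevi.mul_smul_skewTens {m : U n} {z : ℂˣ} (h : IsLevi m z) {x y : Vec n} (hx : x ∈ V0 n)
    (hy : y ∈ V0 n) (t : ℝ) : IsLevi (m * expU (t • skewTens x y)) z := by
  rw [← skewTens_real_smul_left]
  exact h.mul_skewTens (Submodule.smul_mem _ _ hx) hy

theorem hasDerivAt_pairing (T : Vec n) (m : U n) (z : ℂˣ) (X : lie n) (y : Vec n) (t : ℝ) :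
    HasDerivAt (fun s : ℝ => pairing T (m * expU (s • X)) z y)
      (-pairing T (m * expU (t • X)) z (y ᵥ* (X : Matrix (Idx n) (Idx n) ℂ))) t := by
  have h0 : ∀ m : U n, HasDerivAt (fun s : ℝ => pairing T (m * expU (s • X)) z y)
      (-pairing T m z (y ᵥ* (X : Matrix (Idx n) (Idx n) ℂ))) 0 := by
    intro m
    have e : ∀ x : Vec n, HasDerivAt (fun s : ℝ => herm (act x (expU (s • X))) y)
        (herm (x ᵥ* (X : Matrix (Idx n) (Idx n) ℂ)) y) 0 := fun x =>
      (HasDerivAt.fun_sum fun i _ => (hasDerivAt_act_expU x X _).mul_const _).sub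
        (HasDerivAt.fun_sum fun i _ => (hasDerivAt_act_expU x X _).mul_const _)
    have e2 := (e ((z : ℂ) • act T m)).star.const_mul
      ((4 * Real.pi / Real.sqrt 2 : ℝ) : ℂ)
    have e3 : (fun s : ℝ => pairing T (m * expU (s • X)) z y) = fun s : ℝ =>
        ((4 * Real.pi / Real.sqrt 2 : ℝ) : ℂ) *
          star (herm (act ((z : ℂ) • act T m) (expU (s • X))) y) := by
      funext s
      rw [pairing, act_mul, act_smul]
      congr 1
      exact (herm_conj _ _).symm
    rw [e3]
    refine e2.congr_deriv ?_
    have e4 := X.2 ((z : ℂ) • act T m) y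
    have e5 : herm (((z : ℂ) • act T m) ᵥ* (X : Matrix (Idx n) (Idx n) ℂ)) y =
        -herm ((z : ℂ) • act T m) (y ᵥ* (X : Matrix (Idx n) (Idx n) ℂ)) := by
      linear_combination e4
    rw [e5, pairing, star_neg, mul_neg]
    congr 2
    exact herm_conj _ _
  have h2 : HasDerivAt (fun s : ℝ => s - t) 1 t := (hasDerivAt_id t).sub_const t
  have h3 := HasDerivAt.scomp (h := fun s : ℝ => s - t) t
    (by rw [sub_self]; exact h0 (m * expU (t • X))) h2
  rw [one_smul] at h3
  refine h3.congr_of_eventuallyEq (Filter.Eventually.of_forall fun s => ?_)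
  simp only [Function.comp]
  rw [mul_assoc, ← expU_add_smul, add_sub_cancel]

/-- `skewTens u₂ y` for `y ∈ V₀` orthogonal to `u₂` moves `u₂` to `-y`. -/
theorem uVec_one_boost {y : Vec n} (hy : y (Sum.inl 1) = 0) :
    uVec n 1 ᵥ* (skewTens (uVec n 1) y : Matrix (Idx n) (Idx n) ℂ) = -y := by
  rw [vecMul_skewTens, herm_uVec_self, herm_swap_eq_zero (by rw [herm_uVec, hy]), zero_smul,
    one_smul, zero_sub]

theorem act_uVec_one_boost {y : Vec n} (hy : y (Sum.inl 1) = 0) (hyy : herm y y = -1) (t : ℝ) :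
    act (uVec n 1) (expU (t • skewTens (uVec n 1) y)) =
      ((Real.cosh t : ℝ) : ℂ) • uVec n 1 - ((Real.sinh t : ℝ) : ℂ) • y := by
  have h1 := uVec_one_boost hy
  have h2 : y ᵥ* (skewTens (uVec n 1) y : Matrix (Idx n) (Idx n) ℂ) = -uVec n 1 := by
    rw [vecMul_skewTens, hyy, herm_uVec, hy, zero_smul, sub_zero, neg_one_smul]
  have e1 : (uVec n 1 + y) ᵥ* (skewTens (uVec n 1) y : Matrix (Idx n) (Idx n) ℂ) =
      (-1 : ℂ) • (uVec n 1 + y) := by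
    rw [Matrix.add_vecMul, h1, h2]; module
  have e2 : (uVec n 1 - y) ᵥ* (skewTens (uVec n 1) y : Matrix (Idx n) (Idx n) ℂ) =
      (1 : ℂ) • (uVec n 1 - y) := by
    rw [Matrix.sub_vecMul, h1, h2]; module
  have a1 := act_expU_smul_of_eigen e1 t
  have a2 := act_expU_smul_of_eigen e2 t
  have e3 : uVec n 1 = (1 / 2 : ℂ) • ((uVec n 1 + y) + (uVec n 1 - y)) := by module
  have a3 := congrArg (fun v => act v (expU (t • skewTens (uVec n 1) y))) e3
  simp only [act_smul, act_add, a1, a2] at a3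
  rw [a3]
  rw [Real.cosh_eq, Real.sinh_eq]
  push_cast
  rw [mul_neg_one, mul_one]
  module

/-! The decomposition. -/

theorem exists_unitary {ι : Type} [Fintype ι] [DecidableEq ι] (i₀ : ι) (x : ι → ℂ)
    (hx : 0 < ∑ i, ‖x i‖ ^ 2) : ∃ Q : Matrix ι ι ℂ, Q * Qᴴ = 1 ∧
      x ᵥ* Q = ((Real.sqrt (∑ i, ‖x i‖ ^ 2) : ℝ) : ℂ) • Pi.single i₀ 1 := by
  set r := Real.sqrt (∑ i, ‖x i‖ ^ 2) with hr
  have hr0 : 0 < r := Real.sqrt_pos.2 hx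
  set X : EuclideanSpace ℂ ι := WithLp.toLp 2 x with hX
  have hXn : ‖X‖ = r := by rw [EuclideanSpace.norm_eq]
  have hunit : ‖((r⁻¹ : ℝ) : ℂ) • X‖ = 1 := by
    rw [norm_smul, hXn, Complex.norm_real, norm_inv, Real.norm_of_nonneg hr0.le,
      inv_mul_cancel₀ hr0.ne']
  have hor : Orthonormal ℂ (({i₀} : Set ι).domRestrict fun _ => ((r⁻¹ : ℝ) : ℂ) • X) := by
    rw [orthonormal_iff_ite]
    intro i j
    have : i = j := Subsingleton.elim _ _
    subst this
    rw [if_pos rfl, inner_self_eq_norm_sq_to_K, Set.domRestrict_apply, hunit]; simp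
  obtain ⟨b, hb⟩ := hor.exists_orthonormalBasis_extension_of_card_eq (by simp)
  have hb0 := hb i₀ rfl
  refine ⟨Matrix.of fun j i => conj (b i j), ?_, ?_⟩
  · have h1 : (Matrix.of fun j i => conj (b i j))ᴴ * (Matrix.of fun j i => conj (b i j)) = 1 := by
      ext i j
      have := (orthonormal_iff_ite.1 b.orthonormal) j i
      rw [PiLp.inner_apply] at this
      simp only [Matrix.mul_apply, Matrix.conjTranspose_apply, Matrix.of_apply, Matrix.one_apply]
      simp only [RCLike.inner_apply] at this
      rw [show (if i = j then (1 : ℂ) else 0) = if j = i then 1 else 0 by simp [eq_comm], ← this]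
      exact Finset.sum_congr rfl fun k _ => by simp
    exact mul_eq_one_comm.1 h1
  · have hx' : X = (r : ℂ) • b i₀ := by
      rw [hb0, smul_smul, ← Complex.ofReal_mul, mul_inv_cancel₀ hr0.ne', Complex.ofReal_one,
        one_smul]
    funext i
    have h2 : (x ᵥ* (Matrix.of fun j i => conj (b i j))) i = inner ℂ (b i) X := by
      rw [PiLp.inner_apply]
      simp [Matrix.vecMul, dotProduct, hX]
    rw [h2, hx', inner_smul_right, (orthonormal_iff_ite.1 b.orthonormal)]
    by_cases hi : i = i₀
    · subst hi; simp
    · simp [hi]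

/-- Block diagonal unitary matrices as elements of `K_∞`. -/
theorem exists_mem_KInf {P : Matrix (Fin 2) (Fin 2) ℂ} {Q : Matrix (Fin n) (Fin n) ℂ}
    (hP : P * Pᴴ = 1) (hQ : Q * Qᴴ = 1) :
    ∃ k ∈ KInf n, toMat k = Matrix.fromBlocks P 0 0 Q := by
  have hP' := mul_eq_one_comm.1 hP
  have hQ' := mul_eq_one_comm.1 hQ
  set A := Matrix.fromBlocks P 0 0 Q with hA
  have hct : Aᴴ = Matrix.fromBlocks Pᴴ 0 0 Qᴴ := by
    rw [hA, Matrix.fromBlocks_conjTranspose]; simp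
  have h1 : A * Aᴴ = 1 := by
    rw [hct, hA, Matrix.fromBlocks_multiply]; simp [hP, hQ, Matrix.fromBlocks_one]
  have h2 : Aᴴ * A = 1 := mul_eq_one_comm.1 h1
  have hc : Commute A (gram n) := commute_gram_of_blocks (fun i j => rfl) (fun i j => rfl)
  refine ⟨⟨⟨A, Aᴴ, h1, h2⟩, fun x y => ?_⟩, ⟨?_, ?_⟩, rfl⟩
  · change herm (x ᵥ* A) (y ᵥ* A) = herm x y
    rw [herm_eq_gram, herm_eq_gram, Matrix.star_vecMul, ← Matrix.dotProduct_mulVec,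
      Matrix.mulVec_mulVec, Matrix.mulVec_mulVec, hc.eq, mul_assoc, h1, mul_one]
  · ext i j; rfl
  · ext i j; rfl

theorem exists_act_b1_eq (g : U n) : ∃ k ∈ KInf n, ∃ r : ℝ, 0 < r ∧
    act (b1 n) (g * k) = (r : ℂ) • b1 n := by
  set x := act (b1 n) g with hx
  have hiso : herm x x = 0 := by rw [hx, herm_act, herm_b1_b1]
  have heq : ∑ i : Fin 2, ‖x (Sum.inl i)‖ ^ 2 = ∑ k : Fin n, ‖x (Sum.inr k)‖ ^ 2 := by
    have := herm_self_re x
    rw [hiso] at this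
    simp only [Complex.zero_re] at this
    linarith
  have hpos : 0 < ∑ i : Fin 2, ‖x (Sum.inl i)‖ ^ 2 := by
    refine lt_of_le_of_ne (by positivity) fun h0 => ?_
    have hx0 : x = 0 := by
      rw [← h0] at heq
      have h1 := (Finset.sum_eq_zero_iff_of_nonneg fun _ _ => by positivity).1 h0.symm
      have h2 := (Finset.sum_eq_zero_iff_of_nonneg fun _ _ => by positivity).1 heq.symm
      funext i
      rcases i with i | i
      · simpa using h1 i (Finset.mem_univ i)
      · simpa using h2 i (Finset.mem_univ i)
    have h3 := herm_act (b1 n) (b2 n) g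
    rw [← hx, hx0, herm_zero_left, herm_b1_b2] at h3
    exact zero_ne_one h3
  obtain ⟨P, hP, hPx⟩ := exists_unitary (0 : Fin 2) (fun i => x (Sum.inl i)) hpos
  obtain ⟨Q, hQ, hQx⟩ := exists_unitary (lastIdx n) (fun i => x (Sum.inr i)) (heq ▸ hpos)
  obtain ⟨k, hk, hkm⟩ := exists_mem_KInf hP hQ
  set r := Real.sqrt (∑ i : Fin 2, ‖x (Sum.inl i)‖ ^ 2) with hr
  have hr0 : 0 < r := Real.sqrt_pos.2 hpos
  refine ⟨k, hk, r * Real.sqrt 2, by positivity, ?_⟩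
  rw [Complex.ofReal_mul, ← smul_smul, sqrt_two_smul_b1, act_mul, ← hx, act, hkm]
  rw [← heq, ← hr] at hQx
  have hxe : x = Sum.elim (fun i => x (Sum.inl i)) (fun i => x (Sum.inr i)) := by
    funext i; cases i <;> rfl
  rw [hxe, Matrix.vecMul_fromBlocks]
  funext i
  rcases i with i | i
  · simp only [Sum.elim_inl, Sum.elim_comp_inl, Sum.elim_comp_inr, Matrix.vecMul_zero, add_zero,
      Pi.smul_apply, Pi.add_apply, smul_eq_mul]
    rw [hPx]
    simp [uVec, vVec, Pi.single_apply]
  · simp only [Sum.elim_inr, Sum.elim_comp_inl, Sum.elim_comp_inr, Matrix.vecMul_zero, zero_add,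
      Pi.smul_apply, Pi.add_apply, smul_eq_mul]
    rw [hQx]
    simp [uVec, vVec, Pi.single_apply]

theorem act_b1_heis {w : Vec n} (hw : w ∈ V0 n) (t : ℝ) : act (b1 n) (heis w t) = b1 n := by
  have h1 : b1 n ᵥ* (skewTens w (b1 n) : Matrix (Idx n) (Idx n) ℂ) = 0 := by
    rw [vecMul_skewTens, herm_b1_b1, herm_swap_eq_zero hw.1]; simp
  rw [heis, act_mul, act_expU_of_eq_zero h1, act_expU_of_eq_zero]
  rw [Submodule.coe_smul, Matrix.vecMul_smul, vecMul_diagTens, herm_b1_b1]; simp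

theorem act_V0_heis {w : Vec n} (hw : w ∈ V0 n) (t : ℝ) {x : Vec n} (hx : x ∈ V0 n) :
    act x (heis w t) = x - herm x w • b1 n := by
  have h1 : x ᵥ* (skewTens w (b1 n) : Matrix (Idx n) (Idx n) ℂ) = -herm x w • b1 n := by
    rw [vecMul_skewTens, hx.1]; simp
  have h2 : (-herm x w • b1 n) ᵥ* (skewTens w (b1 n) : Matrix (Idx n) (Idx n) ℂ) = 0 := by
    rw [Matrix.smul_vecMul, vecMul_skewTens, herm_b1_b1, herm_swap_eq_zero hw.1]; simp
  rw [heis, act_mul, act_expU_of_cube h1 h2 (Matrix.zero_vecMul _), act_expU_of_eq_zero]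
  · rw [smul_zero, add_zero, neg_smul, sub_eq_add_neg]
  · rw [Submodule.coe_smul, Matrix.vecMul_smul, vecMul_diagTens, smul_zero, add_zero,
      herm_add_left, herm_smul_left, hx.1, herm_b1_b1]
    simp

theorem act_b2_heis {w : Vec n} (hw : w ∈ V0 n) (t : ℝ) :
    act (b2 n) (heis w t) = b2 n + w + (t * Complex.I - 1 / 2 * herm w w) • b1 n := by
  have h1 : b2 n ᵥ* (skewTens w (b1 n) : Matrix (Idx n) (Idx n) ℂ) = w := by
    rw [vecMul_skewTens, herm_b2_b1, herm_swap_eq_zero hw.2]; simp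
  have h2 : w ᵥ* (skewTens w (b1 n) : Matrix (Idx n) (Idx n) ℂ) = -herm w w • b1 n := by
    rw [vecMul_skewTens, hw.1]; simp
  have h3 : (-herm w w • b1 n) ᵥ* (skewTens w (b1 n) : Matrix (Idx n) (Idx n) ℂ) = 0 := by
    rw [Matrix.smul_vecMul, vecMul_skewTens, herm_b1_b1, herm_swap_eq_zero hw.1]; simp
  have k1 : b2 n ᵥ* ((t • diagTens (b1 n) : lie n) : Matrix (Idx n) (Idx n) ℂ) =
      (t * Complex.I) • b1 n := by
    rw [Submodule.coe_smul, Matrix.vecMul_smul, vecMul_diagTens, herm_b2_b1, mul_one,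
      ← Complex.coe_smul, smul_smul]
  have k2 : ((t * Complex.I) • b1 n) ᵥ*
      ((t • diagTens (b1 n) : lie n) : Matrix (Idx n) (Idx n) ℂ) = 0 := by
    rw [Submodule.coe_smul, Matrix.vecMul_smul, Matrix.smul_vecMul, vecMul_diagTens, herm_b1_b1]
    simp
  have k3 : (w + (1 / 2 : ℂ) • (-herm w w • b1 n)) ᵥ*
      ((t • diagTens (b1 n) : lie n) : Matrix (Idx n) (Idx n) ℂ) = 0 := by
    rw [Submodule.coe_smul, Matrix.vecMul_smul, vecMul_diagTens, herm_add_left, hw.1,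
      herm_smul_left, herm_smul_left, herm_b1_b1]
    simp
  rw [heis, act_mul, act_expU_of_cube h1 h2 h3, add_assoc, act_add,
    act_expU_of_cube k1 k2 (Matrix.zero_vecMul _), act_expU_of_eq_zero k3]
  module

theorem mem_KInf_of_isLevi {k : U n} (h : IsLevi k 1) {c : ℂ}
    (hu : act (uVec n 1) k = c • uVec n 1) : k ∈ KInf n := by
  have h0 : act (uVec n 0) k = uVec n 0 := by
    rw [uVec_zero_eq, act_smul, act_add, h.1, h.2]; simp
  have hrow : ∀ j : Fin 2, ∃ d : ℂ, act (uVec n j) k = d • uVec n j := by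
    intro j
    fin_cases j
    · exact ⟨1, by rw [one_smul]; exact h0⟩
    · exact ⟨c, hu⟩
  have hentry : ∀ i j, toMat k i j = act (Pi.single i 1) k j := fun i j => by
    simp [act]
  constructor
  · ext j i
    obtain ⟨d, hd⟩ := hrow j
    change toMat k (Sum.inl j) (Sum.inr i) = 0
    rw [hentry]
    have := congrFun hd (Sum.inr i)
    simpa [uVec] using this
  · ext i j
    obtain ⟨d, hd⟩ := hrow j
    change toMat k (Sum.inr i) (Sum.inl j) = 0
    rw [hentry]
    have h1 : herm (act (vVec n i) k) (d • uVec n j) = 0 := by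
      rw [← hd, herm_act, herm_uVec]; simp [vVec]
    rw [herm_smul_right] at h1
    have hd0 : d ≠ 0 := by
      rintro rfl
      have := herm_act (uVec n j) (uVec n j) k
      rw [hd, zero_smul, herm_zero_left, herm_uVec_self] at this
      exact zero_ne_one this
    rw [← herm_uVec (act _ k)]
    exact (mul_eq_zero.1 h1).resolve_left (by simpa using hd0)

theorem IsLevi.inv {m : U n} {z : ℂˣ} (h : IsLevi m z) : IsLevi m⁻¹ z⁻¹ := by
  constructor
  · rw [h.act_b1_inv]; simp
  · rw [h.act_b2_inv]; simp

theorem dilation_eq : dilation n = skewTens (b2 n) (b1 n) := by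
  refine Subtype.ext (matrix_ext_vecMul fun v => ?_)
  have h := inv_sqrt_two_sq
  rw [dilation, vecMul_skewTens, vecMul_skewTens, herm_uVec, herm_vVec, herm_b1, herm_b2, b1, b2]
  set s := ((1 / Real.sqrt 2 : ℝ) : ℂ)
  have h2 : s * s = 1 / 2 := by rw [← h]; ring
  simp only [smul_smul, smul_sub, smul_add]
  rw [show s * (v (Sum.inl 0) - v (Sum.inr (lastIdx n))) * s =
      s * s * (v (Sum.inl 0) - v (Sum.inr (lastIdx n))) by ring,
    show s * (v (Sum.inl 0) + v (Sum.inr (lastIdx n))) * s =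
      s * s * (v (Sum.inl 0) + v (Sum.inr (lastIdx n))) by ring, h2]
  module

theorem IsLevi.commute_dilation {k : U n} (h : IsLevi k 1) (t : ℝ) :
    k * expU (t • dilation n) = expU (t • dilation n) * k := by
  refine mul_expU_smul_eq ?_ t
  rw [dilation_eq, toMat_mul_skewTens, h.act_b1_inv, h.act_b2_inv]
  simp

theorem exists_boost {m : U n} (h : IsLevi m 1) : ∃ y ∈ V0 n, y (Sum.inl 1) = 0 ∧ ∃ k ∈ KInf n,
    IsLevi k 1 ∧ m * k = expU (skewTens (uVec n 1) y) := by
  set x := act (uVec n 1) m⁻¹ with hx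
  have hxV : x ∈ V0 n := h.act_inv_mem_V0 uVec_one_mem_V0
  set c := x (Sum.inl 1) with hc
  set y' := x - c • uVec n 1 with hy'
  have hyV : y' ∈ V0 n := Submodule.sub_mem _ hxV (Submodule.smul_mem _ _ uVec_one_mem_V0)
  have hy1 : y' (Sum.inl 1) = 0 := by simp [hy', uVec, hc]
  have hxe : x = c • uVec n 1 + y' := by rw [hy']; abel
  have hyu : herm y' (uVec n 1) = 0 := by rw [herm_uVec, hy1]
  have hxx : herm x x = 1 := by rw [hx, herm_act, herm_uVec_self]
  have hxx2 : herm x x = (‖c‖ ^ 2 : ℝ) + herm y' y' := by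
    rw [hxe, herm_add_left, herm_add_right, herm_add_right, herm_smul_left, herm_smul_left,
      herm_smul_right, herm_smul_right, hyu, herm_swap_eq_zero hyu, herm_uVec_self]
    push_cast
    rw [← Complex.mul_conj']
    ring
  have hyneg : (herm y' y').re ≤ 0 := by
    have h0 := ((mem_V0_iff y').1 hyV).1
    rw [herm_self_re, Fin.sum_univ_two, h0, hy1]
    have : 0 ≤ ∑ k : Fin n, ‖y' (Sum.inr k)‖ ^ 2 := by positivity
    simpa using this
  have hre : 1 = ‖c‖ ^ 2 + (herm y' y').re := by
    have := congrArg Complex.re (hxx.symm.trans hxx2)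
    rw [Complex.add_re, Complex.ofReal_re, Complex.one_re] at this
    exact this
  set ρ := Real.sqrt (-(herm y' y').re) with hρ
  have hρ2 : ρ ^ 2 = -(herm y' y').re := Real.sq_sqrt (by linarith)
  have hc0 : c ≠ 0 := by
    intro h0
    rw [h0] at hre
    simp at hre
    linarith
  have hcn : 0 < ‖c‖ := norm_pos_iff.2 hc0
  have hkey : ∃ y ∈ V0 n, y (Sum.inl 1) = 0 ∧ ∃ d : ℂ,
      act x (expU (skewTens (uVec n 1) y)) = d • uVec n 1 := by
    by_cases hρ0 : ρ = 0
    · refine ⟨0, Submodule.zero_mem _, rfl, c, ?_⟩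
      have : y' = 0 := vec_eq_zero_of_herm ((mem_V0_iff y').1 hyV).1 hy1 (by
        rw [hρ0] at hρ2; linarith)
      have e : skewTens (uVec n 1) 0 = 0 := by rw [skewTens_swap, skewTens_zero_left, neg_zero]
      rw [e, expU_zero, act_one, hxe, this, add_zero]
    · have hρp : 0 < ρ := lt_of_le_of_ne (Real.sqrt_nonneg _) (Ne.symm hρ0)
      set l : ℂ := c / (‖c‖ : ℝ) with hl
      have hln : ‖l‖ = 1 := by
        rw [hl, norm_div, Complex.norm_real, norm_norm, div_self hcn.ne']
      have hl0 : l ≠ 0 := norm_ne_zero_iff.1 (by rw [hln]; norm_num)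
      set y := (l⁻¹ * ((ρ⁻¹ : ℝ) : ℂ)) • y' with hy
      have hyy1 : y (Sum.inl 1) = 0 := by rw [hy, Pi.smul_apply, hy1, smul_zero]
      have hyyV : y ∈ V0 n := Submodule.smul_mem _ _ hyV
      have hyy : herm y y = -1 := by
        have e : herm y' y' = ((-ρ ^ 2 : ℝ) : ℂ) := by
          rw [hρ2, neg_neg]
          exact Complex.ext (by simp) (by simp [herm_self_im])
        rw [hy, herm_smul_left, herm_smul_right, e, ← mul_assoc, Complex.mul_conj', norm_mul,
          norm_inv, hln, Complex.norm_real, norm_inv, Real.norm_of_nonneg hρp.le]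
        push_cast
        have : (ρ : ℂ) ≠ 0 := by exact_mod_cast hρ0
        field_simp
      set s := Real.arsinh ρ with hs
      have hch : Real.cosh s = ‖c‖ := by
        rw [hs, Real.cosh_arsinh]
        rw [Real.sqrt_eq_iff_mul_self_eq (by positivity) hcn.le]
        linarith
      refine ⟨(s : ℂ) • y, Submodule.smul_mem _ _ hyyV, by rw [Pi.smul_apply, hyy1, smul_zero],
        l, ?_⟩
      rw [skewTens_real_smul_right]
      have e1 := act_uVec_one_boost hyy1 hyy (-s)
      have e2 : x = l • act (uVec n 1) (expU ((-s) • skewTens (uVec n 1) y)) := by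
        rw [e1, Real.cosh_neg, Real.sinh_neg, hch, hs, Real.sinh_arsinh, hxe, hy, smul_sub,
          smul_smul, smul_smul, smul_smul]
        have a1 : l * ((‖c‖ : ℝ) : ℂ) = c := by
          rw [hl, div_mul_cancel₀]; exact_mod_cast hcn.ne'
        have a2 : l * (((-ρ : ℝ) : ℂ) * (l⁻¹ * ((ρ⁻¹ : ℝ) : ℂ))) = -1 := by
          push_cast
          have : (ρ : ℂ) ≠ 0 := by exact_mod_cast hρ0
          field_simp
        rw [a1, mul_assoc, a2]; module
      rw [e2, act_smul, ← act_mul, expU_neg_smul, inv_mul_cancel, act_one]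
  obtain ⟨y, hyV, hy1, d, hd⟩ := hkey
  have hLk : IsLevi (m⁻¹ * expU (skewTens (uVec n 1) y)) 1 := by
    have := h.inv.mul_skewTens (uVec_one_mem_V0 (n := n)) hyV
    rwa [inv_one] at this
  refine ⟨y, hyV, hy1, m⁻¹ * expU (skewTens (uVec n 1) y), mem_KInf_of_isLevi hLk (c := d) ?_,
    hLk, by rw [mul_inv_cancel_left]⟩
  rw [act_mul, ← hx, hd]

/-- The decomposition `G = N · exp(boosts) · A · K_∞`. -/
theorem exists_decomposition (g : U n) : ∃ w ∈ V0 n, ∃ t : ℝ, ∃ y ∈ V0 n, y (Sum.inl 1) = 0 ∧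
    ∃ s : ℝ, ∃ k ∈ KInf n, heis w t * (g * k) =
      expU (skewTens (uVec n 1) y) * expU (s • dilation n) := by
  obtain ⟨k, hk, r, hr, hgk⟩ := exists_act_b1_eq g
  set p := g * k * expU (Real.log r • dilation n) with hp
  have hpb1 : act (b1 n) p = b1 n := by
    rw [hp, act_mul, hgk, act_smul, act_b1_dilation, smul_smul, Real.exp_neg, Real.exp_log hr,
      ← Complex.ofReal_mul, mul_inv_cancel₀ hr.ne', Complex.ofReal_one, one_smul]
  set x := act (b2 n) p⁻¹ with hx
  have hxb1 : herm x (b1 n) = 1 := by rw [hx, ← herm_act_right, hpb1, herm_b2_b1]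
  have hxx : herm x x = 0 := by rw [hx, herm_act, herm_b2_b2]
  set c := herm x (b2 n) with hc
  set w := x - b2 n - c • b1 n with hw
  have hwV : w ∈ V0 n := by
    constructor
    · rw [hw, herm_sub_left, herm_sub_left, herm_smul_left, hxb1, herm_b2_b1, herm_b1_b1]; ring
    · rw [hw, herm_sub_left, herm_sub_left, herm_smul_left, herm_b2_b2, herm_b1_b2, hc]; ring
  have hxe : x = b2 n + w + c • b1 n := by rw [hw]; abel
  have hww : c + conj c + herm w w = 0 := by
    rw [← hxx, hxe]
    simp only [herm_add_left, herm_add_right, herm_smul_left, herm_smul_right, hwV.1, hwV.2,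
      herm_swap_eq_zero hwV.1, herm_swap_eq_zero hwV.2, herm_b1_b1, herm_b2_b2, herm_b1_b2,
      herm_b2_b1]
    ring
  have hceq : c = c.im * Complex.I - 1 / 2 * herm w w := by
    have h1 : c + conj c = 2 * c.re := by rw [Complex.add_conj]; push_cast; ring
    have h2 := Complex.re_add_im c
    linear_combination -h2 + (1 / 2) * hww - (1 / 2) * h1
  have hb2 : act (b2 n) (heis w c.im) = x := by
    rw [act_b2_heis hwV, ← hceq, hxe]
  have hL : IsLevi (heis w c.im * p) 1 := by
    constructor
    · rw [act_mul, act_b1_heis hwV, hpb1]; simp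
    · rw [act_mul, hb2, hx, act_inv_act]; simp
  obtain ⟨y, hyV, hy1, k', hk', hLk', he⟩ := exists_boost hL
  refine ⟨w, hwV, c.im, y, hyV, hy1, -Real.log r, k * k', KInf_mul_mem hk hk', ?_⟩
  rw [← he, mul_assoc _ k', hLk'.commute_dilation, hp, expU_neg_smul]
  group

end Geometry

end

end QWhittaker

namespace QWhittaker

noncomputable section

/-! ### Uniqueness -/

set_option linter.unusedSectionVars false

section Height

variable {n : ℕ}

theorem height_mul_le (g h : U n) : height (g * h) ≤ height g * height h := by
  have key : ∀ A B : Matrix (Idx n) (Idx n) ℂ, ∑ i, ∑ j, ‖(A * B) i j‖ ≤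
      (∑ i, ∑ j, ‖A i j‖) * ∑ i, ∑ j, ‖B i j‖ := by
    intro A B
    rw [Finset.sum_mul]
    refine Finset.sum_le_sum fun i _ => ?_
    calc ∑ j, ‖(A * B) i j‖ ≤ ∑ j, ∑ k, ‖A i k‖ * ‖B k j‖ :=
          Finset.sum_le_sum fun j _ => by
            rw [Matrix.mul_apply]
            exact (norm_sum_le _ _).trans (Finset.sum_le_sum fun k _ => (norm_mul _ _).le)
      _ = ∑ k, ‖A i k‖ * ∑ j, ‖B k j‖ := by
          rw [Finset.sum_comm]
          exact Finset.sum_congr rfl fun k _ => (Finset.mul_sum _ _ _).symm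
      _ ≤ ∑ k, ‖A i k‖ * ∑ i, ∑ j, ‖B i j‖ :=
          Finset.sum_le_sum fun k _ => mul_le_mul_of_nonneg_left
            (Finset.single_le_sum (f := fun i => ∑ j, ‖B i j‖) (fun _ _ => by positivity)
              (Finset.mem_univ k)) (norm_nonneg _)
      _ = (∑ k, ‖A i k‖) * ∑ i, ∑ j, ‖B i j‖ := (Finset.sum_mul _ _ _).symm
  have e : ∀ g : U n, height g =
      (∑ i, ∑ j, ‖toMat g i j‖) + ∑ i, ∑ j, ‖toMat g⁻¹ i j‖ := fun g => by
    simp only [height, Finset.sum_add_distrib]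
  have h1 := key (toMat g) (toMat h)
  have h2 := key (toMat h⁻¹) (toMat g⁻¹)
  rw [e, e, e, mul_inv_rev, toMat_mul, toMat_mul]
  have p : ∀ A : Matrix (Idx n) (Idx n) ℂ, 0 ≤ ∑ i, ∑ j, ‖A i j‖ := fun A => by positivity
  nlinarith [mul_nonneg (p (toMat g)) (p (toMat h⁻¹)), mul_nonneg (p (toMat g⁻¹)) (p (toMat h))]

theorem height_inv (g : U n) : height g⁻¹ = height g := by
  simp only [height, inv_inv]
  exact Finset.sum_congr rfl fun i _ => Finset.sum_congr rfl fun j _ => add_comm _ _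

variable [NeZero n]

theorem act_dilation (x : Vec n) (t : ℝ) : act x (expU (t • dilation n)) = x +
    (((Real.exp (-t) : ℝ) : ℂ) - 1) • herm x (b2 n) • b1 n +
      (((Real.exp t : ℝ) : ℂ) - 1) • herm x (b1 n) • b2 n := by
  set x0 := x - herm x (b2 n) • b1 n - herm x (b1 n) • b2 n with hx0
  have hV : x0 ∈ V0 n := by
    constructor
    · rw [hx0, herm_sub_left, herm_sub_left, herm_smul_left, herm_smul_left, herm_b1_b1,
        herm_b2_b1]; ring
    · rw [hx0, herm_sub_left, herm_sub_left, herm_smul_left, herm_smul_left, herm_b1_b2,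
        herm_b2_b2]; ring
  have hx : x = x0 + herm x (b2 n) • b1 n + herm x (b1 n) • b2 n := by rw [hx0]; abel
  have h1 : act x (expU (t • dilation n)) = x0 + ((Real.exp (-t) : ℝ) : ℂ) • herm x (b2 n) • b1 n +
      ((Real.exp t : ℝ) : ℂ) • herm x (b1 n) • b2 n := by
    conv_lhs => rw [hx, act_add, act_add, act_smul, act_smul, act_V0_dilation hV, act_b1_dilation,
      act_b2_dilation]
    module
  rw [h1, hx0]
  module

theorem exists_height_dilation_le : ∃ C : ℝ, 0 ≤ C ∧ ∀ t : ℝ, 0 ≤ t →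
    height (expU (t • dilation n)) ≤ C * Real.exp t := by
  set B : Idx n → Idx n → ℝ := fun i j => ‖(Pi.single i 1 : Vec n) j‖ +
    ‖herm (Pi.single i 1) (b2 n) * b1 n j‖ + ‖herm (Pi.single i 1) (b1 n) * b2 n j‖ with hB
  have hent : ∀ (t s : ℝ), 0 ≤ t → |s| = t → ∀ i j,
      ‖toMat (expU (s • dilation n)) i j‖ ≤ B i j * Real.exp t := by
    intro t s ht hs i j
    have e : toMat (expU (s • dilation n)) i j = act (Pi.single i 1) (expU (s • dilation n)) j := by
      simp [act]
    have hle : ∀ r : ℝ, |r| = t → ‖((Real.exp r : ℝ) : ℂ) - 1‖ ≤ Real.exp t := by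
      intro r hr
      rw [← Complex.ofReal_one, ← Complex.ofReal_sub, Complex.norm_real, Real.norm_eq_abs, abs_le]
      have h1 := Real.exp_pos r
      have h2 : Real.exp r ≤ Real.exp t := Real.exp_le_exp.2 (hr ▸ le_abs_self r)
      have h3 : 1 ≤ Real.exp t := Real.one_le_exp ht
      constructor <;> linarith
    rw [e, act_dilation]
    simp only [Pi.add_apply, Pi.smul_apply, smul_eq_mul]
    refine (norm_add₃_le).trans ?_
    rw [norm_mul _ (herm _ (b2 n) * _), norm_mul _ (herm _ (b1 n) * _)]
    have h1 := mul_le_mul_of_nonneg_right (hle (-s) (by rw [abs_neg, hs]))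
      (norm_nonneg (herm (Pi.single i 1) (b2 n) * b1 n j))
    have h2 := mul_le_mul_of_nonneg_right (hle s hs)
      (norm_nonneg (herm (Pi.single i 1) (b1 n) * b2 n j))
    have h3 := le_mul_of_one_le_left (norm_nonneg ((Pi.single i 1 : Vec n) j))
      (Real.one_le_exp ht)
    simp only [hB]
    linarith
  refine ⟨∑ i, ∑ j, (B i j + B i j), by positivity, fun t ht => ?_⟩
  rw [height, Finset.sum_mul]
  refine Finset.sum_le_sum fun i _ => ?_
  rw [Finset.sum_mul]
  refine Finset.sum_le_sum fun j _ => ?_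
  rw [add_mul, ← expU_neg_smul]
  exact add_le_add (hent t t ht (abs_of_nonneg ht) i j)
    (hent t (-t) ht (by rw [abs_neg, abs_of_nonneg ht]) i j)

end Height

section Uniqueness

variable {n ℓ : ℕ} [NeZero n] {T : Vec n} {W : U n → VEll ℓ}

theorem lieDeriv_skewTens_vVec {g : U n} (hs : IsSmooth W) (c : ℂ) (k : Fin n) :
    lieDeriv (skewTens (uVec n 1) (c • vVec n k)) W g =
      conj c • pPlus 1 k W g + c • pMinus 1 k W g := by
  have h1 : skewTens (uVec n 1) (c • vVec n k) = c.re • skewTens (uVec n 1) (vVec n k) -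
      c.im • symTens (uVec n 1) (vVec n k) := by
    have e : c • vVec n k = (c.re : ℂ) • vVec n k + (c.im : ℂ) • Complex.I • vVec n k := by
      rw [smul_smul, ← add_smul, Complex.re_add_im]
    rw [e, skewTens_add_right, skewTens_real_smul_right, skewTens_real_smul_right,
      skewTens_I_smul_right, smul_neg, sub_eq_add_neg]
  rw [h1, lieDeriv_sub_lie hs, lieDeriv_smul_lie hs, lieDeriv_smul_lie hs, pPlus, pMinus]
  funext a
  simp only [Pi.add_apply, Pi.sub_apply, Pi.smul_apply, smul_eq_mul, Complex.real_smul]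
  have hb : conj c = c.re - c.im * Complex.I := by
    rw [Complex.ext_iff]; simp
  conv_rhs => enter [2, 1]; rw [← Complex.re_add_im c]
  rw [hb]
  linear_combination -(c.im * lieDeriv (symTens (uVec n 1) (vVec n k)) W g a) * Complex.I_sq

theorem vec_eq_sum_vVec {y : Vec n} (hy : y ∈ V0 n) (hy1 : y (Sum.inl 1) = 0) :
    y = ∑ k : Fin n, y (Sum.inr k) • vVec n k := by
  funext i
  rw [Finset.sum_apply]
  rcases i with i | i
  · have : y (Sum.inl i) = 0 := by
      fin_cases i
      · exact ((mem_V0_iff y).1 hy).1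
      · exact hy1
    rw [this]; simp [vVec]
  · simp [vVec, Pi.single_apply]

omit [NeZero n] in
theorem pairing_add (m : U n) (z : ℂˣ) (x y : Vec n) :
    pairing T m z (x + y) = pairing T m z x + pairing T m z y := by
  rw [pairing, pairing, pairing, herm_add_left]; ring

omit [NeZero n] in
theorem pairing_smul (m : U n) (z : ℂˣ) (c : ℂ) (y : Vec n) :
    pairing T m z (c • y) = c * pairing T m z y := by
  rw [pairing, pairing, herm_smul_left]; ring

variable (hW : IsWhittaker T W)

include hW

theorem IsWhittaker.lieDeriv_boost {m : U n} {z : ℂˣ} (hm : IsLevi m z) {y : Vec n}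
    (hy : y ∈ V0 n) (hy1 : y (Sum.inl 1) = 0) {i j : Fin (2 * ℓ)} (hij : i.succ = j.castSucc) :
    lieDeriv (skewTens (uVec n 1) y) W m j.castSucc =
      -(1 / 2) * (conj (pairing T m z y) * W m i.castSucc + pairing T m z y * W m j.succ) := by
  have hp := ((schmidPlus_eq_zero_iff hW.smooth hW.character hW.equivariant hm).1
    (hW.schmid_plus m)).2
  have hq := ((schmidMinus_eq_zero_iff hW.smooth hW.character hW.equivariant hm).1
    (hW.schmid_minus m)).2
  rw [vec_eq_sum_vVec hy hy1]
  refine Finset.sum_induction _ (fun y => lieDeriv (skewTens (uVec n 1) y) W m j.castSucc =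
      -(1 / 2) * (conj (pairing T m z y) * W m i.castSucc + pairing T m z y * W m j.succ))
    (fun x y hx hy => ?_) ?_ fun k _ => ?_
  · simp only [skewTens_add_right, lieDeriv_add_lie hW.smooth, Pi.add_apply, hx, hy, pairing_add,
      map_add]
    ring
  · have e := lieDeriv_skewTens_vVec (g := m) hW.smooth 0 (0 : Fin n)
    rw [zero_smul] at e
    simp only [e, pairing, herm_zero_left]
    simp
  · by_cases hk : k = lastIdx n
    · rw [hk, ((mem_V0_iff y).1 hy).2]
      have e := lieDeriv_skewTens_vVec (g := m) hW.smooth 0 (lastIdx n)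
      simp only [e, pairing_smul]
      simp
    · rw [lieDeriv_skewTens_vVec hW.smooth, pairing_smul]
      simp only [Pi.add_apply, Pi.smul_apply, smul_eq_mul]
      have h1 := hp k hk i
      have h2 := hq k hk j
      rw [hij] at h1
      rw [h1, h2, map_mul]
      ring

theorem IsWhittaker.dilation_succ {m : U n} {z : ℂˣ} (hm : IsLevi m z) (a : Fin (2 * ℓ)) :
    lieDeriv (dilation n) W m a.castSucc =
        ((a : ℕ) + ℓ + 2) * W m a.castSucc - beta T m z * W m a.succ :=
  ((schmidPlus_eq_zero_iff hW.smooth hW.character hW.equivariant hm).1 (hW.schmid_plus m)).1 a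

theorem IsWhittaker.dilation_pred {m : U n} {z : ℂˣ} (hm : IsLevi m z) (a : Fin (2 * ℓ)) :
    lieDeriv (dilation n) W m a.succ =
        (3 * ℓ + 1 - (a : ℕ)) * W m a.succ - conj (beta T m z) * W m a.castSucc :=
  ((schmidMinus_eq_zero_iff hW.smooth hW.character hW.equivariant hm).1 (hW.schmid_minus m)).1 a

omit hW in
theorem hasDerivAt_coord (hs : IsSmooth W) (g : U n) (X : lie n) (t : ℝ) (a : Fin (2 * ℓ + 1)) :
    HasDerivAt (fun s : ℝ => W (g * expU (s • X)) a) (lieDeriv X W (g * expU (t • X)) a) t :=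
  hasDerivAt_pi.1 (hs.hasDerivAt_path g X t) a

/-- If one coefficient vanishes on a dilation orbit, all coefficients do. -/
theorem IsWhittaker.eq_zero_on_line (hT : T ∈ V0 n) {m : U n} {z : ℂˣ} (hm : IsLevi m z)
    (hb : beta T m z ≠ 0) (c : Fin (2 * ℓ + 1))
    (h0 : ∀ t : ℝ, W (m * expU (t • dilation n)) c = 0) (t : ℝ) :
    W (m * expU (t • dilation n)) = 0 := by
  have hbt : ∀ t : ℝ, beta T (m * expU (t • dilation n)) (z * expUnit t) ≠ 0 := fun t => by
    rw [beta_dilation hT hm]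
    exact mul_ne_zero (by exact_mod_cast (Real.exp_pos t).ne') hb
  have hL : ∀ a : Fin (2 * ℓ + 1), (∀ t : ℝ, W (m * expU (t • dilation n)) a = 0) →
      ∀ t : ℝ, lieDeriv (dilation n) W (m * expU (t • dilation n)) a = 0 := by
    intro a ha t
    have h1 := hasDerivAt_coord hW.smooth m (dilation n) t a
    have e : (fun s : ℝ => W (m * expU (s • dilation n)) a) = fun _ => 0 := funext ha
    rw [e] at h1
    exact h1.unique (hasDerivAt_const t (0 : ℂ))
  have hup : ∀ a : Fin (2 * ℓ), (∀ t : ℝ, W (m * expU (t • dilation n)) a.castSucc = 0) →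
      ∀ t : ℝ, W (m * expU (t • dilation n)) a.succ = 0 := by
    intro a ha t
    have h1 := hW.dilation_succ (hm.mul_dilation t) a
    rw [hL _ ha, ha, mul_zero, zero_sub, eq_comm, neg_eq_zero] at h1
    exact (mul_eq_zero.1 h1).resolve_left (hbt t)
  have hdown : ∀ a : Fin (2 * ℓ), (∀ t : ℝ, W (m * expU (t • dilation n)) a.succ = 0) →
      ∀ t : ℝ, W (m * expU (t • dilation n)) a.castSucc = 0 := by
    intro a ha t
    have h1 := hW.dilation_pred (hm.mul_dilation t) a
    rw [hL _ ha, ha, mul_zero, zero_sub, eq_comm, neg_eq_zero] at h1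
    exact (mul_eq_zero.1 h1).resolve_left (by simpa using hbt t)
  have hup' : ∀ (d : ℕ) (a : Fin (2 * ℓ + 1)), (a : ℕ) = c + d →
      ∀ t : ℝ, W (m * expU (t • dilation n)) a = 0 := by
    intro d
    induction d with
    | zero => intro a ha; rw [show a = c from Fin.ext (by omega)]; exact h0
    | succ d ih =>
      intro a ha
      have := hup ⟨c + d, by omega⟩ (ih _ rfl)
      rwa [show a = Fin.succ ⟨c + d, by omega⟩ from Fin.ext (by simp; omega)]
  have hdown' : ∀ (d : ℕ) (a : Fin (2 * ℓ + 1)), (a : ℕ) + d = c →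
      ∀ t : ℝ, W (m * expU (t • dilation n)) a = 0 := by
    intro d
    induction d with
    | zero => intro a ha; rw [show a = c from Fin.ext (by omega)]; exact h0
    | succ d ih =>
      intro a ha
      have := hdown ⟨a, by omega⟩ (ih (Fin.succ ⟨a, by omega⟩) (by simp; omega))
      rwa [show a = Fin.castSucc ⟨a, by omega⟩ from Fin.ext (by simp)]
  funext a
  rcases le_total (c : ℕ) a with h | h
  · exact hup' (a - c) a (by omega) t
  · exact hdown' (c - a) a (by omega) t

omit hW in
theorem tendsto_exp_mul_besselK (v : ℤ) (r : ℕ) {b : ℝ} (hb : 0 < b) :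
    Filter.Tendsto (fun t : ℝ => Real.exp t ^ r * besselK v (b * Real.exp t))
      Filter.atTop (𝓝 0) := by
  obtain ⟨M, C, hM, hC, h⟩ := besselK_le v (r + 1)
  have hlim : Filter.Tendsto (fun t : ℝ => C * (1 / b) ^ M * Real.exp (-t)) Filter.atTop (𝓝 0) := by
    simpa using (Real.tendsto_exp_neg_atTop_nhds_zero).const_mul (C * (1 / b) ^ M)
  refine squeeze_zero' (Filter.Eventually.of_forall fun t => ?_) ?_ hlim
  · exact mul_nonneg (by positivity) (besselK_pos v (by positivity)).le
  · filter_upwards [Filter.eventually_ge_atTop 0] with t ht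
    have h1 := h (b * Real.exp t) (by positivity)
    have h2 : Real.exp t ^ r * (1 / Real.exp t) ^ M ≤ Real.exp (-t) := by
      obtain ⟨d, rfl⟩ := Nat.exists_eq_add_of_le hM
      rw [Real.exp_neg, one_div, inv_pow, show r + 1 + d = r + (1 + d) by ring, pow_add, mul_inv,
        ← mul_assoc, mul_inv_cancel₀ (by positivity), one_mul]
      refine inv_anti₀ (Real.exp_pos t) ?_
      exact le_self_pow₀ (Real.one_le_exp ht) (by omega)
    calc Real.exp t ^ r * besselK v (b * Real.exp t)
        ≤ Real.exp t ^ r * (C * (1 / (b * Real.exp t)) ^ M) := by gcongr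
      _ = C * (1 / b) ^ M * (Real.exp t ^ r * (1 / Real.exp t) ^ M) := by
          rw [show 1 / (b * Real.exp t) = 1 / b * (1 / Real.exp t) by field_simp, mul_pow]; ring
      _ ≤ _ := mul_le_mul_of_nonneg_left h2 (by positivity)

/-- The Wronskian argument: by moderate growth, `W` is proportional to the `K`-Bessel solution. -/
theorem IsWhittaker.mul_kap_eq (hT : T ∈ V0 n) {m : U n} {z : ℂˣ} (hm : IsLevi m z)
    (hb : beta T m z ≠ 0) {j : Fin (2 * ℓ)} (hj : (j : ℕ) = ℓ) :
    W m j.castSucc * kap 1 (beta T m z) = W m j.succ * kap 0 (beta T m z) := by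
  set b := beta T m z with hbdef
  set B : ℝ → ℂ := fun t => ((Real.exp t : ℝ) : ℂ) * b with hB
  have hBt : ∀ t, beta T (m * expU (t • dilation n)) (z * expUnit t) = B t :=
    fun t => beta_dilation hT hm t
  have hB0 : ∀ t, B t ≠ 0 := fun t => mul_ne_zero (by exact_mod_cast (Real.exp_pos t).ne') hb
  have hBd : ∀ t, HasDerivAt B (B t) t := fun t =>
    ((Real.hasDerivAt_exp t).ofReal_comp).mul_const b
  set f : ℝ → ℂ := fun t => W (m * expU (t • dilation n)) j.castSucc with hf
  set f1 : ℝ → ℂ := fun t => W (m * expU (t • dilation n)) j.succ with hf1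
  have hfd : ∀ t, HasDerivAt f ((2 * ℓ + 2) * f t - B t * f1 t) t := fun t => by
    refine (hasDerivAt_coord hW.smooth m (dilation n) t j.castSucc).congr_deriv ?_
    rw [hW.dilation_succ (hm.mul_dilation t) j, hBt, hj]
    simp only [hf, hf1]; ring
  have hf1d : ∀ t, HasDerivAt f1 ((2 * ℓ + 1) * f1 t - conj (B t) * f t) t := fun t => by
    refine (hasDerivAt_coord hW.smooth m (dilation n) t j.succ).congr_deriv ?_
    rw [hW.dilation_pred (hm.mul_dilation t) j, hBt, hj]
    simp only [hf, hf1]; ring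
  have hk0 : ∀ t, HasDerivAt (fun t => kap 0 (B t)) (-(B t * kap 1 (B t))) t := fun t => by
    refine (hasDerivAt_kap 0 (hBd t) (hB0 t)).congr_deriv ?_
    have := kap_recurrence 0 (hB0 t)
    simp only [zero_add, zero_sub, Int.cast_zero, mul_zero, zero_mul] at this ⊢
    linear_combination (1 / 2) * this
  have hk1 : ∀ t, HasDerivAt (fun t => kap 1 (B t)) (-kap 1 (B t) - conj (B t) * kap 0 (B t)) t :=
    fun t => by
      refine (hasDerivAt_kap 1 (hBd t) (hB0 t)).congr_deriv ?_
      have := kap_recurrence 1 (hB0 t)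
      simp only [sub_self, Int.cast_one, mul_one] at this ⊢
      linear_combination -(1 / 2) * this
  have hed : ∀ t : ℝ, HasDerivAt (fun t : ℝ => ((Real.exp (-(2 * ℓ + 1) * t) : ℝ) : ℂ))
      (-(2 * ℓ + 1) * ((Real.exp (-(2 * ℓ + 1) * t) : ℝ) : ℂ)) t := fun t => by
    have h1 : HasDerivAt (fun t : ℝ => -(2 * (ℓ : ℝ) + 1) * t) (-(2 * ℓ + 1)) t := by
      simpa using (hasDerivAt_id t).const_mul (-(2 * (ℓ : ℝ) + 1))
    refine (h1.exp.ofReal_comp).congr_deriv ?_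
    push_cast; ring
  set w : ℝ → ℂ := fun t => ((Real.exp (-(2 * ℓ + 1) * t) : ℝ) : ℂ) *
    (f t * kap 1 (B t) - f1 t * kap 0 (B t)) with hw
  have hwd : ∀ t, HasDerivAt w 0 t := fun t => by
    refine ((hed t).mul (((hfd t).mul (hk1 t)).sub ((hf1d t).mul (hk0 t)))).congr_deriv ?_
    simp only [Pi.sub_apply, Pi.mul_apply]
    ring
  have hconst : ∀ t, w t = w 0 := fun t =>
    is_const_of_deriv_eq_zero (fun t => (hwd t).differentiableAt) (fun t => (hwd t).deriv) t 0
  obtain ⟨C, r, hC⟩ := hW.moderate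
  obtain ⟨D, hD0, hD⟩ := exists_height_dilation_le (n := n)
  have hpos : 0 < ‖b‖ := norm_pos_iff.2 hb
  have hBn : ∀ t, ‖B t‖ = ‖b‖ * Real.exp t := fun t => by
    rw [hB, norm_mul, Complex.norm_real, Real.norm_of_nonneg (Real.exp_pos t).le, mul_comm]
  have hC0 : 0 ≤ C := by
    have := (norm_nonneg _).trans (hC 1)
    exact nonneg_of_mul_nonneg_left this (pow_pos (lt_of_lt_of_le one_pos (height_one_le 1)) r)
  have hWb : ∀ t : ℝ, 0 ≤ t → ∀ a, ‖W (m * expU (t • dilation n)) a‖ ≤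
      C * (height m * D) ^ r * Real.exp t ^ r := fun t ht a => by
    refine (norm_le_pi_norm _ a).trans ((hC _).trans ?_)
    rw [mul_assoc, ← mul_pow]
    have h1 := height_mul_le m (expU (t • dilation n))
    have h2 : 0 ≤ height m := zero_le_one.trans (height_one_le m)
    have h3 := mul_le_mul_of_nonneg_left (hD t ht) h2
    have h4 : 0 ≤ height (m * expU (t • dilation n)) := zero_le_one.trans (height_one_le _)
    refine mul_le_mul_of_nonneg_left (pow_le_pow_left₀ h4 ?_ r) hC0
    linarith
  have hlim : Filter.Tendsto (fun t : ℝ => C * (height m * D) ^ r *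
      (Real.exp t ^ r * besselK 1 (‖b‖ * Real.exp t)) + C * (height m * D) ^ r *
      (Real.exp t ^ r * besselK 0 (‖b‖ * Real.exp t))) Filter.atTop (𝓝 0) := by
    simpa using ((tendsto_exp_mul_besselK 1 r hpos).const_mul (C * (height m * D) ^ r)).add
      ((tendsto_exp_mul_besselK 0 r hpos).const_mul (C * (height m * D) ^ r))
  have hw0 : ‖w 0‖ ≤ 0 := by
    refine ge_of_tendsto hlim ?_
    filter_upwards [Filter.eventually_ge_atTop 0] with t ht
    rw [← hconst t, hw]
    simp only
    rw [norm_mul, Complex.norm_real, Real.norm_of_nonneg (Real.exp_pos _).le]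
    have he : Real.exp (-(2 * ℓ + 1) * t) ≤ 1 := by
      refine Real.exp_le_one_iff.2 ?_
      have : 0 ≤ (2 * (ℓ : ℝ) + 1) * t := by positivity
      linarith
    refine (mul_le_of_le_one_left (norm_nonneg _) he).trans ((norm_sub_le _ _).trans ?_)
    rw [norm_mul, norm_mul, norm_kap 1 (hB0 t), norm_kap 0 (hB0 t), hBn, ← mul_assoc, ← mul_assoc]
    have p1 := (besselK_pos 1 (x := ‖b‖ * Real.exp t) (by positivity)).le
    have p0 := (besselK_pos 0 (x := ‖b‖ * Real.exp t) (by positivity)).le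
    exact add_le_add (mul_le_mul_of_nonneg_right (hWb t ht _) p1)
      (mul_le_mul_of_nonneg_right (hWb t ht _) p0)
  have hw1 : w 0 = 0 := norm_le_zero_iff.1 hw0
  simp only [hw, hf, hf1, hB, mul_zero, Real.exp_zero, Complex.ofReal_one, one_mul, zero_smul,
    expU_zero, mul_one] at hw1
  linear_combination hw1

theorem IsWhittaker.mul_kap_neg_eq (hT : T ∈ V0 n) {m : U n} {z : ℂˣ} (hm : IsLevi m z)
    (hb : beta T m z ≠ 0) {i j : Fin (2 * ℓ)} (hij : i.succ = j.castSucc) (hj : (j : ℕ) = ℓ) :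
    W m j.castSucc * kap (-1) (beta T m z) = W m i.castSucc * kap 0 (beta T m z) := by
  have h1 := hW.mul_kap_eq hT hm hb hj
  have hi : (i : ℕ) + 1 = ℓ := by
    have := congrArg Fin.val hij
    simp at this
    omega
  have hi' : (i : ℂ) = ℓ - 1 := by
    have : ((i : ℕ) : ℂ) + 1 = ℓ := by exact_mod_cast hi
    linear_combination this
  have h2 := hW.dilation_succ hm j
  have h3 := hW.dilation_pred hm i
  rw [hij, h2, hj, hi'] at h3
  have h4 := kap_recurrence 0 hb
  simp only [zero_add, zero_sub, Int.cast_zero, mul_zero, zero_mul] at h4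
  have hc : conj (beta T m z) ≠ 0 := by simpa using hb
  refine mul_left_cancel₀ hc ?_
  linear_combination beta T m z * h1 - W m j.castSucc * h4 - kap 0 (beta T m z) * h3

/-- Along a dilation orbit the middle coefficient vanishes if it does at one point. -/
theorem IsWhittaker.mid_eq_zero_dilation (hT : T ∈ V0 n) {m : U n} {z : ℂˣ} (hm : IsLevi m z)
    (hb : beta T m z ≠ 0) {j : Fin (2 * ℓ)} (hj : (j : ℕ) = ℓ)
    (h0 : W m j.castSucc = 0) (t : ℝ) : W (m * expU (t • dilation n)) j.castSucc = 0 := by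
  set b := beta T m z with hbdef
  set B : ℝ → ℂ := fun t => ((Real.exp t : ℝ) : ℂ) * b with hB
  have hBt : ∀ t, beta T (m * expU (t • dilation n)) (z * expUnit t) = B t :=
    fun t => beta_dilation hT hm t
  have hB0 : ∀ t, B t ≠ 0 := fun t => mul_ne_zero (by exact_mod_cast (Real.exp_pos t).ne') hb
  have hBd : ∀ t, HasDerivAt B (B t) t := fun t =>
    ((Real.hasDerivAt_exp t).ofReal_comp).mul_const b
  set f : ℝ → ℂ := fun t => W (m * expU (t • dilation n)) j.castSucc with hf
  have hfd : ∀ t, HasDerivAt f ((2 * ℓ + 2) * f t -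
      B t * W (m * expU (t • dilation n)) j.succ) t := fun t => by
    refine (hasDerivAt_coord hW.smooth m (dilation n) t j.castSucc).congr_deriv ?_
    rw [hW.dilation_succ (hm.mul_dilation t) j, hBt, hj]
    simp only [hf]; ring
  have hk0 : ∀ t, HasDerivAt (fun t => kap 0 (B t)) (-(B t * kap 1 (B t))) t := fun t => by
    refine (hasDerivAt_kap 0 (hBd t) (hB0 t)).congr_deriv ?_
    have := kap_recurrence 0 (hB0 t)
    simp only [zero_add, zero_sub, Int.cast_zero, mul_zero, zero_mul] at this ⊢
    linear_combination (1 / 2) * this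
  have hed : ∀ t : ℝ, HasDerivAt (fun t : ℝ => ((Real.exp (-(2 * ℓ + 2) * t) : ℝ) : ℂ))
      (-(2 * ℓ + 2) * ((Real.exp (-(2 * ℓ + 2) * t) : ℝ) : ℂ)) t := fun t => by
    have h1 : HasDerivAt (fun t : ℝ => -(2 * (ℓ : ℝ) + 2) * t) (-(2 * ℓ + 2)) t := by
      simpa using (hasDerivAt_id t).const_mul (-(2 * (ℓ : ℝ) + 2))
    refine (h1.exp.ofReal_comp).congr_deriv ?_
    push_cast; ring
  have hqd : ∀ t, HasDerivAt (fun t => ((Real.exp (-(2 * ℓ + 2) * t) : ℝ) : ℂ) * f t /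
      kap 0 (B t)) 0 t := fun t => by
    refine (((hed t).mul (hfd t)).div (hk0 t) (kap_ne_zero 0 (hB0 t))).congr_deriv ?_
    have h1 := hW.mul_kap_eq hT (hm.mul_dilation t) (by rw [hBt]; exact hB0 t) hj
    rw [hBt] at h1
    change f t * _ = _ at h1
    rw [div_eq_zero_iff]
    left
    simp only [Pi.mul_apply]
    linear_combination ((Real.exp (-(2 * ℓ + 2) * t) : ℝ) : ℂ) * B t * h1
  have := is_const_of_deriv_eq_zero (fun t => (hqd t).differentiableAt) (fun t => (hqd t).deriv) t 0
  have hf0 : f 0 = 0 := by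
    simp only [hf, zero_smul, expU_zero, mul_one]; exact h0
  rw [hf0, mul_zero, zero_div, div_eq_zero_iff] at this
  rcases this with h | h
  · exact (mul_eq_zero.1 h).resolve_left (by exact_mod_cast (Real.exp_pos _).ne')
  · exact absurd h (kap_ne_zero 0 (hB0 t))

/-- Along a boost the quotient of the middle coefficient by the Bessel solution is constant. -/
theorem IsWhittaker.hasDerivAt_boost_quotient (hT : T ∈ V0 n) {m : U n} {z : ℂˣ} (hm : IsLevi m z)
    {y : Vec n} (hy : y ∈ V0 n) (hy1 : y (Sum.inl 1) = 0) (s : ℝ)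
    (hb : beta T (m * expU (s • skewTens (uVec n 1) y)) z ≠ 0)
    {i j : Fin (2 * ℓ)} (hij : i.succ = j.castSucc) (hj : (j : ℕ) = ℓ) :
    HasDerivAt (fun s : ℝ => W (m * expU (s • skewTens (uVec n 1) y)) j.castSucc /
      kap 0 (beta T (m * expU (s • skewTens (uVec n 1) y)) z)) 0 s := by
  have hms := hm.mul_smul_skewTens (uVec_one_mem_V0 (n := n)) hy s
  have h1 := hasDerivAt_coord hW.smooth m (skewTens (uVec n 1) y) s j.castSucc
  rw [hW.lieDeriv_boost hms hy hy1 hij] at h1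
  have h2 := hasDerivAt_pairing T m z (skewTens (uVec n 1) y) (uVec n 1) s
  have e : ∀ m : U n, pairing T m z (-y) = -pairing T m z y := fun m => by
    rw [← neg_one_smul ℂ, pairing_smul, neg_one_mul]
  rw [uVec_one_boost hy1, e, neg_neg] at h2
  have h3 := hasDerivAt_kap 0 h2 hb
  refine (h1.div h3 (kap_ne_zero 0 hb)).congr_deriv ?_
  have e1 := hW.mul_kap_eq hT hms hb hj
  have e2 := hW.mul_kap_neg_eq hT hms hb hij hj
  rw [div_eq_zero_iff]
  left
  simp only [zero_add, zero_sub]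
  rw [beta_eq_pairing] at e1 e2
  linear_combination (1 / 2) * pairing T (m * expU (s • skewTens (uVec n 1) y)) z y * e1 +
    (1 / 2) * conj (pairing T (m * expU (s • skewTens (uVec n 1) y)) z y) * e2

/-- A Whittaker function vanishing on boosts times dilations vanishes. -/
theorem IsWhittaker.eq_zero_of_boost
    (h : ∀ y ∈ V0 n, y (Sum.inl 1) = 0 → ∀ t : ℝ,
      W (expU (skewTens (uVec n 1) y) * expU (t • dilation n)) = 0) : W = 0 := by
  funext g
  obtain ⟨w, hw, t, y, hy, hy1, s, k, hk, he⟩ := exists_decomposition g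
  have h1 := hW.character w hw t (g * k)
  rw [he, h y hy hy1 s] at h1
  have h2 : W (g * k) = 0 :=
    (smul_eq_zero.1 h1.symm).resolve_left (Complex.exp_ne_zero _)
  have h3 := (isActK_iff _ _ _).1 (hW.equivariant k⁻¹ (KInf_inv_mem hk) (g * k))
  rw [mul_inv_cancel_right, h2] at h3
  refine formEval_injective fun u => ?_
  rw [h3 u, formEval_zero, mul_zero, Pi.zero_apply, formEval_zero]

omit hW in
theorem beta_ne_zero_iff {m : U n} {z : ℂˣ} : beta T m z ≠ 0 ↔ act T m (Sum.inl 1) ≠ 0 := by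
  rw [beta, herm_smul_right, ← herm_conj, herm_uVec]
  simp

omit hW in
theorem beta_ne_zero (hT : T ∈ V0 n) (hT0 : T ≠ 0) (hpos : 0 ≤ (herm T T).re) {m : U n} {z : ℂˣ}
    (hm : IsLevi m z) : beta T m z ≠ 0 := by
  rw [beta_ne_zero_iff]
  intro h0
  have h1 : act T m = 0 := vec_eq_zero_of_herm ((mem_V0_iff _).1 (hm.act_mem_V0 hT)).1 h0
    (by rw [herm_act]; exact hpos)
  apply hT0
  rw [← act_act_inv T m, h1, act, Matrix.zero_vecMul]

/-- Uniqueness for non-negative `T`. -/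
theorem IsWhittaker.eq_zero_of_nonneg (hℓ : 1 ≤ ℓ) (hT : T ∈ V0 n) (hT0 : T ≠ 0)
    (hpos : 0 ≤ (herm T T).re) (h1 : W 1 ⟨ℓ, by omega⟩ = 0) : W = 0 := by
  set i : Fin (2 * ℓ) := ⟨ℓ - 1, by omega⟩
  set j : Fin (2 * ℓ) := ⟨ℓ, by omega⟩
  have hij : i.succ = j.castSucc := Fin.ext (by simp [i, j]; omega)
  refine hW.eq_zero_of_boost fun y hy hy1 t => ?_
  have hL : ∀ s : ℝ, IsLevi (1 * expU (s • skewTens (uVec n 1) y)) 1 := fun s =>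
    isLevi_one.mul_smul_skewTens (uVec_one_mem_V0 (n := n)) hy s
  have hd := fun s : ℝ => hW.hasDerivAt_boost_quotient hT isLevi_one hy hy1 s
    (beta_ne_zero hT hT0 hpos (hL s)) hij rfl
  have hc := is_const_of_deriv_eq_zero (fun t => (hd t).differentiableAt)
    (fun t => (hd t).deriv) 1 0
  have hb := beta_ne_zero hT hT0 hpos (hL 1)
  have hmid : W (1 * expU ((1 : ℝ) • skewTens (uVec n 1) y)) j.castSucc = 0 := by
    rw [zero_smul, expU_zero, mul_one, show j.castSucc = ⟨ℓ, by omega⟩ from rfl, h1, zero_div,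
      div_eq_zero_iff] at hc
    exact hc.resolve_right (kap_ne_zero 0 hb)
  have := hW.eq_zero_on_line hT (hL 1) hb j.castSucc
    (fun t => hW.mid_eq_zero_dilation hT (hL 1) hb rfl hmid t) t
  rwa [one_mul, one_smul] at this

omit hW in
theorem beta_boost {m : U n} {z : ℂˣ} {y : Vec n} (hy1 : y (Sum.inl 1) = 0)
    (hyy : herm y y = -1) (s : ℝ) :
    beta T (m * expU (s • skewTens (uVec n 1) y)) z =
      ((Real.cosh s : ℝ) : ℂ) * beta T m z + ((Real.sinh s : ℝ) : ℂ) * pairing T m z y := by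
  have h := act_uVec_one_boost hy1 hyy (-s)
  rw [expU_neg_smul, Real.cosh_neg, Real.sinh_neg] at h
  rw [beta_eq_pairing, beta_eq_pairing, pairing, act_mul, ← act_smul, herm_act_right, h, pairing,
    pairing, herm_sub_left, herm_smul_left, herm_smul_left]
  push_cast
  ring

omit hW in
theorem exists_unit_boost {x : Vec n} (hx : x ∈ V0 n) (hneg : (herm x x).re < 0) :
    ∃ (y : Vec n) (q : ℝ), y ∈ V0 n ∧ y (Sum.inl 1) = 0 ∧ herm y y = -1 ∧
      ‖x (Sum.inl 1)‖ < q ∧ herm x y = -q := by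
  set c := x (Sum.inl 1) with hc
  set y' := x - c • uVec n 1 with hy'
  have hyV : y' ∈ V0 n := Submodule.sub_mem _ hx (Submodule.smul_mem _ _ uVec_one_mem_V0)
  have hy1 : y' (Sum.inl 1) = 0 := by simp [hy', uVec, hc]
  have hxe : x = c • uVec n 1 + y' := by rw [hy']; abel
  have hyu : herm y' (uVec n 1) = 0 := by rw [herm_uVec, hy1]
  have hxx2 : herm x x = (‖c‖ ^ 2 : ℝ) + herm y' y' := by
    conv_lhs => rw [hxe, herm_add_left, herm_add_right, herm_add_right, herm_smul_left,
      herm_smul_left, herm_smul_right, herm_smul_right, hyu, herm_swap_eq_zero hyu, herm_uVec_self]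
    push_cast
    rw [← Complex.mul_conj']
    ring
  have hre : (herm x x).re = ‖c‖ ^ 2 + (herm y' y').re := by
    rw [hxx2, Complex.add_re, Complex.ofReal_re]
  set ρ := Real.sqrt (-(herm y' y').re) with hρ
  have hρ2 : ρ ^ 2 = -(herm y' y').re := Real.sq_sqrt (by nlinarith [sq_nonneg ‖c‖])
  have hcρ : ‖c‖ < ρ := by
    refine lt_of_pow_lt_pow_left₀ 2 (Real.sqrt_nonneg _) ?_
    rw [hρ2]; linarith
  have hρp : 0 < ρ := (norm_nonneg c).trans_lt hcρ
  have e : herm y' y' = ((-ρ ^ 2 : ℝ) : ℂ) := by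
    rw [hρ2, neg_neg]
    exact Complex.ext (by simp) (by simp [herm_self_im])
  have hρC : (ρ : ℂ) ≠ 0 := by exact_mod_cast hρp.ne'
  refine ⟨((ρ⁻¹ : ℝ) : ℂ) • y', ρ, Submodule.smul_mem _ _ hyV, by rw [Pi.smul_apply, hy1, smul_zero],
    ?_, hcρ, ?_⟩
  · rw [herm_smul_left, herm_smul_right, e, Complex.conj_ofReal]
    push_cast
    field_simp
  · rw [herm_smul_right, hxe, herm_add_left, herm_smul_left, herm_swap_eq_zero hyu, e,
      Complex.conj_ofReal]
    push_cast
    field_simp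
    ring

omit hW in
theorem pairing_eq_of_herm {m : U n} {y : Vec n} {q : ℝ} {d : ℂ} (h : herm (act T m) y = -q) :
    pairing T m 1 (d • y) = -((4 * Real.pi / Real.sqrt 2 : ℝ) : ℂ) * d * q := by
  rw [pairing_smul, pairing, Units.val_one, one_smul, ← herm_conj, h]
  simp
  ring

/-- For negative `T`, the Bessel solutions blow up along a boost. -/
theorem IsWhittaker.mid_eq_zero_of_neg (hT : T ∈ V0 n) (hneg : (herm T T).re < 0) {m : U n}
    (hm : IsLevi m 1) (hb : beta T m 1 ≠ 0)
    {i j : Fin (2 * ℓ)} (hij : i.succ = j.castSucc) (hj : (j : ℕ) = ℓ) :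
    W m j.castSucc = 0 := by
  set x := act T m with hx
  set c := x (Sum.inl 1) with hc
  have hc0 : c ≠ 0 := beta_ne_zero_iff.1 hb
  have hcn : 0 < ‖c‖ := norm_pos_iff.2 hc0
  obtain ⟨y', q, hyV', hy1', hyy', hcq, hxy'⟩ := exists_unit_boost (hm.act_mem_V0 hT)
    (by rw [herm_act]; exact hneg)
  set l : ℂ := conj c / (‖c‖ : ℝ) with hl
  have hln : ‖l‖ = 1 := by
    rw [hl, norm_div, Complex.norm_real, norm_norm, Complex.norm_conj, div_self hcn.ne']
  set y := l • y' with hy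
  have hyV : y ∈ V0 n := Submodule.smul_mem _ _ hyV'
  have hy1 : y (Sum.inl 1) = 0 := by rw [hy, Pi.smul_apply, hy1', smul_zero]
  have hyy : herm y y = -1 := by
    rw [hy, herm_smul_left, herm_smul_right, hyy', ← mul_assoc, Complex.mul_conj', hln]
    simp
  set Q := q / ‖c‖ with hQ
  have hQ1 : 1 < Q := (one_lt_div hcn).2 hcq
  set X := skewTens (uVec n 1) y with hX
  have hbs : ∀ s : ℝ, beta T (m * expU (s • X)) 1 =
      ((Real.cosh s - Q * Real.sinh s : ℝ) : ℂ) * beta T m 1 := by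
    intro s
    rw [beta_boost hy1 hyy, hy, pairing_eq_of_herm hxy', beta, Units.val_one, one_smul,
      ← herm_conj, herm_uVec, hl]
    have hcC : ((‖c‖ : ℝ) : ℂ) ≠ 0 := by exact_mod_cast hcn.ne'
    change _ + _ * (_ * (conj c / _) * _) = _ * (_ * conj c)
    rw [hQ]
    push_cast
    field_simp
    ring
  set s₀ := Real.log ((Q + 1) / (Q - 1)) / 2 with hs₀
  have hfrac : 1 < (Q + 1) / (Q - 1) := by
    rw [lt_div_iff₀ (by linarith)]; linarith
  have hs₀p : 0 < s₀ := by
    rw [hs₀]; exact div_pos (Real.log_pos hfrac) two_pos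
  have hform : ∀ s : ℝ, Real.cosh s - Q * Real.sinh s =
      Real.exp (-s) * (Q - 1) / 2 * ((Q + 1) / (Q - 1) - Real.exp (2 * s)) := by
    intro s
    have : Real.exp (2 * s) = Real.exp s * Real.exp s := by rw [← Real.exp_add]; ring_nf
    have h1 : Real.exp (-s) * Real.exp s = 1 := by rw [← Real.exp_add]; simp
    have h2 : (Q + 1) / (Q - 1) * (Q - 1) = Q + 1 := div_mul_cancel₀ _ (by linarith)
    rw [this, Real.cosh_eq, Real.sinh_eq]
    linear_combination (Q - 1) * Real.exp s / 2 * h1 - Real.exp (-s) / 2 * h2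
  have hlt : ∀ s < s₀, Real.cosh s - Q * Real.sinh s ≠ 0 := by
    intro s hs
    rw [hform]
    have : Real.exp (2 * s) < (Q + 1) / (Q - 1) := by
      rw [← Real.lt_log_iff_exp_lt (by linarith)]
      rw [hs₀] at hs; linarith
    exact (mul_pos (div_pos (mul_pos (Real.exp_pos _) (by linarith)) two_pos) (by linarith)).ne'
  have hzero : Real.cosh s₀ - Q * Real.sinh s₀ = 0 := by
    rw [hform, hs₀, mul_div_cancel₀ _ (two_ne_zero), Real.exp_log (by linarith), sub_self, mul_zero]
  have hbne : ∀ s < s₀, beta T (m * expU (s • X)) 1 ≠ 0 := fun s hs => by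
    rw [hbs]
    exact mul_ne_zero (by exact_mod_cast hlt s hs) hb
  set C := W m j.castSucc / kap 0 (beta T m 1) with hCdef
  by_contra hne
  have hC0 : C ≠ 0 := div_ne_zero hne (kap_ne_zero 0 hb)
  have hconst : ∀ s, 0 ≤ s → s < s₀ → W (m * expU (s • X)) j.castSucc =
      C * kap 0 (beta T (m * expU (s • X)) 1) := by
    intro s hs hss
    have hd : ∀ r < s₀, _ := fun r hr =>
      hW.hasDerivAt_boost_quotient hT hm hyV hy1 r (hbne r hr) hij hj
    have := constant_of_has_deriv_right_zero (a := 0) (b := s)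
      (f := fun s : ℝ => W (m * expU (s • X)) j.castSucc / kap 0 (beta T (m * expU (s • X)) 1))
      (fun r hr => (hd r (hr.2.trans_lt hss)).continuousAt.continuousWithinAt)
      (fun r hr => (hd r (hr.2.trans hss)).hasDerivWithinAt) s ⟨hs, le_rfl⟩
    simp only [zero_smul, expU_zero, mul_one] at this
    rw [← hCdef] at this
    rw [← this, div_mul_cancel₀ _ (kap_ne_zero 0 (hbne s hss))]
  have hup : ∀ s, 0 ≤ s → s < s₀ → W (m * expU (s • X)) j.succ =
      C * kap 1 (beta T (m * expU (s • X)) 1) := by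
    intro s hs hss
    have h1 := hW.mul_kap_eq hT (hm.mul_smul_skewTens (uVec_one_mem_V0 (n := n)) hyV s)
      (hbne s hss) hj
    rw [← hX, hconst s hs hss] at h1
    refine mul_right_cancel₀ (kap_ne_zero 0 (hbne s hss)) ?_
    rw [← h1]; ring
  set β := fun s : ℝ => ‖beta T (m * expU (s • X)) 1‖ with hβ
  have hβc : Continuous β := by
    have e : β = fun s : ℝ => ‖((Real.cosh s - Q * Real.sinh s : ℝ) : ℂ) * beta T m 1‖ := by
      funext s; rw [hβ]; simp only; rw [hbs]
    rw [e]
    have := Real.continuous_cosh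
    have := Real.continuous_sinh
    fun_prop
  have hβ0 : β s₀ = 0 := by simp only [hβ, hbs, hzero]; simp
  have hWc : ContinuousAt (fun s : ℝ => W (m * expU (s • X)) j.succ) s₀ :=
    (hasDerivAt_coord hW.smooth m X s₀ j.succ).continuousAt
  have hl1 : Filter.Tendsto (fun s => β s * ‖W (m * expU (s • X)) j.succ‖ - ‖C‖ * Real.exp (-β s))
      (𝓝[<] s₀) (𝓝 (0 - ‖C‖ * Real.exp (-0))) := by
    have h1 : ContinuousAt (fun s => β s * ‖W (m * expU (s • X)) j.succ‖ -
        ‖C‖ * Real.exp (-β s)) s₀ :=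
      (hβc.continuousAt.mul hWc.norm).sub
        (continuousAt_const.mul (Real.continuous_exp.continuousAt.comp hβc.continuousAt.neg))
    have h2 := h1.tendsto.mono_left (nhdsWithin_le_nhds (s := Set.Iio s₀))
    rwa [hβ0, zero_mul] at h2
  have hge : (0 : ℝ) ≤ 0 - ‖C‖ * Real.exp (-0) := by
    refine ge_of_tendsto hl1 ?_
    filter_upwards [self_mem_nhdsWithin, nhdsWithin_le_nhds (Ioi_mem_nhds hs₀p)] with s hs hs'
    have hs1 : s < s₀ := hs
    have hs2 : 0 < s := hs'
    have hβp : 0 < β s := norm_pos_iff.2 (hbne s hs1)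
    rw [hup s hs2.le hs1, norm_mul, norm_kap 1 (hbne s hs1)]
    have h1 := exp_div_le_besselK_one hβp
    rw [div_le_iff₀ hβp] at h1
    have := mul_le_mul_of_nonneg_left h1 (norm_nonneg C)
    change 0 ≤ β s * (‖C‖ * besselK 1 (β s)) - _
    linarith
  have : 0 < ‖C‖ := norm_pos_iff.2 hC0
  rw [neg_zero, Real.exp_zero] at hge
  linarith

/-- Vanishing for negative `T`. -/
theorem IsWhittaker.eq_zero_of_neg (hℓ : 1 ≤ ℓ) (hT : T ∈ V0 n) (hneg : (herm T T).re < 0) :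
    W = 0 := by
  set i : Fin (2 * ℓ) := ⟨ℓ - 1, by omega⟩
  set j : Fin (2 * ℓ) := ⟨ℓ, by omega⟩
  have hij : i.succ = j.castSucc := Fin.ext (by simp [i, j]; omega)
  have hline : ∀ m : U n, IsLevi m 1 → beta T m 1 ≠ 0 → ∀ t : ℝ,
      W (m * expU (t • dilation n)) = 0 := fun m hm hb t =>
    hW.eq_zero_on_line hT hm hb j.castSucc
      (hW.mid_eq_zero_dilation hT hm hb rfl (hW.mid_eq_zero_of_neg hT hneg hm hb hij rfl)) t
  refine hW.eq_zero_of_boost fun y₀ hy₀ hy₀1 t => ?_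
  set m := expU (skewTens (uVec n 1) y₀) with hm_def
  have hm : IsLevi m 1 := by
    have := isLevi_one.mul_skewTens (uVec_one_mem_V0 (n := n)) hy₀
    rwa [one_mul] at this
  by_cases hb : beta T m 1 = 0
  · obtain ⟨y, q, hyV, hy1, hyy, hcq, hxy⟩ := exists_unit_boost (hm.act_mem_V0 hT)
      (by rw [herm_act]; exact hneg)
    have hq : 0 < q := (norm_nonneg _).trans_lt hcq
    set X := skewTens (uVec n 1) y with hX
    have hbs : ∀ s : ℝ, s ≠ 0 → beta T (m * expU (s • X)) 1 ≠ 0 := by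
      intro s hs
      have h1 := pairing_eq_of_herm (d := 1) hxy
      rw [one_smul] at h1
      rw [beta_boost hy1 hyy, hb, h1, mul_zero, zero_add]
      have h2 : ((4 * Real.pi / Real.sqrt 2 : ℝ) : ℂ) ≠ 0 := by
        exact_mod_cast (by positivity : (4 * Real.pi / Real.sqrt 2 : ℝ) ≠ 0)
      refine mul_ne_zero ?_ (mul_ne_zero (mul_ne_zero (neg_ne_zero.2 h2) one_ne_zero) ?_)
      · exact_mod_cast Real.sinh_eq_zero.not.2 hs
      · exact_mod_cast hq.ne'
    have hcomm : ∀ s : ℝ, m * expU (s • X) * expU (t • dilation n) =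
        m * expU (t • dilation n) * expU (s • X) := by
      intro s
      have hL : IsLevi (expU (s • X)) 1 := by
        have := isLevi_one.mul_smul_skewTens (uVec_one_mem_V0 (n := n)) hyV s
        rwa [one_mul] at this
      rw [mul_assoc, hL.commute_dilation, mul_assoc]
    have hc := (hW.smooth.hasDerivAt_path (m * expU (t • dilation n)) X 0).continuousAt
    have h0 : ∀ s : ℝ, s ≠ 0 → W (m * expU (t • dilation n) * expU (s • X)) = 0 := fun s hs => by
      rw [← hcomm]
      exact hline _ (hm.mul_smul_skewTens (uVec_one_mem_V0 (n := n)) hyV s) (hbs s hs) t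
    have hl := hc.tendsto.mono_left (nhdsWithin_le_nhds (s := {0}ᶜ))
    have hl2 : Filter.Tendsto (fun s : ℝ => W (m * expU (t • dilation n) * expU (s • X)))
        (𝓝[≠] 0) (𝓝 0) := by
      refine tendsto_const_nhds.congr' ?_
      filter_upwards [self_mem_nhdsWithin] with s hs
      exact (h0 s hs).symm
    have := tendsto_nhds_unique hl hl2
    rwa [zero_smul, expU_zero, mul_one] at this
  · exact hline m hm hb t

end Uniqueness

end

end QWhittaker

namespace QWhittaker

noncomputable section

/-! ### The explicit Whittaker function -/

variable {n ℓ : ℕ}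

/-- The squared length of a pair of complex numbers. -/
def sqLen (A : Fin 2 → ℂ) : ℝ := Complex.normSq (A 0) + Complex.normSq (A 1)

/-- The parameter of the Bessel functions at the pair of projections `A`, `B` of `b₁ g`, `T g`. -/
def whitBeta (A B : Fin 2 → ℂ) : ℂ :=
  2 * Real.pi * conj (A 0 * B 1 - A 1 * B 0) / (sqLen A : ℂ)

/-- The scalar factor of the explicit Whittaker function. -/
def whitScalar (ℓ : ℕ) (A B : Fin 2 → ℂ) : ℂ :=
  ((2 ^ (ℓ + 1) * sqLen A ^ (2 * ℓ + 1) : ℝ) : ℂ)⁻¹ *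
    Complex.exp (2 * Real.pi * Complex.I *
      (((B 0 * conj (A 0) + B 1 * conj (A 1)) / (sqLen A : ℂ)).im : ℂ))

/-- The vector of Bessel coefficients. -/
def kapVec (ℓ : ℕ) (b : ℂ) : VEll ℓ := fun a => kap ((a : ℤ) - (ℓ : ℤ)) b

/-- The explicit Whittaker function in terms of the projections of `b₁ g` and `T g` to `V₂⁺`. -/
def whitPair (ℓ : ℕ) (A B : Fin 2 → ℂ) : VEll ℓ :=
  whitScalar ℓ A B • (exists_formEval_comp (kapVec ℓ (whitBeta A B))
    (A 0) (A 1) (-conj (A 1)) (conj (A 0))).choose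

theorem formEval_whitPair (A B : Fin 2 → ℂ) (u : Fin 2 → ℂ) :
    formEval (whitPair ℓ A B) u = whitScalar ℓ A B * formEval (kapVec ℓ (whitBeta A B))
      ![A 0 * u 0 + A 1 * u 1, -conj (A 1) * u 0 + conj (A 0) * u 1] := by
  rw [whitPair, formEval_smul, (exists_formEval_comp (kapVec ℓ (whitBeta A B))
    (A 0) (A 1) (-conj (A 1)) (conj (A 0))).choose_spec]

/-- The projection to `V₂⁺`. -/
def projTwo (x : Vec n) : Fin 2 → ℂ := fun j => x (Sum.inl j)

/-- The explicit Whittaker function. -/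
def whit (ℓ : ℕ) [NeZero n] (T : Vec n) (g : U n) : VEll ℓ :=
  whitPair ℓ (projTwo (act (b1 n) g)) (projTwo (act T g))

theorem sqLen_nonneg (A : Fin 2 → ℂ) : 0 ≤ sqLen A :=
  add_nonneg (Complex.normSq_nonneg _) (Complex.normSq_nonneg _)

theorem coe_sqLen (A : Fin 2 → ℂ) : (sqLen A : ℂ) = A 0 * conj (A 0) + A 1 * conj (A 1) := by
  rw [sqLen, Complex.ofReal_add, Complex.mul_conj, Complex.mul_conj]

/-! ### Equivariance -/

theorem whitPair_sub_smul {A B : Fin 2 → ℂ} (hA : 0 < sqLen A) (c : ℂ) :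
    whitPair ℓ A (B - c • A) =
      Complex.exp (-2 * Real.pi * Complex.I * (c.im : ℂ)) • whitPair ℓ A B := by
  have hA' : (sqLen A : ℂ) ≠ 0 := by exact_mod_cast hA.ne'
  have h1 : whitBeta A (B - c • A) = whitBeta A B := by
    simp only [whitBeta, Pi.sub_apply, Pi.smul_apply, smul_eq_mul]
    congr 3; ring
  have h2 : whitScalar ℓ A (B - c • A) =
      Complex.exp (-2 * Real.pi * Complex.I * (c.im : ℂ)) * whitScalar ℓ A B := by
    have e : ((B - c • A) 0 * conj (A 0) + (B - c • A) 1 * conj (A 1)) / (sqLen A : ℂ) =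
        (B 0 * conj (A 0) + B 1 * conj (A 1)) / (sqLen A : ℂ) - c := by
      rw [div_sub' hA', coe_sqLen]
      simp only [Pi.sub_apply, Pi.smul_apply, smul_eq_mul]
      congr 1; ring
    rw [whitScalar, whitScalar, e, mul_left_comm, ← Complex.exp_add, Complex.sub_im,
      Complex.ofReal_sub]
    congr 2; ring
  refine formEval_injective fun u => ?_
  rw [formEval_smul, formEval_whitPair, formEval_whitPair, h1, h2, mul_assoc]

theorem kapVec_mul {b d : ℂ} (hd : ‖d‖ = 1) (a : Fin (2 * ℓ + 1)) :
    kapVec ℓ (conj d * b) a = d ^ ((a : ℤ) - (ℓ : ℤ)) * kapVec ℓ b a := by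
  have hd0 : d ≠ 0 := fun h => by simp [h] at hd
  have e : conj d = d⁻¹ := by
    rw [Complex.inv_def, Complex.normSq_eq_norm_sq, hd]; simp
  rw [kapVec, kapVec, kap, kap, norm_mul, RCLike.norm_conj, hd, one_mul, ← mul_assoc, ← mul_zpow]
  congr 2
  rw [e]; field_simp

theorem whitPair_vecMul {A B : Fin 2 → ℂ} {k : Matrix (Fin 2) (Fin 2) ℂ} (hk : k * kᴴ = 1)
    (u : Fin 2 → ℂ) :
    formEval (whitPair ℓ (A ᵥ* k) (B ᵥ* k)) u =
      (k.det ^ ℓ)⁻¹ * formEval (whitPair ℓ A B) (k *ᵥ u) := by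
  have hdet : k.det * conj k.det = 1 := by
    have := congrArg Matrix.det hk
    rwa [Matrix.det_mul, Matrix.det_conjTranspose, Matrix.det_one] at this
  have hd : ‖k.det‖ = 1 := by
    rw [Complex.mul_conj'] at hdet
    have : ‖k.det‖ ^ 2 = 1 := by exact_mod_cast hdet
    exact (pow_eq_one_iff_of_nonneg (norm_nonneg _) two_ne_zero).1 this
  have hd0 : k.det ≠ 0 := fun h => by simp [h] at hd
  have hadj : k.det • kᴴ = k.adjugate := by
    have := congrArg (k.adjugate * ·) hk
    simpa [← mul_assoc, Matrix.adjugate_mul] using this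
  have hU' := mul_eq_one_comm.1 hk
  have r : ∀ i j, k.det * conj (k j i) = k.adjugate i j := fun i j => by
    rw [← hadj]; simp
  have r00 := r 0 0
  have r01 := r 0 1
  have r10 := r 1 0
  have r11 := r 1 1
  simp [Matrix.adjugate_fin_two] at r00 r01 r10 r11
  have q00 := congrFun (congrFun hk 0) 0
  have q01 := congrFun (congrFun hk 0) 1
  have q10 := congrFun (congrFun hk 1) 0
  have q11 := congrFun (congrFun hk 1) 1
  simp [Matrix.mul_apply, Fin.sum_univ_two] at q00 q01 q10 q11
  have hin : ∀ B : Fin 2 → ℂ, (B ᵥ* k) 0 * conj ((A ᵥ* k) 0) + (B ᵥ* k) 1 * conj ((A ᵥ* k) 1) =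
      B 0 * conj (A 0) + B 1 * conj (A 1) := fun B => by
    simp only [Matrix.vecMul, dotProduct, Fin.sum_univ_two, map_add, map_mul]
    linear_combination B 0 * conj (A 0) * q00 + B 0 * conj (A 1) * q01 +
      B 1 * conj (A 0) * q10 + B 1 * conj (A 1) * q11
  have hlen : sqLen (A ᵥ* k) = sqLen A := by
    have : (sqLen (A ᵥ* k) : ℂ) = sqLen A := by rw [coe_sqLen, coe_sqLen, hin]
    exact_mod_cast this
  have hs : whitScalar ℓ (A ᵥ* k) (B ᵥ* k) = whitScalar ℓ A B := by
    rw [whitScalar, whitScalar, hin, hlen]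
  have hb : whitBeta (A ᵥ* k) (B ᵥ* k) = conj k.det * whitBeta A B := by
    rw [whitBeta, whitBeta, hlen]
    have : (A ᵥ* k) 0 * (B ᵥ* k) 1 - (A ᵥ* k) 1 * (B ᵥ* k) 0 =
        k.det * (A 0 * B 1 - A 1 * B 0) := by
      simp only [Matrix.vecMul, dotProduct, Fin.sum_univ_two, Matrix.det_fin_two]
      ring
    rw [this, map_mul]; ring
  rw [formEval_whitPair, formEval_whitPair, hs, hb, mul_left_comm]
  congr 1
  have h0 : (A ᵥ* k) 0 * u 0 + (A ᵥ* k) 1 * u 1 = A 0 * (k *ᵥ u) 0 + A 1 * (k *ᵥ u) 1 := by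
    simp only [Matrix.vecMul, Matrix.mulVec, dotProduct, Fin.sum_univ_two]; ring
  have h1 : -conj (A 1) * (k *ᵥ u) 0 + conj (A 0) * (k *ᵥ u) 1 =
      k.det * (-conj ((A ᵥ* k) 1) * u 0 + conj ((A ᵥ* k) 0) * u 1) := by
    simp only [Matrix.vecMul, Matrix.mulVec, dotProduct, Fin.sum_univ_two, map_add, map_mul]
    linear_combination conj (A 0) * u 0 * r10 + conj (A 1) * u 0 * r11 - conj (A 0) * u 1 * r00 -
      conj (A 1) * u 1 * r01
  rw [h0, h1]
  generalize A 0 * (k *ᵥ u) 0 + A 1 * (k *ᵥ u) 1 = p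
  generalize -conj ((A ᵥ* k) 1) * u 0 + conj ((A ᵥ* k) 0) * u 1 = q
  rw [formEval, formEval, Finset.mul_sum]
  refine Finset.sum_congr rfl fun a _ => ?_
  rw [kapVec_mul hd, zpow_sub₀ hd0]
  simp only [Matrix.cons_val_zero, Matrix.cons_val_one, zpow_natCast, mul_pow]
  ring

theorem toBlocks_mul_conjTranspose {k : U n} (hk : k ∈ KInf n) :
    (toMat k).toBlocks₁₁ * (toMat k).toBlocks₁₁ᴴ = 1 := by
  ext i j
  have h := herm_act (uVec n i) (uVec n j) k
  have h12 := hk.1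
  have e : ∀ i x, act (uVec n i) k x = toMat k (Sum.inl i) x := fun i x => by
    simp [act, uVec]
  have e0 : ∀ i x, toMat k (Sum.inl i) (Sum.inr x) = 0 := fun i x => congrFun (congrFun h12 i) x
  rw [herm] at h
  simp only [e, e0, zero_mul, Finset.sum_const_zero, sub_zero] at h
  rw [Matrix.mul_apply, Matrix.one_apply]
  simp only [Matrix.conjTranspose_apply, Matrix.toBlocks₁₁, Matrix.of_apply]
  refine h.trans ?_
  simp [herm, uVec, Pi.single_apply, eq_comm]

theorem projTwo_act {k : U n} (hk : k ∈ KInf n) (x : Vec n) :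
    projTwo (act x k) = projTwo x ᵥ* (toMat k).toBlocks₁₁ := by
  have e0 : ∀ i x, toMat k (Sum.inr i) (Sum.inl x) = 0 := fun i x => congrFun (congrFun hk.2 i) x
  funext j
  simp [projTwo, act, Matrix.vecMul, dotProduct, Fintype.sum_sum_type, e0, Matrix.toBlocks₁₁]

variable [NeZero n]

theorem whit_equivariant (T : Vec n) {k : U n} (hk : k ∈ KInf n) (g : U n) :
    IsActK k (whit ℓ T g) (whit ℓ T (g * k)) := by
  rw [isActK_iff]
  intro u
  rw [whit, act_mul, act_mul, projTwo_act hk, projTwo_act hk]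
  exact whitPair_vecMul (toBlocks_mul_conjTranspose hk) u

theorem whit_character {T : Vec n} (hT : T ∈ V0 n) {w : Vec n} (hw : w ∈ V0 n) (t : ℝ) (g : U n)
    (hA : 0 < sqLen (projTwo (act (b1 n) g))) :
    whit ℓ T (heis w t * g) =
      Complex.exp (-2 * Real.pi * Complex.I * ((herm T w).im : ℂ)) • whit ℓ T g := by
  rw [whit, act_mul, act_mul, act_b1_heis hw, act_V0_heis hw t hT, act_sub, act_smul]
  exact whitPair_sub_smul hA _

/-! ### Bounds -/

omit [NeZero n] in
theorem sum_norm_toMat_le_height (g : U n) (j : Idx n) : ∑ i, ‖toMat g i j‖ ≤ height g := by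
  refine Finset.sum_le_sum fun i _ => ?_
  exact (le_add_of_nonneg_right (norm_nonneg _)).trans
    (Finset.single_le_sum (f := fun j => ‖toMat g i j‖ + ‖toMat g⁻¹ i j‖)
      (fun _ _ => by positivity) (Finset.mem_univ j))

omit [NeZero n] in
theorem norm_act_le {x : Vec n} {r : ℝ} (hx : ∀ i, ‖x i‖ ≤ r) (g : U n) (j : Idx n) :
    ‖act x g j‖ ≤ r * height g := by
  have hr : 0 ≤ r := (norm_nonneg _).trans (hx j)
  calc ‖act x g j‖ ≤ ∑ i, ‖x i * toMat g i j‖ := by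
        rw [act, Matrix.vecMul, dotProduct]; exact norm_sum_le _ _
    _ ≤ ∑ i, r * ‖toMat g i j‖ := Finset.sum_le_sum fun i _ => by
        rw [norm_mul]; exact mul_le_mul_of_nonneg_right (hx i) (norm_nonneg _)
    _ = r * ∑ i, ‖toMat g i j‖ := (Finset.mul_sum _ _ _).symm
    _ ≤ _ := mul_le_mul_of_nonneg_left (sum_norm_toMat_le_height g j) hr

omit [NeZero n] in
theorem norm_sq_le_sqLen {x : Vec n} (hx : 0 ≤ (herm x x).re) (i : Idx n) :
    ‖x i‖ ^ 2 ≤ sqLen (projTwo x) := by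
  rw [herm_self_re] at hx
  simp only [Fin.sum_univ_two] at hx
  simp only [sqLen, projTwo, Complex.normSq_eq_norm_sq]
  rcases i with i | i
  · fin_cases i
    · exact le_add_of_nonneg_right (sq_nonneg _)
    · exact le_add_of_nonneg_left (sq_nonneg _)
  · have : ‖x (Sum.inr i)‖ ^ 2 ≤ ∑ k, ‖x (Sum.inr k)‖ ^ 2 :=
      Finset.single_le_sum (f := fun k => ‖x (Sum.inr k)‖ ^ 2) (fun _ _ => sq_nonneg _)
        (Finset.mem_univ i)
    linarith

omit [NeZero n] in
theorem norm_sq_le_sqLen_act {x : Vec n} (hx : 0 ≤ (herm x x).re) (g : U n) (j : Idx n) :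
    ‖x j‖ ^ 2 ≤ sqLen (projTwo (act x g)) * height g ^ 2 := by
  have h1 : ∀ i, ‖act x g i‖ ≤ Real.sqrt (sqLen (projTwo (act x g))) := fun i =>
    Real.le_sqrt_of_sq_le (norm_sq_le_sqLen (by rw [herm_act]; exact hx) i)
  have h2 := norm_act_le h1 g⁻¹ j
  rw [act_act_inv, height_inv] at h2
  calc ‖x j‖ ^ 2 ≤ (Real.sqrt (sqLen (projTwo (act x g))) * height g) ^ 2 :=
        pow_le_pow_left₀ (norm_nonneg _) h2 2
    _ = _ := by rw [mul_pow, Real.sq_sqrt (sqLen_nonneg _)]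

theorem half_le_sqLen (g : U n) : 1 / 2 ≤ sqLen (projTwo (act (b1 n) g)) * height g ^ 2 := by
  have h := norm_sq_le_sqLen_act (x := b1 n) (by rw [herm_b1_b1]; simp) g (Sum.inl 0)
  have e : ‖b1 n (Sum.inl 0)‖ ^ 2 = 1 / 2 := by
    simp [b1, uVec, vVec]
  rwa [e] at h

theorem sqLen_pos (g : U n) : 0 < sqLen (projTwo (act (b1 n) g)) := by
  have h := half_le_sqLen g
  refine (sqLen_nonneg _).lt_of_ne fun h0 => ?_
  rw [← h0, zero_mul] at h
  norm_num at h

theorem norm_act_b1_le (g : U n) (j : Idx n) : ‖act (b1 n) g j‖ ≤ height g := by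
  have h1 : ∀ i, ‖b1 n i‖ ≤ 1 := fun i => by
    have h := norm_sq_le_sqLen (x := b1 n) (by rw [herm_b1_b1]; simp) i
    have e : sqLen (projTwo (b1 n)) = 1 / 2 := by
      simp [sqLen, projTwo, b1, uVec, vVec, Complex.normSq_eq_norm_sq]
    rw [e] at h
    nlinarith [norm_nonneg (b1 n i)]
  simpa using norm_act_le h1 g j

theorem sqLen_le (g : U n) : sqLen (projTwo (act (b1 n) g)) ≤ 2 * height g ^ 2 := by
  have h := fun j : Fin 2 => pow_le_pow_left₀ (norm_nonneg _) (norm_act_b1_le g (Sum.inl j)) 2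
  simp only [sqLen, projTwo, Complex.normSq_eq_norm_sq]
  linarith [h 0, h 1]

theorem sqLen_mul_sqLen (A B : Fin 2 → ℂ) (hA : 0 < sqLen A) :
    ‖A 0 * B 1 - A 1 * B 0‖ ^ 2 = sqLen A *
      sqLen (B - ((B 0 * conj (A 0) + B 1 * conj (A 1)) / (sqLen A : ℂ)) • A) := by
  have hA' : (sqLen A : ℂ) ≠ 0 := by exact_mod_cast hA.ne'
  set c := (B 0 * conj (A 0) + B 1 * conj (A 1)) / (sqLen A : ℂ) with hc
  have h1 : c * sqLen A = B 0 * conj (A 0) + B 1 * conj (A 1) := div_mul_cancel₀ _ hA'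
  have h2 := congrArg conj h1
  simp only [map_mul, map_add, Complex.conj_conj, Complex.conj_ofReal] at h2
  have : ((‖A 0 * B 1 - A 1 * B 0‖ ^ 2 : ℝ) : ℂ) = ((sqLen A * sqLen (B - c • A) : ℝ) : ℂ) := by
    rw [Complex.ofReal_pow, ← Complex.mul_conj', Complex.ofReal_mul, coe_sqLen (B - c • A)]
    rw [coe_sqLen] at h1 h2 ⊢
    simp only [map_sub, map_mul, Pi.sub_apply, Pi.smul_apply, smul_eq_mul]
    clear_value c
    linear_combination (-1 : ℂ) * (conj c * (A 0 * conj (A 0) + A 1 * conj (A 1)) -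
      (conj (B 0) * A 0 + conj (B 1) * A 1)) * h1
  exact_mod_cast this

variable {T : Vec n} (hT : T ∈ V0 n) (hpos : 0 ≤ (herm T T).re)

include hT hpos

theorem le_norm_whitBeta (g : U n) : ‖T (Sum.inl 1)‖ ≤
    ‖whitBeta (projTwo (act (b1 n) g)) (projTwo (act T g))‖ * height g ^ 2 := by
  set A := projTwo (act (b1 n) g) with hA
  set B := projTwo (act T g) with hB
  have hpA : 0 < sqLen A := sqLen_pos g
  set c := (B 0 * conj (A 0) + B 1 * conj (A 1)) / (sqLen A : ℂ) with hc
  have h1 : 0 ≤ (herm (T - c • b1 n) (T - c • b1 n)).re := by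
    rw [herm_sub_left, herm_sub_right, herm_sub_right, herm_smul_left, herm_smul_left,
      herm_smul_right, herm_smul_right, hT.1, herm_b1_b1, herm_swap_eq_zero hT.1]
    simpa using hpos
  have h2 := norm_sq_le_sqLen_act h1 g (Sum.inl 1)
  have e1 : (T - c • b1 n) (Sum.inl 1) = T (Sum.inl 1) := by simp [b1, uVec, vVec]
  have e2 : projTwo (act (T - c • b1 n) g) = B - c • A := by
    rw [act_sub, act_smul]; rfl
  rw [e1, e2] at h2
  have h3 := sqLen_mul_sqLen A B hpA
  rw [← hc] at h3
  have h4 : ‖whitBeta A B‖ = 2 * Real.pi * ‖A 0 * B 1 - A 1 * B 0‖ / sqLen A := by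
    rw [whitBeta, norm_div, norm_mul, RCLike.norm_conj, Complex.norm_of_nonneg hpA.le]
    simp [abs_of_pos Real.pi_pos]
  have h5 : ‖whitBeta A B‖ ^ 2 * sqLen A = 4 * Real.pi ^ 2 * sqLen (B - c • A) := by
    rw [h4, div_pow, mul_pow, h3]; field_simp; ring
  have h6 := sqLen_le g
  rw [← hA] at h6
  have hpi : 1 ≤ Real.pi := by linarith [Real.pi_gt_three]
  have hh := height_one_le g
  refine le_of_sq_le_sq ?_ (by positivity)
  have hq := sqLen_nonneg (B - c • A)
  have h7 : 2 * sqLen (B - c • A) ≤ ‖whitBeta A B‖ ^ 2 * (2 * height g ^ 2) := by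
    calc 2 * sqLen (B - c • A) ≤ 4 * Real.pi ^ 2 * sqLen (B - c • A) := by
          apply mul_le_mul_of_nonneg_right _ hq
          nlinarith
      _ = ‖whitBeta A B‖ ^ 2 * sqLen A := h5.symm
      _ ≤ _ := mul_le_mul_of_nonneg_left h6 (sq_nonneg _)
  calc ‖T (Sum.inl 1)‖ ^ 2 ≤ sqLen (B - c • A) * height g ^ 2 := h2
    _ ≤ (‖whitBeta A B‖ ^ 2 * height g ^ 2) * height g ^ 2 := by
        apply mul_le_mul_of_nonneg_right _ (sq_nonneg _)
        linarith
    _ = _ := by ring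

omit hT hpos

/-! ### Moderate growth -/

omit [NeZero n] in
/-- Polynomially bounded scalar functions. -/
def PolyBounded (f : U n → ℂ) : Prop := ∃ (C : ℝ) (r : ℕ), 0 ≤ C ∧ ∀ g, ‖f g‖ ≤ C * height g ^ r

omit [NeZero n] in
theorem PolyBounded.mul {f f' : U n → ℂ} (h : PolyBounded f) (h' : PolyBounded f') :
    PolyBounded fun g => f g * f' g := by
  obtain ⟨C, r, hC, h⟩ := h
  obtain ⟨C', r', hC', h'⟩ := h'
  refine ⟨C * C', r + r', by positivity, fun g => ?_⟩
  have hh := height_one_le g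
  rw [norm_mul]
  calc ‖f g‖ * ‖f' g‖ ≤ (C * height g ^ r) * (C' * height g ^ r') :=
        mul_le_mul (h g) (h' g) (norm_nonneg _) (by positivity)
    _ = _ := by ring

omit [NeZero n] in
theorem PolyBounded.add {f f' : U n → ℂ} (h : PolyBounded f) (h' : PolyBounded f') :
    PolyBounded fun g => f g + f' g := by
  obtain ⟨C, r, hC, h⟩ := h
  obtain ⟨C', r', hC', h'⟩ := h'
  refine ⟨C + C', r + r', by positivity, fun g => ?_⟩
  have hh := height_one_le g
  calc ‖f g + f' g‖ ≤ ‖f g‖ + ‖f' g‖ := norm_add_le _ _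
    _ ≤ C * height g ^ r + C' * height g ^ r' := add_le_add (h g) (h' g)
    _ ≤ C * height g ^ (r + r') + C' * height g ^ (r + r') := by
        gcongr <;> first | exact hh | omega
    _ = _ := by ring

omit [NeZero n] in
theorem polyBounded_const (c : ℂ) : PolyBounded fun _ : U n => c :=
  ⟨‖c‖, 0, norm_nonneg _, fun g => by simp⟩

omit [NeZero n] in
theorem PolyBounded.pow {f : U n → ℂ} (h : PolyBounded f) (k : ℕ) :
    PolyBounded fun g => f g ^ k := by
  induction k with
  | zero => simpa using polyBounded_const 1
  | succ k ih => simpa only [pow_succ] using ih.mul h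

omit [NeZero n] in
theorem PolyBounded.sum {ι : Type*} (s : Finset ι) {f : ι → U n → ℂ}
    (h : ∀ i, PolyBounded (f i)) : PolyBounded fun g => ∑ i ∈ s, f i g := by
  classical
  induction s using Finset.induction_on with
  | empty => simpa using polyBounded_const 0
  | insert i s hi ih => simpa only [Finset.sum_insert hi] using (h i).add ih

omit [NeZero n] in
theorem isModerate_of_polyBounded {W : U n → VEll ℓ} (h : ∀ a, PolyBounded fun g => W g a) :
    IsModerate W := by
  have h1 : PolyBounded fun g => ∑ a, ((‖W g a‖ : ℝ) : ℂ) := PolyBounded.sum _ fun a => by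
    obtain ⟨C, r, hC, h⟩ := h a
    exact ⟨C, r, hC, fun g => by simpa using h g⟩
  obtain ⟨C, r, -, h1⟩ := h1
  refine ⟨C, r, fun g => le_trans ?_ (h1 g)⟩
  beta_reduce
  rw [← Complex.ofReal_sum, Complex.norm_of_nonneg (by positivity)]
  exact (pi_norm_le_iff_of_nonneg (by positivity)).2 fun a =>
    Finset.single_le_sum (f := fun a => ‖W g a‖) (fun _ _ => norm_nonneg _) (Finset.mem_univ a)

omit [NeZero n] in
/-- A linear combination of values of forms recovers the form. -/
theorem exists_eq_sum_formEval (ℓ : ℕ) : ∃ P : Fin (2 * ℓ + 1) → Fin (2 * ℓ + 1) → ℂ,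
    ∀ c : VEll ℓ, ∀ a, c a = ∑ i, P i a * formEval c ![1, ((i : ℕ) : ℂ)] := by
  obtain ⟨Ψ, hΨ⟩ := exists_interpolation (2 * ℓ + 1)
  refine ⟨fun i => Ψ (Pi.single i 1), fun c a => ?_⟩
  have h := hΨ c
  rw [pi_eq_sum_univ' (formValues (2 * ℓ + 1) c), map_sum] at h
  conv_lhs => rw [← h]
  rw [Finset.sum_apply]
  refine Finset.sum_congr rfl fun i _ => ?_
  rw [map_smul, Pi.smul_apply, smul_eq_mul, mul_comm]
  congr 2

include hT hpos in
theorem whit_moderate (hT1 : T (Sum.inl 1) ≠ 0) : IsModerate (whit ℓ T) := by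
  refine isModerate_of_polyBounded fun a => ?_
  obtain ⟨P, hP⟩ := exists_eq_sum_formEval ℓ
  rw [funext fun g => hP (whit ℓ T g) a]
  refine PolyBounded.sum _ fun i => (polyBounded_const _).mul ?_
  simp only [whit, formEval_whitPair]
  refine PolyBounded.mul ?_ ?_
  · refine ⟨2 ^ (2 * ℓ + 1), 2 * (2 * ℓ + 1), by positivity, fun g => ?_⟩
    have h1 := sqLen_pos g
    have h2 := half_le_sqLen g
    have hh := height_one_le g
    beta_reduce
    rw [whitScalar, norm_mul, norm_inv, Complex.norm_of_nonneg (by positivity),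
      Complex.norm_exp]
    have h3 : ∀ x : ℝ, (2 * Real.pi * Complex.I * (x : ℂ)).re = 0 := fun x => by simp
    rw [h3, Real.exp_zero, mul_one]
    have h4 : (sqLen (projTwo (act (b1 n) g)))⁻¹ ≤ 2 * height g ^ 2 := by
      rw [inv_le_iff_one_le_mul₀ h1]; linarith
    calc (2 ^ (ℓ + 1) * sqLen (projTwo (act (b1 n) g)) ^ (2 * ℓ + 1))⁻¹
        ≤ (sqLen (projTwo (act (b1 n) g)) ^ (2 * ℓ + 1))⁻¹ := by
          apply inv_anti₀ (by positivity)
          exact le_mul_of_one_le_left (by positivity) (one_le_pow₀ (by norm_num))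
      _ = (sqLen (projTwo (act (b1 n) g)))⁻¹ ^ (2 * ℓ + 1) := (inv_pow _ _).symm
      _ ≤ (2 * height g ^ 2) ^ (2 * ℓ + 1) := pow_le_pow_left₀ (by positivity) h4 _
      _ = _ := by rw [mul_pow, ← pow_mul]
  · simp only [formEval]
    have hA : ∀ j : Fin 2, PolyBounded fun g : U n => projTwo (act (b1 n) g) j := fun j =>
      ⟨1, 1, zero_le_one, fun g => by simpa [projTwo] using norm_act_b1_le g (Sum.inl j)⟩
    have hAc : ∀ j : Fin 2, PolyBounded fun g : U n => conj (projTwo (act (b1 n) g) j) := fun j =>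
      ⟨1, 1, zero_le_one, fun g => by simpa [projTwo] using norm_act_b1_le g (Sum.inl j)⟩
    refine PolyBounded.sum _ fun a => PolyBounded.mul ?_ ((polyBounded_const _).mul
      (PolyBounded.mul (PolyBounded.pow ?_ _) (PolyBounded.pow ?_ _)))
    · obtain ⟨M, C, -, hC, hK⟩ := besselK_le ((a : ℤ) - (ℓ : ℤ)) 0
      refine ⟨C * (1 / ‖T (Sum.inl 1)‖) ^ M, 2 * M, by positivity, fun g => ?_⟩
      have h1 := le_norm_whitBeta hT hpos g
      have hT' : 0 < ‖T (Sum.inl 1)‖ := norm_pos_iff.2 hT1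
      have hh := height_one_le g
      set b := whitBeta (projTwo (act (b1 n) g)) (projTwo (act T g)) with hb
      have hb0 : b ≠ 0 := fun h => by rw [h, norm_zero, zero_mul] at h1; linarith
      have hb1 : 0 < ‖b‖ := norm_pos_iff.2 hb0
      beta_reduce
      rw [← hb, kapVec, norm_kap _ hb0]
      calc besselK ((a : ℤ) - (ℓ : ℤ)) ‖b‖ ≤ C * (1 / ‖b‖) ^ M := hK _ hb1
        _ ≤ C * (1 / ‖T (Sum.inl 1)‖ * height g ^ 2) ^ M := by
            gcongr
            rw [div_mul_eq_mul_div, one_mul, div_le_div_iff₀ hb1 hT']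
            linarith
        _ = _ := by rw [mul_pow, ← pow_mul]; ring
    · simp only [Matrix.cons_val_zero, Matrix.cons_val_one]
      exact ((hA 0).mul (polyBounded_const _)).add ((hA 1).mul (polyBounded_const _))
    · simp only [Matrix.cons_val_zero, Matrix.cons_val_one]
      have := ((polyBounded_const (-1)).mul (hAc 1))
      simp only [neg_one_mul] at this
      exact (this.mul (polyBounded_const _)).add ((hAc 0).mul (polyBounded_const _))


/-! ### Smoothness -/

omit [NeZero n] in
theorem contDiffAt_zpow {E : Type*} [NormedAddCommGroup E] [NormedSpace ℝ E] {f : E → ℂ} {x : E}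
    (hf : ContDiffAt ℝ ∞ f x) (h0 : f x ≠ 0) (v : ℤ) : ContDiffAt ℝ ∞ (fun y => f y ^ v) x := by
  rcases v with v | v
  · simpa using hf.pow v
  · simp only [zpow_negSucc]
    exact (hf.pow (v + 1)).inv (pow_ne_zero _ h0)

omit [NeZero n] in
theorem contDiffAt_conj {E : Type*} [NormedAddCommGroup E] [NormedSpace ℝ E] {f : E → ℂ} {x : E}
    (hf : ContDiffAt ℝ ∞ f x) : ContDiffAt ℝ ∞ (fun y => conj (f y)) x :=
  (Complex.conjCLE.contDiff.contDiffAt).comp x hf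

omit [NeZero n] in
theorem contDiffAt_ofReal {E : Type*} [NormedAddCommGroup E] [NormedSpace ℝ E] {f : E → ℝ} {x : E}
    (hf : ContDiffAt ℝ ∞ f x) : ContDiffAt ℝ ∞ (fun y => (f y : ℂ)) x :=
  (Complex.ofRealCLM.contDiff.contDiffAt).comp x hf

omit [NeZero n] in
theorem contDiffAt_kap (v : ℤ) {b : ℂ} (hb : b ≠ 0) : ContDiffAt ℝ ∞ (kap v) b := by
  have hn : ContDiffAt ℝ ∞ (fun b : ℂ => ‖b‖) b := contDiffAt_norm ℝ hb
  have hb' : 0 < ‖b‖ := norm_pos_iff.2 hb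
  refine ContDiffAt.mul (contDiffAt_zpow ((contDiffAt_ofReal hn).mul (contDiffAt_id.inv hb)) ?_ v)
    (contDiffAt_ofReal ?_)
  · exact mul_ne_zero (by exact_mod_cast hb'.ne') (inv_ne_zero hb)
  · exact ((contDiffOn_besselK v).contDiffAt (Ioi_mem_nhds hb')).comp b hn

omit [NeZero n] in
theorem contDiffAt_whitPair {E : Type*} [NormedAddCommGroup E] [NormedSpace ℝ E]
    {A B : E → Fin 2 → ℂ} {x : E} (hA : ∀ j, ContDiffAt ℝ ∞ (fun y => A y j) x)
    (hB : ∀ j, ContDiffAt ℝ ∞ (fun y => B y j) x) (h0 : sqLen (A x) ≠ 0)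
    (h1 : whitBeta (A x) (B x) ≠ 0) : ContDiffAt ℝ ∞ (fun y => whitPair ℓ (A y) (B y)) x := by
  have hcA := fun j => contDiffAt_conj (hA j)
  have h0' : (sqLen (A x) : ℂ) ≠ 0 := by exact_mod_cast h0
  have hlen : ContDiffAt ℝ ∞ (fun y => (sqLen (A y) : ℂ)) x := by
    simp only [coe_sqLen]
    exact ((hA 0).mul (hcA 0)).add ((hA 1).mul (hcA 1))
  have hbeta : ContDiffAt ℝ ∞ (fun y => whitBeta (A y) (B y)) x :=
    (contDiffAt_const.mul (contDiffAt_conj (((hA 0).mul (hB 1)).sub ((hA 1).mul (hB 0))))).mul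
      (hlen.inv h0')
  have hsc : ContDiffAt ℝ ∞ (fun y => whitScalar ℓ (A y) (B y)) x := by
    refine ContDiffAt.mul (ContDiffAt.inv ?_ ?_) (ContDiffAt.cexp (contDiffAt_const.mul
      (contDiffAt_ofReal ((Complex.imCLM.contDiff.contDiffAt).comp x
      ((((hB 0).mul (hcA 0)).add ((hB 1).mul (hcA 1))).mul (hlen.inv h0'))))))
    · push_cast
      exact contDiffAt_const.mul (hlen.pow _)
    · push_cast
      exact mul_ne_zero (pow_ne_zero _ two_ne_zero) (pow_ne_zero _ h0')
  obtain ⟨P, hP⟩ := exists_eq_sum_formEval ℓ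
  refine contDiffAt_pi.2 fun a => ?_
  rw [funext fun y => hP (whitPair ℓ (A y) (B y)) a]
  refine ContDiffAt.sum fun i _ => contDiffAt_const.mul ?_
  simp only [formEval_whitPair]
  simp only [formEval]
  refine hsc.mul (ContDiffAt.sum fun a _ => ContDiffAt.mul ?_ (contDiffAt_const.mul
    (ContDiffAt.mul (ContDiffAt.pow ?_ _) (ContDiffAt.pow ?_ _))))
  · exact (contDiffAt_kap _ h1).comp x hbeta
  · simp only [Matrix.cons_val_zero, Matrix.cons_val_one]
    exact ((hA 0).mul contDiffAt_const).add ((hA 1).mul contDiffAt_const)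
  · simp only [Matrix.cons_val_zero, Matrix.cons_val_one]
    exact ((hcA 1).neg.mul contDiffAt_const).add ((hcA 0).mul contDiffAt_const)

include hT hpos in
theorem whitBeta_ne_zero (hT1 : T (Sum.inl 1) ≠ 0) (g : U n) :
    whitBeta (projTwo (act (b1 n) g)) (projTwo (act T g)) ≠ 0 := fun h => by
  have h1 := le_norm_whitBeta hT hpos g
  rw [h, norm_zero, zero_mul] at h1
  exact hT1 (norm_le_zero_iff.1 h1)

omit [NeZero n] in
theorem contDiff_projTwo_vecMul (x : Vec n) (j : Fin 2) :
    ContDiff ℝ ∞ fun e : Idx n → Idx n → ℂ => projTwo (x ᵥ* Matrix.of e) j := by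
  simp only [projTwo, Matrix.vecMul, dotProduct, Matrix.of_apply]
  exact ContDiff.sum fun i _ => contDiff_const.mul
    (contDiff_apply_apply ℝ ℂ i (Sum.inl j))

include hT hpos in
theorem whit_smooth (hT1 : T (Sum.inl 1) ≠ 0) : IsSmooth (whit ℓ T) := by
  intro g₀
  have hc : ∀ (x : Vec n) (j : Fin 2), Continuous fun e : Idx n → Idx n → ℂ =>
      projTwo (x ᵥ* Matrix.of e) j := fun x j => (contDiff_projTwo_vecMul x j).continuous
  refine ⟨{e | sqLen (projTwo (b1 n ᵥ* Matrix.of e)) ≠ 0} ∩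
    {e | projTwo (b1 n ᵥ* Matrix.of e) 0 * projTwo (T ᵥ* Matrix.of e) 1 -
      projTwo (b1 n ᵥ* Matrix.of e) 1 * projTwo (T ᵥ* Matrix.of e) 0 ≠ 0},
    fun e => whitPair ℓ (projTwo (b1 n ᵥ* Matrix.of e)) (projTwo (T ᵥ* Matrix.of e)),
    IsOpen.inter ?_ ?_, ⟨(sqLen_pos g₀).ne', ?_⟩, ?_, fun g _ => rfl⟩
  · refine isOpen_ne_fun ?_ continuous_const
    exact (Complex.continuous_normSq.comp (hc _ 0)).add (Complex.continuous_normSq.comp (hc _ 1))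
  · exact isOpen_ne_fun (((hc _ 0).mul (hc _ 1)).sub ((hc _ 1).mul (hc _ 0))) continuous_const
  · intro h
    apply whitBeta_ne_zero hT hpos hT1 g₀
    change projTwo (act (b1 n) g₀) 0 * projTwo (act T g₀) 1 -
      projTwo (act (b1 n) g₀) 1 * projTwo (act T g₀) 0 = 0 at h
    rw [whitBeta, h]; simp
  · rintro e ⟨h0, h1⟩
    refine (contDiffAt_whitPair (fun j => (contDiff_projTwo_vecMul _ j).contDiffAt)
      (fun j => (contDiff_projTwo_vecMul _ j).contDiffAt) h0 ?_).contDiffWithinAt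
    refine div_ne_zero (mul_ne_zero (by simp [Real.pi_ne_zero]) ?_) (by exact_mod_cast h0)
    exact (map_ne_zero _).2 h1

/-! ### Restriction to the Levi subgroup -/

omit [NeZero n] in
theorem besselFormula_eq (T : Vec n) (m : U n) (z : ℂˣ) (a : Fin (2 * ℓ + 1)) :
    besselFormula ℓ T m z a =
      ((‖(z : ℂ)‖ ^ (2 * ℓ + 2) : ℝ) : ℂ) * kap ((a : ℤ) - (ℓ : ℤ)) (beta T m z) := by
  rw [besselFormula, kap, mul_assoc]

include hT in
theorem whit_eq_besselFormula {m : U n} {z : ℂˣ} (hm : IsLevi m z) :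
    whit ℓ T m = besselFormula ℓ T m z := by
  have hz : (z : ℂ) ≠ 0 := z.ne_zero
  have hzc : conj (z : ℂ) ≠ 0 := by simp
  have hs := inv_sqrt_two_sq
  set s := ((1 / Real.sqrt 2 : ℝ) : ℂ) with hsdef
  have hsc : conj s = s := Complex.conj_ofReal _
  set A := projTwo (act (b1 n) m) with hA
  set B := projTwo (act T m) with hB
  have hA0 : A 0 = (z : ℂ)⁻¹ * s := by
    rw [hA, projTwo, hm.1]; simp [b1, uVec, vVec, hsdef]
  have hA1 : A 1 = 0 := by
    rw [hA, projTwo, hm.1]; simp [b1, uVec, vVec]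
  have hB0 : B 0 = 0 := ((mem_V0_iff _).1 (hm.act_mem_V0 hT)).1
  have hlen : (sqLen A : ℂ) = 1 / (2 * z * conj (z : ℂ)) := by
    rw [coe_sqLen, hA0, hA1, map_mul, map_inv₀, hsc]
    field_simp
    linear_combination 2 * hs
  have hlen' : sqLen A = 1 / (2 * ‖(z : ℂ)‖ ^ 2) := by
    have : (sqLen A : ℂ) = ((1 / (2 * ‖(z : ℂ)‖ ^ 2) : ℝ) : ℂ) := by
      rw [hlen]; push_cast; rw [mul_assoc, Complex.mul_conj']
    exact_mod_cast this
  have hb : whitBeta A B = conj (conj (z : ℂ) / z) * beta T m z := by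
    have e : beta T m z = 4 * Real.pi * s * conj (z : ℂ) * conj (B 1) := by
      rw [beta, herm_smul_right, ← herm_conj, herm_uVec, hsdef]
      push_cast
      simp only [hB, projTwo]; ring
    rw [whitBeta, hlen, e, hA0, hA1, hB0, zero_mul, sub_zero]
    simp only [map_mul, map_inv₀, map_div₀, Complex.conj_conj, hsc]
    field_simp
    ring
  have hsca : whitScalar ℓ A B = ((2 ^ ℓ * ‖(z : ℂ)‖ ^ (4 * ℓ + 2) : ℝ) : ℂ) := by
    rw [whitScalar, hA1, hB0, hlen']
    have : 0 < ‖(z : ℂ)‖ := norm_pos_iff.2 hz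
    simp only [zero_mul, map_zero, mul_zero, add_zero, zero_div, Complex.zero_im,
      Complex.ofReal_zero, Complex.exp_zero, mul_one, ← Complex.ofReal_inv]
    congr 1
    rw [one_div, inv_pow, mul_pow, ← pow_mul]
    field_simp
    ring
  have hd : ‖conj (z : ℂ) / z‖ = 1 := by
    rw [norm_div, RCLike.norm_conj, div_self (norm_ne_zero_iff.2 hz)]
  refine formEval_injective fun u => ?_
  rw [whit, formEval_whitPair, ← hA, ← hB, hsca, hb, formEval, formEval, Finset.mul_sum]
  refine Finset.sum_congr rfl fun a _ => ?_
  obtain ⟨b, hb⟩ : ∃ b, 2 * ℓ + 1 - 1 - (a : ℕ) = b := ⟨_, rfl⟩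
  have hab : 2 * ℓ = a + b := by omega
  have hs2 : 2 ^ ℓ * (s ^ a.val * s ^ b) = 1 := by
    rw [← pow_add, ← hab, pow_mul, hs, ← mul_pow]; norm_num
  have key : 2 ^ ℓ * ((z : ℂ) * conj (z : ℂ)) ^ ℓ * (conj (z : ℂ) / z) ^ ((a : ℤ) - (ℓ : ℤ)) *
      (((z : ℂ)⁻¹ * s) ^ b * ((conj (z : ℂ))⁻¹ * s) ^ a.val) = 1 := by
    rw [zpow_sub₀ (div_ne_zero hzc hz), zpow_natCast, zpow_natCast]
    calc _ = (2 ^ ℓ * (s ^ a.val * s ^ b)) * ((z : ℂ) ^ (2 * ℓ) / z ^ (a.val + b)) *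
          (conj (z : ℂ) ^ (ℓ + a.val) / conj (z : ℂ) ^ (ℓ + a.val)) := by
          simp only [two_mul, pow_add, mul_pow, div_pow, inv_pow]
          field_simp
      _ = 1 := by
          rw [hs2, ← hab, div_self (pow_ne_zero _ hz), div_self (pow_ne_zero _ hzc)]; norm_num
  have hnorm : ((‖(z : ℂ)‖ ^ (4 * ℓ + 2) : ℝ) : ℂ) =
      ((‖(z : ℂ)‖ ^ (2 * ℓ + 2) : ℝ) : ℂ) * ((z : ℂ) * conj (z : ℂ)) ^ ℓ := by
    rw [Complex.mul_conj']; push_cast; ring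
  rw [kapVec_mul hd, besselFormula_eq, kapVec, hb, Complex.ofReal_mul, hnorm]
  simp only [Matrix.cons_val_zero, Matrix.cons_val_one, hA0, hA1, map_mul, map_inv₀, hsc, map_zero,
    zero_mul, neg_zero, zero_add, add_zero]
  rw [mul_pow _ (u 0), mul_pow _ (u 1)]
  push_cast
  linear_combination (‖(z : ℂ)‖ : ℂ) ^ (2 * ℓ + 2) * kap ((a : ℤ) - (ℓ : ℤ)) (beta T m z) *
    (((b.factorial : ℂ) * (a.val.factorial : ℂ))⁻¹ * (u 0 ^ b * u 1 ^ a.val)) * key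

end

end QWhittaker

namespace QWhittaker

noncomputable section

/-! ### Equivariance of the Schmid operators -/

variable {n ℓ : ℕ} {W : U n → VEll ℓ}

/-- The holomorphic derivative along `x ⊗ ȳ`. -/
def wPlus (φ : U n → VEll ℓ) (g : U n) (x y : Vec n) : VEll ℓ :=
  (1 / 2 : ℂ) • lieDeriv (skewTens x y) φ g + (-Complex.I / 2) • lieDeriv (symTens x y) φ g

/-- The antiholomorphic derivative along `x ⊗ ȳ`. -/
def wMinus (φ : U n → VEll ℓ) (g : U n) (x y : Vec n) : VEll ℓ :=
  (1 / 2 : ℂ) • lieDeriv (skewTens x y) φ g + (Complex.I / 2) • lieDeriv (symTens x y) φ g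

theorem symTens_add_left (x x' y : Vec n) : symTens (x + x') y = symTens x y + symTens x' y := by
  rw [symTens_eq, symTens_eq, symTens_eq, smul_add, skewTens_add_left]

theorem symTens_add_right (x y y' : Vec n) : symTens x (y + y') = symTens x y + symTens x y' := by
  rw [symTens_eq, symTens_eq, symTens_eq, skewTens_add_right]

theorem skewTens_smul_left (c : ℂ) (x y : Vec n) :
    skewTens (c • x) y = c.re • skewTens x y + c.im • symTens x y := by
  conv_lhs => rw [← Complex.re_add_im c]
  rw [add_smul, skewTens_add_left, skewTens_real_smul_left, mul_smul, skewTens_real_smul_left,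
    symTens_eq]

theorem symTens_smul_left (c : ℂ) (x y : Vec n) :
    symTens (c • x) y = c.re • symTens x y - c.im • skewTens x y := by
  rw [symTens_eq, smul_smul, skewTens_smul_left]
  simp only [Complex.mul_re, Complex.mul_im, Complex.I_re, Complex.I_im]
  module

theorem skewTens_smul_right (c : ℂ) (x y : Vec n) :
    skewTens x (c • y) = c.re • skewTens x y - c.im • symTens x y := by
  conv_lhs => rw [← Complex.re_add_im c]
  rw [add_smul, skewTens_add_right, skewTens_real_smul_right, mul_smul, skewTens_real_smul_right,
    skewTens_I_smul_right, smul_neg, sub_eq_add_neg]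

theorem symTens_smul_right (c : ℂ) (x y : Vec n) :
    symTens x (c • y) = c.re • symTens x y + c.im • skewTens x y := by
  rw [symTens_eq, skewTens_smul_right, symTens_smul_left, symTens_eq]
  simp

section bilinear

variable (hs : IsSmooth W) (g : U n)

include hs

theorem wPlus_add_left (x x' y : Vec n) : wPlus W g (x + x') y = wPlus W g x y + wPlus W g x' y := by
  simp only [wPlus, skewTens_add_left, symTens_add_left, lieDeriv_add_lie hs]; module

theorem wPlus_add_right (x y y' : Vec n) : wPlus W g x (y + y') = wPlus W g x y + wPlus W g x y' := by
  simp only [wPlus, skewTens_add_right, symTens_add_right, lieDeriv_add_lie hs]; module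

theorem wMinus_add_left (x x' y : Vec n) :
    wMinus W g (x + x') y = wMinus W g x y + wMinus W g x' y := by
  simp only [wMinus, skewTens_add_left, symTens_add_left, lieDeriv_add_lie hs]; module

theorem wMinus_add_right (x y y' : Vec n) :
    wMinus W g x (y + y') = wMinus W g x y + wMinus W g x y' := by
  simp only [wMinus, skewTens_add_right, symTens_add_right, lieDeriv_add_lie hs]; module

theorem wPlus_smul_left (c : ℂ) (x y : Vec n) : wPlus W g (c • x) y = c • wPlus W g x y := by
  funext a
  simp only [wPlus, skewTens_smul_left, symTens_smul_left, lieDeriv_add_lie hs,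
    lieDeriv_sub_lie hs, lieDeriv_smul_lie hs, Pi.add_apply, Pi.sub_apply, Pi.smul_apply,
    smul_eq_mul, Complex.real_smul]
  conv_rhs => rw [← Complex.re_add_im c]
  linear_combination (1 / 2 * c.im * lieDeriv (symTens x y) W g a) * Complex.I_sq

theorem wPlus_smul_right (c : ℂ) (x y : Vec n) : wPlus W g x (c • y) = conj c • wPlus W g x y := by
  have e : conj c = c.re - c.im * Complex.I := by
    apply Complex.ext <;> simp
  funext a
  simp only [wPlus, skewTens_smul_right, symTens_smul_right, lieDeriv_add_lie hs,
    lieDeriv_sub_lie hs, lieDeriv_smul_lie hs, Pi.add_apply, Pi.sub_apply, Pi.smul_apply,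
    smul_eq_mul, Complex.real_smul, e]
  linear_combination (-1 / 2 * c.im * lieDeriv (symTens x y) W g a) * Complex.I_sq

theorem wMinus_smul_left (c : ℂ) (x y : Vec n) : wMinus W g (c • x) y = conj c • wMinus W g x y := by
  have e : conj c = c.re - c.im * Complex.I := by
    apply Complex.ext <;> simp
  funext a
  simp only [wMinus, skewTens_smul_left, symTens_smul_left, lieDeriv_add_lie hs,
    lieDeriv_sub_lie hs, lieDeriv_smul_lie hs, Pi.add_apply, Pi.sub_apply, Pi.smul_apply,
    smul_eq_mul, Complex.real_smul, e]
  linear_combination (1 / 2 * c.im * lieDeriv (symTens x y) W g a) * Complex.I_sq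

theorem wMinus_smul_right (c : ℂ) (x y : Vec n) : wMinus W g x (c • y) = c • wMinus W g x y := by
  funext a
  simp only [wMinus, skewTens_smul_right, symTens_smul_right, lieDeriv_add_lie hs,
    lieDeriv_sub_lie hs, lieDeriv_smul_lie hs, Pi.add_apply, Pi.sub_apply, Pi.smul_apply,
    smul_eq_mul, Complex.real_smul]
  conv_rhs => rw [← Complex.re_add_im c]
  linear_combination (-1 / 2 * c.im * lieDeriv (symTens x y) W g a) * Complex.I_sq

omit hs in
theorem vec_eq_sum_of_inl {y : Vec n} (hy : ∀ j, y (Sum.inl j) = 0) :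
    y = ∑ k, y (Sum.inr k) • vVec n k := by
  funext i
  rw [Finset.sum_apply]
  rcases i with i | i
  · simp [hy, vVec]
  · simp [vVec, Pi.single_apply]

theorem schmidPlus_eq_zero_iff_forall : schmidPlus W g = 0 ↔
    ∀ y : Vec n, (∀ j, y (Sum.inl j) = 0) → ∀ a : Fin (2 * ℓ),
      wPlus W g (uVec n 0) y a.castSucc + wPlus W g (uVec n 1) y a.succ = 0 := by
  have hn : (1 / (2 * ((n : ℂ) + 2))) ≠ 0 := by
    refine one_div_ne_zero (mul_ne_zero two_ne_zero ?_)
    exact_mod_cast (by omega : n + 2 ≠ 0)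
  have e : ∀ k a, schmidPlus W g k a = (1 / (2 * ((n : ℂ) + 2))) *
      (wPlus W g (uVec n 0) (vVec n k) a.castSucc + wPlus W g (uVec n 1) (vVec n k) a.succ) :=
    fun k a => by
      simp only [schmidPlus, projPlus, schmidTildePlus, lower1, lower2, Pi.add_apply,
        Pi.smul_apply, smul_eq_mul, mul_add]
      rfl
  constructor
  · intro h y hy a
    rw [vec_eq_sum_of_inl hy]
    refine Finset.sum_induction _ (fun y => wPlus W g (uVec n 0) y a.castSucc +
      wPlus W g (uVec n 1) y a.succ = 0) (fun x y hx hy => ?_) ?_ fun k _ => ?_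
    · simp only [wPlus_add_right hs, Pi.add_apply]
      linear_combination hx + hy
    · have := wPlus_smul_right hs g 0
      simp only [zero_smul, map_zero] at this
      simp [this _ (0 : Vec n)]
    · have h1 : schmidPlus W g k a = 0 := by rw [h]; rfl
      rw [e] at h1
      have h2 := (mul_eq_zero.1 h1).resolve_left hn
      simp only [wPlus_smul_right hs, Pi.smul_apply, smul_eq_mul]
      linear_combination conj (y (Sum.inr k)) * h2
  · intro h
    ext k a
    rw [e, h (vVec n k) (fun j => by simp [vVec]), mul_zero]; rfl

theorem schmidMinus_eq_zero_iff_forall : schmidMinus W g = 0 ↔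
    ∀ y : Vec n, (∀ j, y (Sum.inl j) = 0) → ∀ a : Fin (2 * ℓ),
      -wMinus W g (uVec n 0) y a.succ + wMinus W g (uVec n 1) y a.castSucc = 0 := by
  have hn : (1 / (2 * ((n : ℂ) + 2))) ≠ 0 := by
    refine one_div_ne_zero (mul_ne_zero two_ne_zero ?_)
    exact_mod_cast (by omega : n + 2 ≠ 0)
  have e : ∀ k a, schmidMinus W g k a = (1 / (2 * ((n : ℂ) + 2))) *
      (-wMinus W g (uVec n 0) (vVec n k) a.succ + wMinus W g (uVec n 1) (vVec n k) a.castSucc) :=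
    fun k a => by
      simp only [schmidMinus, projMinus, schmidTildeMinus, lower1, lower2, Pi.add_apply,
        Pi.neg_apply, Pi.smul_apply, smul_eq_mul, mul_add, mul_neg]
      rfl
  constructor
  · intro h y hy a
    rw [vec_eq_sum_of_inl hy]
    refine Finset.sum_induction _ (fun y => -wMinus W g (uVec n 0) y a.succ +
      wMinus W g (uVec n 1) y a.castSucc = 0) (fun x y hx hy => ?_) ?_ fun k _ => ?_
    · simp only [wMinus_add_right hs, Pi.add_apply]
      linear_combination hx + hy
    · have := wMinus_smul_right hs g 0
      simp only [zero_smul] at this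
      simp [this _ (0 : Vec n)]
    · have h1 : schmidMinus W g k a = 0 := by rw [h]; rfl
      rw [e] at h1
      have h2 := (mul_eq_zero.1 h1).resolve_left hn
      simp only [wMinus_smul_right hs, Pi.smul_apply, smul_eq_mul]
      linear_combination y (Sum.inr k) * h2
  · intro h
    ext k a
    rw [e, h (vVec n k) (fun j => by simp [vVec]), mul_zero]; rfl

end bilinear

theorem formEval_derivatives_comp {M : ℕ} {c d : Fin (M + 1) → ℂ} {r : ℂ}
    {k : Matrix (Fin 2) (Fin 2) ℂ} (h : ∀ u, formEval c u = r * formEval d (k *ᵥ u))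
    (u : Fin 2 → ℂ) :
    formEval (fun a : Fin M => c a.castSucc) u =
        r * (k 0 0 * formEval (fun a : Fin M => d a.castSucc) (k *ᵥ u) +
          k 1 0 * formEval (fun a : Fin M => d a.succ) (k *ᵥ u)) ∧
      formEval (fun a : Fin M => c a.succ) u =
        r * (k 0 1 * formEval (fun a : Fin M => d a.castSucc) (k *ᵥ u) +
          k 1 1 * formEval (fun a : Fin M => d a.succ) (k *ᵥ u)) := by
  have hl : ∀ p q : ℂ, HasDerivAt (fun s : ℝ => p + s * q) q 0 := fun p q => by
    simpa using ((Complex.ofRealCLM.hasDerivAt (x := 0)).mul_const q).const_add p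
  have key : ∀ e : Fin 2 → ℂ,
      e 0 * formEval (fun a : Fin M => c a.castSucc) u +
        e 1 * formEval (fun a : Fin M => c a.succ) u =
      r * ((k *ᵥ e) 0 * formEval (fun a : Fin M => d a.castSucc) (k *ᵥ u) +
        (k *ᵥ e) 1 * formEval (fun a : Fin M => d a.succ) (k *ᵥ u)) := fun e => by
    have h1 := hasDerivAt_formEval c (u := fun s : ℝ => u + (s : ℂ) • e) (u' := e) (t := 0)
      (hl _ _) (hl _ _)
    have hv : ∀ (s : ℝ) (i : Fin 2), (k *ᵥ (u + (s : ℂ) • e)) i = (k *ᵥ u) i + s * (k *ᵥ e) i :=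
      fun s i => by rw [Matrix.mulVec_add, Matrix.mulVec_smul]; rfl
    have h2 := (hasDerivAt_formEval d (u := fun s : ℝ => k *ᵥ (u + (s : ℂ) • e)) (u' := k *ᵥ e)
      (t := 0) (by simpa only [hv] using hl _ _) (by simpa only [hv] using hl _ _)).const_mul r
    simp only [← h] at h2
    have := h1.unique h2
    simpa using this
  constructor
  · simpa [Matrix.mulVec, dotProduct, Fin.sum_univ_two] using key ![1, 0]
  · simpa [Matrix.mulVec, dotProduct, Fin.sum_univ_two] using key ![0, 1]

theorem hasDerivAt_formEval_left {M : ℕ} {f : ℝ → Fin M → ℂ} {f' : Fin M → ℂ} {t : ℝ}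
    (h : HasDerivAt f f' t) (u : Fin 2 → ℂ) :
    HasDerivAt (fun s => formEval (f s) u) (formEval f' u) t := by
  simp only [formEval]
  exact HasDerivAt.fun_sum fun a _ => ((hasDerivAt_pi.1 h) a).mul_const _

section transport

variable (hs : IsSmooth W) (hK : ∀ k ∈ KInf n, ∀ g : U n, IsActK k (W g) (W (g * k)))

include hs hK

theorem formEval_lieDeriv_mul {k : U n} (hk : k ∈ KInf n) (g : U n) (x y : Vec n)
    (u : Fin 2 → ℂ) : formEval (lieDeriv (skewTens x y) W (g * k)) u =
      ((toMat k).toBlocks₁₁.det ^ ℓ)⁻¹ *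
        formEval (lieDeriv (skewTens (act x k⁻¹) (act y k⁻¹)) W g) ((toMat k).toBlocks₁₁ *ᵥ u) := by
  have h1 := hasDerivAt_formEval_left (hs.hasDerivAt_zero (g * k) (skewTens x y)) u
  have h2 := (hasDerivAt_formEval_left
    (hs.hasDerivAt_zero g (skewTens (act x k⁻¹) (act y k⁻¹)))
    ((toMat k).toBlocks₁₁ *ᵥ u)).const_mul (((toMat k).toBlocks₁₁.det ^ ℓ)⁻¹)
  have e : ∀ t : ℝ, g * k * expU (t • skewTens x y) =
      g * expU (t • skewTens (act x k⁻¹) (act y k⁻¹)) * k := fun t => by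
    rw [mul_assoc, mul_expU_smul_eq (toMat_mul_skewTens k x y), mul_assoc]
  simp only [e, fun t : ℝ => (isActK_iff k _ _).1 (hK k hk
    (g * expU (t • skewTens (act x k⁻¹) (act y k⁻¹)))) u] at h1
  exact h1.unique h2

theorem formEval_wPlus_mul {k : U n} (hk : k ∈ KInf n) (g : U n) (x y : Vec n)
    (u : Fin 2 → ℂ) : formEval (wPlus W (g * k) x y) u =
      ((toMat k).toBlocks₁₁.det ^ ℓ)⁻¹ *
        formEval (wPlus W g (act x k⁻¹) (act y k⁻¹)) ((toMat k).toBlocks₁₁ *ᵥ u) := by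
  simp only [wPlus, symTens_eq, formEval_add, formEval_smul, formEval_lieDeriv_mul hs hK hk,
    act_smul]
  ring

theorem formEval_wMinus_mul {k : U n} (hk : k ∈ KInf n) (g : U n) (x y : Vec n)
    (u : Fin 2 → ℂ) : formEval (wMinus W (g * k) x y) u =
      ((toMat k).toBlocks₁₁.det ^ ℓ)⁻¹ *
        formEval (wMinus W g (act x k⁻¹) (act y k⁻¹)) ((toMat k).toBlocks₁₁ *ᵥ u) := by
  simp only [wMinus, symTens_eq, formEval_add, formEval_smul, formEval_lieDeriv_mul hs hK hk,
    act_smul]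
  ring

omit hs hK in
theorem act_uVec_of_mem_KInf {k : U n} (hk : k ∈ KInf n) (j : Fin 2) :
    act (uVec n j) k = (toMat k).toBlocks₁₁ j 0 • uVec n 0 + (toMat k).toBlocks₁₁ j 1 • uVec n 1 := by
  have e : ∀ x, act (uVec n j) k x = toMat k (Sum.inl j) x := fun x => by simp [act, uVec]
  funext x
  rw [e]
  rcases x with x | x
  · fin_cases x <;> simp [uVec, Matrix.toBlocks₁₁]
  · have := congrFun (congrFun hk.1 j) x
    simpa [uVec, Matrix.toBlocks₁₂] using this

omit hs hK in
theorem toBlocks_inv {k : U n} (hk : k ∈ KInf n) :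
    (toMat k⁻¹).toBlocks₁₁ = (toMat k).toBlocks₁₁ᴴ := by
  have h1 := toBlocks_mul_conjTranspose hk
  have h2 : (toMat k).toBlocks₁₁ * (toMat k⁻¹).toBlocks₁₁ = 1 := by
    ext i j
    have := congrFun (congrFun (toMat_mul_inv k) (Sum.inl i)) (Sum.inl j)
    have e0 : ∀ x, toMat k (Sum.inl i) (Sum.inr x) = 0 := fun x => congrFun (congrFun hk.1 i) x
    rw [Matrix.mul_apply, Fintype.sum_sum_type] at this
    simp only [e0, zero_mul, Finset.sum_const_zero, add_zero] at this
    rw [Matrix.mul_apply]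
    refine this.trans ?_
    simp [Matrix.one_apply]
  calc _ = ((toMat k).toBlocks₁₁ᴴ * (toMat k).toBlocks₁₁) * (toMat k⁻¹).toBlocks₁₁ := by
        rw [mul_eq_one_comm.1 h1, one_mul]
    _ = _ := by rw [mul_assoc, h2, mul_one]

omit hs hK in
theorem act_inl_of_mem_KInf {k : U n} (hk : k ∈ KInf n) {y : Vec n} (hy : ∀ j, y (Sum.inl j) = 0)
    (j : Fin 2) : act y k (Sum.inl j) = 0 := by
  have h := congrFun (projTwo_act hk y) j
  have hy' : projTwo y = 0 := funext hy
  rw [hy', Matrix.zero_vecMul] at h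
  exact h

omit hs hK in
theorem toBlocks_inner {k : U n} (hk : k ∈ KInf n) (i j : Fin 2) :
    (toMat k).toBlocks₁₁ i 0 * conj ((toMat k).toBlocks₁₁ j 0) +
      (toMat k).toBlocks₁₁ i 1 * conj ((toMat k).toBlocks₁₁ j 1) = if i = j then 1 else 0 := by
  rw [← Matrix.one_apply, ← toBlocks_mul_conjTranspose hk, Matrix.mul_apply, Fin.sum_univ_two]
  rfl

omit hs hK in
theorem formEval_comp_linear {M N : ℕ} (p q : ℂ) (c d : Fin M → ℂ) (f : Fin N → Fin M)
    (u : Fin 2 → ℂ) : formEval (fun a => (p • c + q • d) (f a)) u =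
      p * formEval (fun a => c (f a)) u + q * formEval (fun a => d (f a)) u := by
  rw [← formEval_smul, ← formEval_smul, ← formEval_add]; rfl

theorem schmidPlus_mul_eq_zero {k : U n} (hk : k ∈ KInf n) {g : U n} (h : schmidPlus W g = 0) :
    schmidPlus W (g * k) = 0 := by
  rw [schmidPlus_eq_zero_iff_forall hs] at h ⊢
  intro y hy
  have hki := KInf_inv_mem hk
  have h1 := h (act y k⁻¹) (act_inl_of_mem_KInf hki hy)
  have h2 := fun j => formEval_derivatives_comp (formEval_wPlus_mul hs hK hk g (uVec n j) y)
  refine congrFun (formEval_injective (d := 0) fun u => (formEval_add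
    (fun a : Fin (2 * ℓ) => wPlus W (g * k) (uVec n 0) y a.castSucc)
    (fun a : Fin (2 * ℓ) => wPlus W (g * k) (uVec n 1) y a.succ) u).trans ?_)
  have q00 := toBlocks_inner hk 0 0
  have q01 := toBlocks_inner hk 0 1
  have q10 := toBlocks_inner hk 1 0
  have q11 := toBlocks_inner hk 1 1
  simp only [reduceIte, zero_ne_one, one_ne_zero] at q00 q01 q10 q11
  have h4 : formEval (fun a : Fin (2 * ℓ) => wPlus W g (uVec n 0) (act y k⁻¹) a.castSucc)
        ((toMat k).toBlocks₁₁ *ᵥ u) +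
      formEval (fun a : Fin (2 * ℓ) => wPlus W g (uVec n 1) (act y k⁻¹) a.succ)
        ((toMat k).toBlocks₁₁ *ᵥ u) = 0 := by
    rw [← formEval_add, ← formEval_zero ((toMat k).toBlocks₁₁ *ᵥ u)]
    congr 1
    exact funext h1
  rw [(h2 0 u).1, (h2 1 u).2]
  simp only [act_uVec_of_mem_KInf hki, toBlocks_inv hk, wPlus_add_left hs, wPlus_smul_left hs,
    Matrix.conjTranspose_apply, formEval_comp_linear, RCLike.star_def, formEval_zero]
  generalize formEval (fun a : Fin (2 * ℓ) => wPlus W g (uVec n 0) (act y k⁻¹) a.castSucc)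
    ((toMat k).toBlocks₁₁ *ᵥ u) = t0c at *
  generalize formEval (fun a : Fin (2 * ℓ) => wPlus W g (uVec n 1) (act y k⁻¹) a.castSucc)
    ((toMat k).toBlocks₁₁ *ᵥ u) = t1c at *
  generalize formEval (fun a : Fin (2 * ℓ) => wPlus W g (uVec n 0) (act y k⁻¹) a.succ)
    ((toMat k).toBlocks₁₁ *ᵥ u) = t0s at *
  generalize formEval (fun a : Fin (2 * ℓ) => wPlus W g (uVec n 1) (act y k⁻¹) a.succ)
    ((toMat k).toBlocks₁₁ *ᵥ u) = t1s at *
  linear_combination ((toMat k).toBlocks₁₁.det ^ ℓ)⁻¹ *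
    (t0c * q00 + t1c * q01 + t0s * q10 + t1s * q11 + h4)

theorem schmidMinus_mul_eq_zero {k : U n} (hk : k ∈ KInf n) {g : U n} (h : schmidMinus W g = 0) :
    schmidMinus W (g * k) = 0 := by
  rw [schmidMinus_eq_zero_iff_forall hs] at h ⊢
  intro y hy
  have hki := KInf_inv_mem hk
  have h1 := h (act y k⁻¹) (act_inl_of_mem_KInf hki hy)
  have h2 := fun j => formEval_derivatives_comp (formEval_wMinus_mul hs hK hk g (uVec n j) y)
  have e : (fun a : Fin (2 * ℓ) => -wMinus W (g * k) (uVec n 0) y a.succ +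
        wMinus W (g * k) (uVec n 1) y a.castSucc) =
      (-1 : ℂ) • (fun a : Fin (2 * ℓ) => wMinus W (g * k) (uVec n 0) y a.succ) +
        fun a : Fin (2 * ℓ) => wMinus W (g * k) (uVec n 1) y a.castSucc := by
    funext a; simp
  refine congrFun (e.trans (formEval_injective (d := 0) fun u => (formEval_add
    ((-1 : ℂ) • (fun a : Fin (2 * ℓ) => wMinus W (g * k) (uVec n 0) y a.succ))
    (fun a : Fin (2 * ℓ) => wMinus W (g * k) (uVec n 1) y a.castSucc) u).trans ?_))
  have h4 : -formEval (fun a : Fin (2 * ℓ) => wMinus W g (uVec n 0) (act y k⁻¹) a.succ)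
        ((toMat k).toBlocks₁₁ *ᵥ u) +
      formEval (fun a : Fin (2 * ℓ) => wMinus W g (uVec n 1) (act y k⁻¹) a.castSucc)
        ((toMat k).toBlocks₁₁ *ᵥ u) = 0 := by
    rw [← neg_one_mul, ← formEval_smul, ← formEval_add,
      ← formEval_zero ((toMat k).toBlocks₁₁ *ᵥ u)]
    congr 1
    refine funext fun a => (?_ : _ = _).trans (h1 a)
    simp
  rw [formEval_smul, (h2 0 u).2, (h2 1 u).1]
  simp only [act_uVec_of_mem_KInf hki, toBlocks_inv hk, wMinus_add_left hs, wMinus_smul_left hs,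
    Matrix.conjTranspose_apply, formEval_comp_linear, RCLike.star_def, formEval_zero,
    Complex.conj_conj]
  generalize formEval (fun a : Fin (2 * ℓ) => wMinus W g (uVec n 0) (act y k⁻¹) a.castSucc)
    ((toMat k).toBlocks₁₁ *ᵥ u) = t0c at *
  generalize formEval (fun a : Fin (2 * ℓ) => wMinus W g (uVec n 1) (act y k⁻¹) a.castSucc)
    ((toMat k).toBlocks₁₁ *ᵥ u) = t1c at *
  generalize formEval (fun a : Fin (2 * ℓ) => wMinus W g (uVec n 0) (act y k⁻¹) a.succ)
    ((toMat k).toBlocks₁₁ *ᵥ u) = t0s at *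
  generalize formEval (fun a : Fin (2 * ℓ) => wMinus W g (uVec n 1) (act y k⁻¹) a.succ)
    ((toMat k).toBlocks₁₁ *ᵥ u) = t1s at *
  linear_combination ((toMat k).toBlocks₁₁.det ^ ℓ)⁻¹ * ((toMat k).toBlocks₁₁ 0 0 *
    (toMat k).toBlocks₁₁ 1 1 - (toMat k).toBlocks₁₁ 0 1 * (toMat k).toBlocks₁₁ 1 0) * h4

omit hK in
theorem schmid_mul_left {h : U n} {c : ℂ} (hc : ∀ g, W (h * g) = c • W g) (g : U n) :
    schmidPlus W (h * g) = c • schmidPlus W g ∧ schmidMinus W (h * g) = c • schmidMinus W g := by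
  have e : ∀ X, lieDeriv X W (h * g) = c • lieDeriv X W g := fun X => by
    have h1 := hs.hasDerivAt_zero (h * g) X
    simp only [mul_assoc, hc] at h1
    exact h1.unique ((hs.hasDerivAt_zero g X).const_smul c)
  constructor <;> ext k a
  · simp only [schmidPlus, projPlus, schmidTildePlus, pPlus, lower1, lower2, e, Pi.add_apply,
      Pi.smul_apply, smul_eq_mul]
    ring
  · simp only [schmidMinus, projMinus, schmidTildeMinus, pMinus, lower1, lower2, e, Pi.add_apply,
      Pi.neg_apply, Pi.smul_apply, smul_eq_mul]
    ring

/-- The Schmid equations follow from their validity on the Levi subgroup. -/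
theorem schmid_eq_zero_of_levi [NeZero n] {T : Vec n}
    (hN : ∀ w ∈ V0 n, ∀ (t : ℝ) (g : U n),
      W (heis w t * g) = Complex.exp (-2 * Real.pi * Complex.I * ((herm T w).im : ℂ)) • W g)
    (h : ∀ (m : U n) (z : ℂˣ), IsLevi m z → schmidPlus W m = 0 ∧ schmidMinus W m = 0) (g : U n) :
    schmidPlus W g = 0 ∧ schmidMinus W g = 0 := by
  obtain ⟨w, hw, t, y, hy, -, s, k, hk, he⟩ := exists_decomposition g
  have hm : IsLevi (expU (skewTens (uVec n 1) y) * expU (s • dilation n)) (1 * expUnit s) := by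
    have := isLevi_one.mul_skewTens (uVec_one_mem_V0 (n := n)) hy
    rw [one_mul] at this
    exact this.mul_dilation s
  have h1 := h _ _ hm
  have h2 := schmid_mul_left hs (hN w hw t) (g * k)
  rw [he, h1.1, h1.2] at h2
  have h3 := (smul_eq_zero.1 h2.1.symm).resolve_left (Complex.exp_ne_zero _)
  have h4 := (smul_eq_zero.1 h2.2.symm).resolve_left (Complex.exp_ne_zero _)
  have hki := KInf_inv_mem hk
  have h5 := schmidPlus_mul_eq_zero hs hK hki h3
  have h6 := schmidMinus_mul_eq_zero hs hK hki h4
  rw [mul_inv_cancel_right] at h5 h6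
  exact ⟨h5, h6⟩

end transport

/-! ### The Schmid equations for the explicit function -/

section levi

variable [NeZero n] {T : Vec n} (hs : IsSmooth W) (hT : T ∈ V0 n)
  (hW : ∀ (m : U n) (z : ℂˣ), IsLevi m z → W m = besselFormula ℓ T m z)

include hs hT hW

theorem lieDeriv_dilation_of_levi {m : U n} {z : ℂˣ} (hm : IsLevi m z) (hb : beta T m z ≠ 0)
    (a : Fin (2 * ℓ + 1)) : lieDeriv (dilation n) W m a =
      ((‖(z : ℂ)‖ ^ (2 * ℓ + 2) : ℝ) : ℂ) * ((2 * ℓ + 2) * kap ((a : ℤ) - ℓ) (beta T m z) -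
        1 / 2 * (beta T m z * kap ((a : ℤ) - ℓ + 1) (beta T m z) +
          conj (beta T m z) * kap ((a : ℤ) - ℓ - 1) (beta T m z))) := by
  have h1 := hasDerivAt_coord hs m (dilation n) 0 a
  have e : (fun t : ℝ => W (m * expU (t • dilation n)) a) = fun t : ℝ =>
      ((‖(z : ℂ)‖ ^ (2 * ℓ + 2) : ℝ) : ℂ) * (((Real.exp ((2 * ℓ + 2) * t) : ℝ) : ℂ) *
        kap ((a : ℤ) - ℓ) (((Real.exp t : ℝ) : ℂ) * beta T m z)) := by
    funext t
    rw [hW _ _ (hm.mul_dilation t), besselFormula_eq, beta_dilation hT hm, Units.val_mul,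
      coe_expUnit, norm_mul, Complex.norm_of_nonneg (Real.exp_pos t).le, mul_pow,
      ← Real.exp_nat_mul, ← mul_assoc, ← Complex.ofReal_mul]
    push_cast
    rfl
  rw [e, zero_smul, expU_zero, mul_one] at h1
  have hB : HasDerivAt (fun t : ℝ => ((Real.exp t : ℝ) : ℂ) * beta T m z) (beta T m z) 0 := by
    simpa using ((Real.hasDerivAt_exp 0).ofReal_comp).mul_const (beta T m z)
  have hE : HasDerivAt (fun t : ℝ => ((Real.exp ((2 * ℓ + 2) * t) : ℝ) : ℂ)) (2 * ℓ + 2) 0 := by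
    have h1 : HasDerivAt (fun t : ℝ => (2 * (ℓ : ℝ) + 2) * t) (2 * ℓ + 2) 0 := by
      simpa using (hasDerivAt_id (0 : ℝ)).const_mul (2 * (ℓ : ℝ) + 2)
    simpa using h1.exp.ofReal_comp
  have h2 := (hE.mul (hasDerivAt_kap ((a : ℤ) - ℓ) hB (by simpa using hb))).const_mul
    ((‖(z : ℂ)‖ ^ (2 * ℓ + 2) : ℝ) : ℂ)
  rw [h1.unique h2]
  simp only [mul_zero, Real.exp_zero, Complex.ofReal_one, one_mul]
  ring

omit hT in
theorem lieDeriv_boost_of_levi {m : U n} {z : ℂˣ} (hm : IsLevi m z) (hb : beta T m z ≠ 0)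
    {y : Vec n} (hy : y ∈ V0 n) (hy1 : y (Sum.inl 1) = 0)
    (a : Fin (2 * ℓ + 1)) : lieDeriv (skewTens (uVec n 1) y) W m a =
      ((‖(z : ℂ)‖ ^ (2 * ℓ + 2) : ℝ) : ℂ) * (-(1 / 2) *
        (pairing T m z y * kap ((a : ℤ) - ℓ + 1) (beta T m z) +
          conj (pairing T m z y) * kap ((a : ℤ) - ℓ - 1) (beta T m z))) := by
  have h1 := hasDerivAt_coord hs m (skewTens (uVec n 1) y) 0 a
  have e : (fun t : ℝ => W (m * expU (t • skewTens (uVec n 1) y)) a) = fun t : ℝ =>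
      ((‖(z : ℂ)‖ ^ (2 * ℓ + 2) : ℝ) : ℂ) *
        kap ((a : ℤ) - ℓ) (pairing T (m * expU (t • skewTens (uVec n 1) y)) z (uVec n 1)) := by
    funext t
    rw [hW _ _ (hm.mul_smul_skewTens uVec_one_mem_V0 hy t), besselFormula_eq]
    rfl
  rw [e, zero_smul, expU_zero, mul_one] at h1
  have hB := hasDerivAt_pairing T m z (skewTens (uVec n 1) y) (uVec n 1) 0
  have en : pairing T m z (-y) = -pairing T m z y := by
    rw [← neg_one_smul ℂ, pairing_smul, neg_one_mul]
  rw [uVec_one_boost hy1, zero_smul, expU_zero, mul_one, en, neg_neg] at hB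
  have h2 := (hasDerivAt_kap ((a : ℤ) - ℓ) hB
    (by rw [zero_smul, expU_zero, mul_one]; exact hb)).const_mul
    ((‖(z : ℂ)‖ ^ (2 * ℓ + 2) : ℝ) : ℂ)
  rw [h1.unique h2, zero_smul, expU_zero, mul_one]
  rfl

variable (hN : ∀ w ∈ V0 n, ∀ (t : ℝ) (g : U n),
    W (heis w t * g) = Complex.exp (-2 * Real.pi * Complex.I * ((herm T w).im : ℂ)) • W g)
  (hK : ∀ k ∈ KInf n, ∀ g : U n, IsActK k (W g) (W (g * k)))

include hN hK

theorem schmid_eq_zero_at_levi {m : U n} {z : ℂˣ} (hm : IsLevi m z) (hb : beta T m z ≠ 0) :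
    schmidPlus W m = 0 ∧ schmidMinus W m = 0 := by
  have hWa : ∀ a, W m a = ((‖(z : ℂ)‖ ^ (2 * ℓ + 2) : ℝ) : ℂ) * kap ((a : ℤ) - ℓ) (beta T m z) :=
    fun a => by rw [hW m z hm, besselFormula_eq]
  have hcs : ∀ a : Fin (2 * ℓ), ((a.castSucc : ℕ) : ℤ) - ℓ + 1 = ((a.succ : ℕ) : ℤ) - ℓ :=
    fun a => by simp; ring
  have hsc : ∀ a : Fin (2 * ℓ), ((a.succ : ℕ) : ℤ) - ℓ - 1 = ((a.castSucc : ℕ) : ℤ) - ℓ :=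
    fun a => by simp; ring
  have hsk : ∀ k ≠ lastIdx n, ∀ a, lieDeriv (skewTens (uVec n 1) (vVec n k)) W m a = _ :=
    fun k hk a => lieDeriv_boost_of_levi hs hW hm hb (vVec_mem_V0 hk) (by simp [vVec]) a
  have hsy : ∀ k ≠ lastIdx n, ∀ a, lieDeriv (symTens (uVec n 1) (vVec n k)) W m a =
      -(((‖(z : ℂ)‖ ^ (2 * ℓ + 2) : ℝ) : ℂ) * (-(1 / 2) *
        (Complex.I * pairing T m z (vVec n k) * kap ((a : ℤ) - ℓ + 1) (beta T m z) -
          Complex.I * conj (pairing T m z (vVec n k)) * kap ((a : ℤ) - ℓ - 1) (beta T m z)))) :=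
    fun k hk a => by
      have h1 := lieDeriv_boost_of_levi hs hW hm hb
        (Submodule.smul_mem _ Complex.I (vVec_mem_V0 hk)) (by simp [vVec]) a
      rw [skewTens_I_smul_right, lieDeriv_neg_lie hs, Pi.neg_apply, pairing_smul, map_mul,
        Complex.conj_I] at h1
      rw [← neg_eq_iff_eq_neg, h1]
      ring
  rw [schmidPlus_eq_zero_iff hs hN hK hm, schmidMinus_eq_zero_iff hs hN hK hm]
  refine ⟨⟨fun a => ?_, fun k hk a => ?_⟩, ⟨fun a => ?_, fun k hk a => ?_⟩⟩
  · rw [lieDeriv_dilation_of_levi hs hT hW hm hb, hWa, hWa, hcs]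
    have hr := kap_recurrence (((a.castSucc : ℕ) : ℤ) - ℓ) hb
    rw [hcs] at hr
    push_cast at hr ⊢
    simp only [Fin.val_castSucc] at hr ⊢
    linear_combination (1 / 2 * (‖(z : ℂ)‖ : ℂ) ^ (2 * ℓ + 2)) * hr
  · simp only [pPlus, Pi.add_apply, Pi.smul_apply, smul_eq_mul]
    rw [hsk k hk, hsy k hk, hWa, hsc]
    linear_combination (-1 / 4 * ((‖(z : ℂ)‖ ^ (2 * ℓ + 2) : ℝ) : ℂ) *
      (pairing T m z (vVec n k) * kap (((a.succ : ℕ) : ℤ) - ℓ + 1) (beta T m z) -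
       conj (pairing T m z (vVec n k)) * kap (((a.castSucc : ℕ) : ℤ) - ℓ) (beta T m z))) *
        Complex.I_sq
  · rw [lieDeriv_dilation_of_levi hs hT hW hm hb, hWa, hWa, hsc]
    have hr := kap_recurrence (((a.succ : ℕ) : ℤ) - ℓ) hb
    rw [hsc] at hr
    push_cast at hr ⊢
    simp only [Fin.val_succ] at hr ⊢
    push_cast at hr ⊢
    linear_combination (-1 / 2 * (‖(z : ℂ)‖ : ℂ) ^ (2 * ℓ + 2)) * hr
  · simp only [pMinus, Pi.add_apply, Pi.smul_apply, smul_eq_mul]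
    rw [hsk k hk, hsy k hk, hWa, hcs]
    linear_combination (1 / 4 * ((‖(z : ℂ)‖ ^ (2 * ℓ + 2) : ℝ) : ℂ) *
      (pairing T m z (vVec n k) * kap (((a.succ : ℕ) : ℤ) - ℓ) (beta T m z) -
       conj (pairing T m z (vVec n k)) * kap (((a.castSucc : ℕ) : ℤ) - ℓ - 1) (beta T m z))) *
        Complex.I_sq

end levi

/-! ### The theorem on generalized Whittaker functions -/

variable [NeZero n] {T : Vec n}

theorem inl_one_ne_zero (hT : T ∈ V0 n) (hT0 : T ≠ 0) (hpos : 0 ≤ (herm T T).re) :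
    T (Sum.inl 1) ≠ 0 := fun h => hT0 (vec_eq_zero_of_herm ((mem_V0_iff _).1 hT).1 h hpos)

theorem whit_isWhittaker (hT : T ∈ V0 n) (hT0 : T ≠ 0) (hpos : 0 ≤ (herm T T).re) :
    IsWhittaker T (whit ℓ T) := by
  have hT1 := inl_one_ne_zero hT hT0 hpos
  have hs : IsSmooth (whit ℓ T) := whit_smooth hT hpos hT1
  have hK : ∀ k ∈ KInf n, ∀ g : U n, IsActK k (whit ℓ T g) (whit ℓ T (g * k)) :=
    fun k hk g => whit_equivariant T hk g
  have hN := fun (w : Vec n) (hw : w ∈ V0 n) (t : ℝ) (g : U n) =>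
    whit_character (ℓ := ℓ) hT hw t g (sqLen_pos g)
  have hS := schmid_eq_zero_of_levi hs hK hN fun m z hm =>
    schmid_eq_zero_at_levi hs hT (fun m z hm => whit_eq_besselFormula hT hm) hN hK hm
      (beta_ne_zero hT hT0 hpos hm)
  exact ⟨hs, whit_moderate hT hpos hT1, hK, hN, fun g => (hS g).1, fun g => (hS g).2⟩

theorem whit_one_ne_zero (hT : T ∈ V0 n) (hT0 : T ≠ 0) (hpos : 0 ≤ (herm T T).re)
    (a : Fin (2 * ℓ + 1)) : whit ℓ T 1 a ≠ 0 := by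
  rw [whit_eq_besselFormula hT isLevi_one, besselFormula_eq]
  refine mul_ne_zero ?_ (kap_ne_zero _ (beta_ne_zero hT hT0 hpos isLevi_one))
  simp

theorem IsWhittaker.eq_smul_whit (hℓ : 1 ≤ ℓ) (hT : T ∈ V0 n) (hT0 : T ≠ 0)
    (hpos : 0 ≤ (herm T T).re) (hW : IsWhittaker T W) :
    W = (W 1 ⟨ℓ, by omega⟩ / whit ℓ T 1 ⟨ℓ, by omega⟩) • whit ℓ T := by
  set c := W 1 ⟨ℓ, by omega⟩ / whit ℓ T 1 ⟨ℓ, by omega⟩ with hc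
  have h : W - c • whit ℓ T ∈ whittakerSpace n ℓ T :=
    Submodule.sub_mem _ hW (Submodule.smul_mem _ c (whit_isWhittaker hT hT0 hpos))
  refine sub_eq_zero.1 (IsWhittaker.eq_zero_of_nonneg h hℓ hT hT0 hpos ?_)
  rw [Pi.sub_apply, Pi.sub_apply, Pi.smul_apply, Pi.smul_apply, smul_eq_mul, hc,
    div_mul_cancel₀ _ (whit_one_ne_zero hT hT0 hpos _), sub_self]

theorem whittakerSpace_eq_span (hℓ : 1 ≤ ℓ) (hT : T ∈ V0 n) (hT0 : T ≠ 0)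
    (hpos : 0 ≤ (herm T T).re) : whittakerSpace n ℓ T = Submodule.span ℂ {whit ℓ T} := by
  refine le_antisymm (fun W hW => Submodule.mem_span_singleton.2
    ⟨_, (IsWhittaker.eq_smul_whit hℓ hT hT0 hpos hW).symm⟩) ?_
  rw [Submodule.span_singleton_le_iff_mem]
  exact whit_isWhittaker hT hT0 hpos

theorem whit_ne_zero (hT : T ∈ V0 n) (hT0 : T ≠ 0) (hpos : 0 ≤ (herm T T).re) :
    whit ℓ T ≠ 0 := fun h => whit_one_ne_zero (ℓ := ℓ) hT hT0 hpos 0 (by rw [h]; rfl)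

end

end QWhittaker
theorem theorem3p3 (n : ℕ) [NeZero n] (ℓ : ℕ) (hℓ : 1 ≤ ℓ)
    (T : QWhittaker.Vec n) (hT : T ∈ QWhittaker.V0 n) (hT0 : T ≠ 0) :
    (0 ≤ (QWhittaker.herm T T).re →
      Module.rank ℂ (QWhittaker.whittakerSpace n ℓ T) = 1) ∧
    ((QWhittaker.herm T T).re < 0 →
      Module.rank ℂ (QWhittaker.whittakerSpace n ℓ T) = 0) ∧
    (0 ≤ (QWhittaker.herm T T).re →
      ∃ W : QWhittaker.U n → QWhittaker.VEll ℓ,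
        (W ∈ QWhittaker.whittakerSpace n ℓ T ∧
          ∀ (m : QWhittaker.U n) (z : ℂˣ), QWhittaker.IsLevi m z →
            W m = QWhittaker.besselFormula ℓ T m z) ∧
        (∀ W' : QWhittaker.U n → QWhittaker.VEll ℓ,
          (W' ∈ QWhittaker.whittakerSpace n ℓ T ∧
            ∀ (m : QWhittaker.U n) (z : ℂˣ), QWhittaker.IsLevi m z →
              W' m = QWhittaker.besselFormula ℓ T m z) → W' = W) ∧
        QWhittaker.whittakerSpace n ℓ T = Submodule.span ℂ {W}) := by
  refine ⟨fun hpos => ?_, fun hneg => ?_, fun hpos => ?_⟩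
  · rw [QWhittaker.whittakerSpace_eq_span hℓ hT hT0 hpos,
      rank_submodule_eq_one_iff]
    exact ⟨_, Submodule.mem_span_singleton_self _, QWhittaker.whit_ne_zero hT hT0 hpos, le_rfl⟩
  · have : QWhittaker.whittakerSpace n ℓ T = ⊥ := (Submodule.eq_bot_iff _).2 fun W hW =>
      QWhittaker.IsWhittaker.eq_zero_of_neg hW hℓ hT hneg
    rw [this, rank_bot]
  · refine ⟨QWhittaker.whit ℓ T, ⟨QWhittaker.whit_isWhittaker hT hT0 hpos,
      fun m z hm => QWhittaker.whit_eq_besselFormula hT hm⟩, ?_,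
      QWhittaker.whittakerSpace_eq_span hℓ hT hT0 hpos⟩
    rintro W' ⟨hW', hL⟩
    rw [QWhittaker.IsWhittaker.eq_smul_whit hℓ hT hT0 hpos hW', hL 1 1 QWhittaker.isLevi_one,
      QWhittaker.whit_eq_besselFormula hT QWhittaker.isLevi_one,
      ← QWhittaker.whit_eq_besselFormula hT QWhittaker.isLevi_one,
      div_self (QWhittaker.whit_one_ne_zero hT hT0 hpos _), one_smul]
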